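/- Let $d$ be an integer and $p$ a real number with $p\ge d\ge 2$, let $q=p/(p-1)$, $\nu>0$ and $T>0$. Fix a kernel $\zeta\in C_c^\infty(\mathbb{R}^d)$ with $\zeta\ge 0$ and $\int\zeta\,dx=1$, put $J_\epsilon(x)=\epsilon^{-d}\zeta(x/\epsilon)$, and let $v_0\in L^p(\mathbb{R}^d;\mathbb{R}^d)$. For $0<\epsilon<1$ let $v^\epsilon$, with some pressure $\pi^\epsilon$, be a strong solution on $\mathbb{R}^d\times[0,T)$ of the regularized $p$-Navier–Stokes system $$\partial_t v_p^\epsilon+(J_\epsilon*v^\epsilon)\cdot\nabla v_p^\epsilon=-\nabla\pi^\epsilon+\nu\Delta_p v^\epsilon+\epsilon\Delta v_p^\epsilon,\qquad v_p^\epsilon=|v^\epsilon|^{p-2}v^\epsilon,\qquad \nabla\cdot v^\epsilon=0,\qquad v^\epsilon(\cdot,0)=J_\epsilon*v_0,$$ where $\Delta_p v=\nabla\cdot(|\nabla v|^{p-2}\nabla v)$ and $|\nabla v|=(\sum_{i,j}(\partial_iv_j)^2)^{1/2}$. Here a strong solution means: $v^\epsilon\in C([0,T);L^p(\mathbb{R}^d))\cap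 L^p_{loc}((0,T);W^{1,p}(\mathbb{R}^d))$; $v^\epsilon_p\in L^1_{loc}((0,T);W^{1,q}(\mathbb{R}^d))$; the (weak) derivatives $\partial_tv_p^\epsilon$, $\nabla\pi^\epsilon$, $\Delta_pv^\epsilon$, $\Delta v_p^\epsilon$ exist and belong to $L^1_{loc}((0,T);L^q(\mathbb{R}^d))$; and the equations hold almost everywhere. Write $\tau_hv(x,t)=v(x,t+h)$. Then $$\|\tau_hv^\epsilon-v^\epsilon\|_{L^p(0,T-h;L^p(\mathbb{R}^d))}\to0\quad\text{as }h\to0+,\ \text{uniformly in }\epsilon\in(0,1).$$ In fact, for every $M\ge 0$ there is a constant $C>0$ depending only on $d$, $p$, $\nu$, $T$ and $M$ such that, whenever $\|v_0\|_{L^p}\le M$, for all $\epsilon\in(0,1)$, all such solutions $v^\epsilon$ and all $0<h<T$, $$\|\tau_hv^\epsilon-v^\epsilon\|^p_{L^p(0,T-h;L^p(\mathbb{R}^d))}\le C\,h ,$$ and accordingly the convergence is uniform also over all such $\zeta$ and all $v_0$ with $\|v_0\|_{L^p}\le M$. -/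

import Mathlib

open MeasureTheory Set Filter Topology
open scoped ENNReal NNReal Convolution

noncomputable section

namespace PNS

/-- Euclidean space `ℝ^d`. -/
abbrev Vec (d : ℕ) : Type := EuclideanSpace ℝ (Fin d)

/-- Real `d × d` matrices with the Euclidean (Frobenius) norm `|A| = (∑_{ij} A_{ij}^2)^{1/2}`.
For a gradient the entry `(i, j)` is `∂_i v_j`. -/
abbrev Mat (d : ℕ) : Type := EuclideanSpace ℝ (Fin d × Fin d)

/-- The map `a ↦ |a|^{p-2} a`.  Applied to a velocity it gives the `p`-momentum `v_p`. -/
def pPower {F : Type*} [NormedAddCommGroup F] [NormedSpace ℝ F] (p : ℝ) (a : F) : F :=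
  (‖a‖ ^ (p - 2)) • a

/-- The conjugate exponent `q = p / (p - 1)`. -/
def conjExp (p : ℝ) : ℝ := p / (p - 1)

/-- Real-valued test functions on `ℝ^d`. -/
def IsTest {d : ℕ} (φ : Vec d → ℝ) : Prop := ContDiff ℝ ((⊤ : ℕ∞) : WithTop ℕ∞) φ ∧ HasCompactSupport φ

/-- The classical partial derivative `∂_i φ`. -/
def partialD {d : ℕ} (i : Fin d) (φ : Vec d → ℝ) (x : Vec d) : ℝ :=
  fderiv ℝ φ x (EuclideanSpace.single i 1)

/-- `g` is the weak partial derivative `∂_i f`. -/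
def HasWeakPartial {d : ℕ} (i : Fin d) (f g : Vec d → ℝ) : Prop :=
  LocallyIntegrable f ∧ LocallyIntegrable g ∧
    ∀ φ : Vec d → ℝ, IsTest φ → ∫ x, f x * partialD i φ x = -∫ x, g x * φ x

/-- The weak gradient of a scalar function `f` is the vector field `g`. -/
def HasWeakGradScalar {d : ℕ} (f : Vec d → ℝ) (g : Vec d → Vec d) : Prop :=
  ∀ i, HasWeakPartial i f (fun x => g x i)

/-- The weak gradient of a vector field `w` is the matrix field `A`, `A_{ij} = ∂_i w_j`. -/
def HasWeakGrad {d : ℕ} (w : Vec d → Vec d) (A : Vec d → Mat d) : Prop :=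
  ∀ i j, HasWeakPartial i (fun x => w x j) (fun x => A x (i, j))

/-- The weak divergence of the matrix field `A` is the vector field `b`, `b_j = ∑_i ∂_i A_{ij}`. -/
def HasWeakDiv {d : ℕ} (A : Vec d → Mat d) (b : Vec d → Vec d) : Prop :=
  LocallyIntegrable A ∧ LocallyIntegrable b ∧
    ∀ j, ∀ φ : Vec d → ℝ, IsTest φ →
      ∑ i, ∫ x, A x (i, j) * partialD i φ x = -∫ x, b x j * φ x

/-- `f ∈ L^r_loc((0,T); L^s(ℝ^d))`, for finite `r`. -/
def MemLpLoc {d : ℕ} {F : Type*} [NormedAddCommGroup F] (T r s : ℝ) (f : ℝ → Vec d → F) : Prop :=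
  AEStronglyMeasurable (Function.uncurry f) ((volume.restrict (Ioo 0 T)).prod volume) ∧
    ∀ a b : ℝ, 0 < a → a < b → b < T →
      ∫⁻ t in Ioo a b, (eLpNorm (f t) (ENNReal.ofReal s) volume) ^ r < ∞

/-- `f ∈ C([0,T); L^s(ℝ^d))`. -/
def ContinuousInLp {d : ℕ} {F : Type*} [NormedAddCommGroup F] (T s : ℝ) (f : ℝ → Vec d → F) :
    Prop :=
  (∀ t ∈ Ico 0 T, MemLp (f t) (ENNReal.ofReal s) volume) ∧
    ∀ t₀ ∈ Ico 0 T,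
      Tendsto (fun t => eLpNorm (f t - f t₀) (ENNReal.ofReal s) volume) (𝓝[Ico 0 T] t₀) (𝓝 0)

/-- An admissible mollifier: `ζ ∈ C_c^∞(ℝ^d)`, `ζ ≥ 0`, `∫ ζ = 1`. -/
structure IsMollifier {d : ℕ} (ζ : Vec d → ℝ) : Prop where
  test : IsTest ζ
  nonneg : ∀ x, 0 ≤ ζ x
  integral_eq_one : ∫ x, ζ x = 1

/-- `J_ε(x) = ε^{-d} ζ(x / ε)`. -/
def J {d : ℕ} (ζ : Vec d → ℝ) (ε : ℝ) (x : Vec d) : ℝ := (1 / ε ^ d) * ζ (ε⁻¹ • x)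

/-- The mollification `J_ε * w`. -/
def mollify {d : ℕ} (ζ : Vec d → ℝ) (ε : ℝ) (w : Vec d → Vec d) : Vec d → Vec d :=
  J ζ ε ⋆[ContinuousLinearMap.lsmul ℝ ℝ, volume] w

/-- The fields `v`, `π` together with
* `Dv = ∇v`, `Dvp = ∇v_p`,
* `dtvp = ∂_t v_p`,
* `gradπ = ∇π`,
* `pLap = Δ_p v = ∇·(|∇v|^{p-2} ∇v)`,
* `lap = Δ v_p = ∇·∇v_p`,

satisfy the regularized `p`-Navier-Stokes system
`∂_t v_p + (J_ε * v)·∇v_p = -∇π + ν Δ_p v + ε Δ v_p`, `v_p = |v|^{p-2} v`, `∇·v = 0`,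
`v(0) = J_ε * v₀` on `ℝ^d × [0,T)`, almost everywhere and with all terms of the momentum equation
in `L^1_loc((0,T); L^q(ℝ^d))`. All the spatial derivatives are weak derivatives. -/
structure IsStrongSolutionWith {d : ℕ} (ζ : Vec d → ℝ) (p ν ε T : ℝ) (v₀ : Vec d → Vec d)
    (v : ℝ → Vec d → Vec d) (π : ℝ → Vec d → ℝ)
    (Dv Dvp : ℝ → Vec d → Mat d) (dtvp gradπ pLap lap : ℝ → Vec d → Vec d) : Prop where
  /-- `v` is jointly measurable. -/
  v_meas : AEStronglyMeasurable (Function.uncurry v) ((volume.restrict (Ioo 0 T)).prod volume)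
  /-- `v ∈ C([0,T); L^p)`. -/
  v_cont : ContinuousInLp T p v
  /-- the initial condition. -/
  v_init : v 0 =ᵐ[volume] mollify ζ ε v₀
  /-- `v ∈ L^p_loc((0,T); W^{1,p})`. -/
  Dv_mem : MemLpLoc T p p Dv
  Dv_grad : ∀ᵐ t ∂(volume.restrict (Ioo 0 T)), HasWeakGrad (v t) (Dv t)
  /-- `v_p ∈ L^1_loc((0,T); W^{1,q})`. -/
  Dvp_mem : MemLpLoc T 1 (conjExp p) Dvp
  Dvp_grad : ∀ᵐ t ∂(volume.restrict (Ioo 0 T)),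
    HasWeakGrad (fun x => pPower p (v t x)) (Dvp t)
  /-- `v_p ∈ W^{1,1}_loc((0,T); L^q)`, with time derivative `dtvp`. -/
  dtvp_mem : MemLpLoc T 1 (conjExp p) dtvp
  dtvp_deriv : ∀ s t : ℝ, 0 < s → s < t → t < T → ∀ᵐ x ∂(volume : Measure (Vec d)),
    pPower p (v t x) - pPower p (v s x) = ∫ r in s..t, dtvp r x
  gradπ_mem : MemLpLoc T 1 (conjExp p) gradπ
  gradπ_grad : ∀ᵐ t ∂(volume.restrict (Ioo 0 T)), HasWeakGradScalar (π t) (gradπ t)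
  pLap_mem : MemLpLoc T 1 (conjExp p) pLap
  pLap_div : ∀ᵐ t ∂(volume.restrict (Ioo 0 T)),
    HasWeakDiv (fun x => pPower p (Dv t x)) (pLap t)
  lap_mem : MemLpLoc T 1 (conjExp p) lap
  lap_div : ∀ᵐ t ∂(volume.restrict (Ioo 0 T)), HasWeakDiv (Dvp t) (lap t)
  /-- the momentum equation. -/
  momentum : ∀ᵐ t ∂(volume.restrict (Ioo 0 T)), ∀ᵐ x ∂(volume : Measure (Vec d)), ∀ j,
    dtvp t x j + ∑ i, mollify ζ ε (v t) x i * Dvp t x (i, j)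
      = -(gradπ t x j) + ν * pLap t x j + ε * lap t x j
  /-- incompressibility. -/
  div_free : ∀ᵐ t ∂(volume.restrict (Ioo 0 T)), ∀ᵐ x ∂(volume : Measure (Vec d)),
    ∑ i, Dv t x (i, i) = 0

/-- `(v, π)` is a strong solution of the regularized `p`-Navier-Stokes system (with `γ = p`) on
`ℝ^d × [0,T)` with parameter `ε` and initial value `J_ε * v₀`. -/
def IsStrongSolution {d : ℕ} (ζ : Vec d → ℝ) (p ν ε T : ℝ) (v₀ : Vec d → Vec d)
    (v : ℝ → Vec d → Vec d) (π : ℝ → Vec d → ℝ) : Prop :=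
  ∃ (Dv Dvp : ℝ → Vec d → Mat d) (dtvp gradπ pLap lap : ℝ → Vec d → Vec d),
    IsStrongSolutionWith ζ p ν ε T v₀ v π Dv Dvp dtvp gradπ pLap lap

/-- The time shift `τ_h v(x, t) = v(x, t + h)`. -/
def timeShift {d : ℕ} (h : ℝ) (v : ℝ → Vec d → Vec d) : ℝ → Vec d → Vec d := fun t => v (t + h)

/-- The norm of `L^p(0, S; L^p(ℝ^d))`, as an extended real number. -/
def normLpLp {d : ℕ} (p S : ℝ) (f : ℝ → Vec d → Vec d) : ℝ≥0∞ :=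
  (∫⁻ t in Ioo 0 S, (eLpNorm (f t) (ENNReal.ofReal p) volume) ^ p) ^ (1 / p)

end PNS

end

/-!
The increment `w = v(t + h) - v(t)` is controlled by the strong monotonicity of `a ↦ |a|^{p-2} a`,
`norm_sub_rpow_le_inner`:
`‖w‖_p^p ≤ 2^{p-1} ∫ (v_p(t + h) - v_p(t)) · w dx = 2^{p-1} ∫_t^{t+h} ∫ ∂_t v_p(r) · w dx dr`.
As `w` is divergence-free and belongs to `W^{1,p}` for almost every `t`, the inner integral can be
computed from the momentum equation at the time `r`, and `exists_abs_integral_inner_dt_le` bounds it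
by `C (1 + ‖∇v(r)‖_p^p + ‖∇w‖_p^p)`, with `C` independent of `ε` and `ζ`. Integration over `t` and
Tonelli's theorem bound the time integral of `‖w‖_p^p` by `C h (T + ∫_0^T ‖∇v‖_p^p dt)`
(`IsStrongSolutionWith.lintegral_eLpNorm_sub_rpow_le`), and the energy inequality bounds the total
dissipation by `‖v₀‖_p^p / ν` (`IsStrongSolutionWith.lintegral_dissipation_le`).

The hypothesis `p ≥ d` is needed for the convection term `∫ (J_ε * v) ⊗ v_p : ∇w`. It requires a
bound for `‖v‖_{pq}^{pq}` by `C (1 + ‖∇v‖_p^p)` when `‖v‖_p` is bounded; this follows from the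
Gagliardo-Nirenberg inequality, itself the Sobolev inequality of exponent `1` for `|v|^p`
(`exists_lintegral_rpow_mul_conjExp_le`).

All the integrations by parts in space are carried out with correlations
`corr f g y = ∫ f(x + y) g(x) dx` of functions in dual Lebesgue spaces. They are continuous in `y`,
and a weak derivative of a factor is a classical derivative of the correlation (`hasDerivAt_corr`),
so that identities between distributions can be evaluated at `y = 0` without approximating by test
functions. In this way one obtains
* the integration by parts itself (`sum_integral_mul_eq_neg`) and the vanishing of the pressure term
  (`sum_integral_grad_mul_eq_zero`), as a correlation tends to zero at infinity;
* the sign and the bound of the term `ε Δ v_p` (`integral_inner_partial_pPower_nonneg`,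
  `abs_integral_inner_partial_pPower_le`) and the cancellation of the convection term in the energy
  balance (`integral_mul_inner_pPower_partial`), from monotonicity, Lipschitz and convexity
  properties of `a ↦ |a|^{p-2} a` applied to difference quotients. No pointwise chain rule for
  `∇v_p` is used.

For the energy inequality in time (`energy_sub_le`), convexity gives
`(‖v(t)‖_p^p - ‖v(s)‖_p^p) / q ≤ ∫_s^t ∫ ∂_t v_p(r) · v(t) dx dr` with `1 / q = (p - 1) / p`. On short
intervals `v(t)` may be replaced by `v(r)` because `v` is uniformly continuous with values in `L^p`.
-/

namespace PNS

/-! ### The map `a ↦ |a|^{p-2} a` -/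

section Pointwise

variable {F : Type*} [NormedAddCommGroup F] [InnerProductSpace ℝ F] {p : ℝ}

theorem holderConjugate_conjExp (hp : 2 ≤ p) : p.HolderConjugate (conjExp p) :=
  Real.HolderConjugate.conjExponent (by linarith)

theorem rpow_sub_two_mul_self (hp : 2 ≤ p) {x : ℝ} (hx : 0 ≤ x) :
    x ^ (p - 2) * x = x ^ (p - 1) := by
  rcases hx.eq_or_lt with rfl | h
  · rw [mul_zero, Real.zero_rpow (by linarith)]
  · rw [← Real.rpow_add_one h.ne']; ring_nf

theorem rpow_sub_one_mul_self (hp : 2 ≤ p) {x : ℝ} (hx : 0 ≤ x) :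
    x ^ (p - 1) * x = x ^ p := by
  rcases hx.eq_or_lt with rfl | h
  · rw [mul_zero, Real.zero_rpow (by linarith)]
  · rw [← Real.rpow_add_one h.ne']; ring_nf

theorem norm_pPower (hp : 2 ≤ p) (a : F) : ‖pPower p a‖ = ‖a‖ ^ (p - 1) := by
  rw [pPower, norm_smul, Real.norm_of_nonneg (by positivity),
    rpow_sub_two_mul_self hp (norm_nonneg a)]

theorem inner_pPower_self (hp : 2 ≤ p) (a : F) : inner ℝ (pPower p a) a = ‖a‖ ^ p := by
  rw [pPower, real_inner_smul_left, real_inner_self_eq_norm_sq, sq, ← mul_assoc,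
    rpow_sub_two_mul_self hp (norm_nonneg a), rpow_sub_one_mul_self hp (norm_nonneg a)]

theorem continuous_pPower (hp : 2 ≤ p) : Continuous (pPower p : F → F) := by
  unfold pPower
  exact (continuous_norm.rpow_const fun _ => Or.inr (by linarith)).smul continuous_id

/-- `|a|^p` is convex with gradient `p |a|^{p-2} a`. -/
theorem inner_pPower_sub_le (hp : 2 ≤ p) (a b : F) :
    p * inner ℝ (pPower p a) (b - a) ≤ ‖b‖ ^ p - ‖a‖ ^ p := by
  have hc := holderConjugate_conjExp hp
  have h1 : inner ℝ (pPower p a) b ≤ ‖a‖ ^ (p - 1) * ‖b‖ :=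
    (real_inner_le_norm _ _).trans_eq (by rw [norm_pPower hp])
  have h2 := Real.young_inequality_of_nonneg (norm_nonneg b)
    (Real.rpow_nonneg (norm_nonneg a) (p - 1)) hc
  have h3 : (‖a‖ ^ (p - 1)) ^ conjExp p = ‖a‖ ^ p := by
    rw [← Real.rpow_mul (norm_nonneg a)]
    congr 1
    have : p - 1 ≠ 0 := by linarith
    unfold conjExp; field_simp
  rw [h3] at h2
  have h4 : ‖a‖ ^ p / conjExp p = ‖a‖ ^ p - ‖a‖ ^ p / p := by
    have : p - 1 ≠ 0 := by linarith
    have : p ≠ 0 := by linarith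
    unfold conjExp; field_simp
  rw [h4] at h2
  have hp0 : 0 < p := by linarith
  have h5 : p * inner ℝ (pPower p a) b ≤ p * (‖b‖ ^ p / p + (‖a‖ ^ p - ‖a‖ ^ p / p)) := by
    gcongr; linarith
  rw [inner_sub_right, inner_pPower_self hp]
  have h6 : p * (‖b‖ ^ p / p + (‖a‖ ^ p - ‖a‖ ^ p / p)) = ‖b‖ ^ p + p * ‖a‖ ^ p - ‖a‖ ^ p := by
    field_simp; ring
  linarith

/-- Strong monotonicity of `a ↦ |a|^{p-2} a`. -/
theorem norm_sub_rpow_le_inner (hp : 2 ≤ p) (a b : F) :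
    ‖a - b‖ ^ p ≤ 2 ^ (p - 1) * inner ℝ (pPower p a - pPower p b) (a - b) := by
  set α := ‖a‖ ^ (p - 2) with hα
  set β := ‖b‖ ^ (p - 2) with hβ
  have hα0 : 0 ≤ α := by positivity
  have hβ0 : 0 ≤ β := by positivity
  -- the second summand is nonnegative because `α`, `β` are ordered like `‖a‖`, `‖b‖`
  have key : inner ℝ (pPower p a - pPower p b) (a - b) =
      (α + β) / 2 * ‖a - b‖ ^ 2 + (α - β) * (‖a‖ ^ 2 - ‖b‖ ^ 2) / 2 := by
    simp only [pPower, ← hα, ← hβ]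
    rw [norm_sub_sq_real]
    simp only [inner_sub_left, inner_sub_right, real_inner_smul_left, real_inner_self_eq_norm_sq,
      real_inner_comm a b]
    ring
  have hmon : 0 ≤ (α - β) * (‖a‖ ^ 2 - ‖b‖ ^ 2) := by
    rcases le_total ‖a‖ ‖b‖ with h | h
    · exact mul_nonneg_of_nonpos_of_nonpos
        (sub_nonpos.2 (Real.rpow_le_rpow (norm_nonneg _) h (by linarith)))
        (sub_nonpos.2 (by gcongr))
    · exact mul_nonneg (sub_nonneg.2 (Real.rpow_le_rpow (norm_nonneg _) h (by linarith)))
        (sub_nonneg.2 (by gcongr))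
  have hmax : ‖a - b‖ ^ (p - 2) ≤ 2 ^ (p - 2) * (α + β) := by
    have h1 : ‖a - b‖ ≤ 2 * max ‖a‖ ‖b‖ := by
      have := norm_sub_le a b
      have := le_max_left ‖a‖ ‖b‖
      have := le_max_right ‖a‖ ‖b‖
      linarith
    calc ‖a - b‖ ^ (p - 2) ≤ (2 * max ‖a‖ ‖b‖) ^ (p - 2) :=
          Real.rpow_le_rpow (norm_nonneg _) h1 (by linarith)
      _ = 2 ^ (p - 2) * (max ‖a‖ ‖b‖) ^ (p - 2) := by
          rw [Real.mul_rpow (by norm_num) (by positivity)]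
      _ ≤ _ := by
          gcongr
          rcases max_choice ‖a‖ ‖b‖ with h | h <;> rw [h] <;> linarith
  have hsplit : ‖a - b‖ ^ p = ‖a - b‖ ^ (p - 2) * ‖a - b‖ ^ 2 := by
    rw [sq, ← mul_assoc, rpow_sub_two_mul_self hp (norm_nonneg _),
      rpow_sub_one_mul_self hp (norm_nonneg _)]
  have h2 : (2 : ℝ) ^ (p - 1) = 2 * 2 ^ (p - 2) := by
    rw [← rpow_sub_two_mul_self hp (by norm_num)]; ring
  rw [hsplit, key, h2]
  have : 0 ≤ (2 : ℝ) ^ (p - 2) * ((α - β) * (‖a‖ ^ 2 - ‖b‖ ^ 2)) := by positivity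
  nlinarith [mul_le_mul_of_nonneg_right hmax (sq_nonneg ‖a - b‖)]

theorem inner_pPower_sub_nonneg (hp : 2 ≤ p) (a b : F) :
    0 ≤ inner ℝ (pPower p a - pPower p b) (a - b) :=
  nonneg_of_mul_nonneg_right ((Real.rpow_nonneg (norm_nonneg _) p).trans
    (norm_sub_rpow_le_inner hp a b)) (by positivity)

theorem rpow_sub_one_sub_le (hp : 2 ≤ p) {x y : ℝ} (hx : 0 ≤ x) (hxy : x ≤ y) :
    y ^ (p - 1) - x ^ (p - 1) ≤ (p - 1) * y ^ (p - 2) * (y - x) := by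
  rcases hxy.eq_or_lt with rfl | hlt
  · simp
  have hy : 0 < y := hx.trans_lt hlt
  -- Bernoulli's inequality for `x / y`
  have hB := one_add_mul_self_le_rpow_one_add (s := x / y - 1)
    (by have : 0 ≤ x / y := by positivity
        linarith) (p := p - 1) (by linarith)
  rw [add_sub_cancel, Real.div_rpow hx hy.le] at hB
  have hy1 : 0 < y ^ (p - 1) := by positivity
  have h3 := mul_le_mul_of_nonneg_right hB hy1.le
  rw [div_mul_cancel₀ _ hy1.ne', ← rpow_sub_two_mul_self hp hy.le] at h3
  rw [← rpow_sub_two_mul_self hp hy.le]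
  have h4 : (1 + (p - 1) * (x / y - 1)) * (y ^ (p - 2) * y)
      = y ^ (p - 2) * y - (p - 1) * y ^ (p - 2) * (y - x) := by field_simp; ring
  linarith

theorem norm_pPower_sub_le_of_le (hp : 2 ≤ p) (a b : F) (h : ‖a‖ ≤ ‖b‖) :
    ‖pPower p b - pPower p a‖ ≤ p * ‖b‖ ^ (p - 2) * ‖b - a‖ := by
  set α := ‖a‖ ^ (p - 2) with hα
  set β := ‖b‖ ^ (p - 2) with hβ
  have hα0 : 0 ≤ α := by positivity
  have hαβ : α ≤ β := Real.rpow_le_rpow (norm_nonneg _) h (by linarith)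
  have h1 : pPower p b - pPower p a = α • (b - a) + (β - α) • b := by
    simp only [pPower, ← hα, ← hβ, smul_sub, sub_smul]; abel
  have h2 := rpow_sub_one_sub_le hp (norm_nonneg a) h
  rw [← rpow_sub_two_mul_self hp (norm_nonneg a), ← rpow_sub_two_mul_self hp (norm_nonneg b),
    ← hα, ← hβ] at h2
  have h3 : ‖b‖ - ‖a‖ ≤ ‖b - a‖ := norm_sub_norm_le b a
  rw [h1]
  calc ‖α • (b - a) + (β - α) • b‖ ≤ α * ‖b - a‖ + (β - α) * ‖b‖ := by
        refine (norm_add_le _ _).trans ?_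
        rw [norm_smul, norm_smul, Real.norm_of_nonneg hα0, Real.norm_of_nonneg (sub_nonneg.2 hαβ)]
    _ ≤ _ := by
        have h4 : (p - 1) * β * (‖b‖ - ‖a‖) ≤ (p - 1) * β * ‖b - a‖ := by
          have : 0 ≤ p - 1 := by linarith
          have : 0 ≤ β := hα0.trans hαβ
          gcongr
        have h5 : α * ‖b - a‖ ≤ β * ‖b - a‖ := by gcongr
        have h6 : 0 ≤ α * (‖b‖ - ‖a‖) := mul_nonneg hα0 (by linarith)
        nlinarith

/-- The map `a ↦ |a|^{p-2} a` is locally Lipschitz. -/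
theorem norm_pPower_sub_le (hp : 2 ≤ p) (a b : F) :
    ‖pPower p b - pPower p a‖ ≤ p * (‖a‖ + ‖b‖) ^ (p - 2) * ‖b - a‖ := by
  rcases le_total ‖a‖ ‖b‖ with h | h
  · refine (norm_pPower_sub_le_of_le hp a b h).trans ?_
    have : 0 ≤ p - 2 := by linarith
    gcongr
    linarith [norm_nonneg a]
  · rw [norm_sub_rev, norm_sub_rev b]
    refine (norm_pPower_sub_le_of_le hp b a h).trans ?_
    have : 0 ≤ p - 2 := by linarith
    gcongr
    linarith [norm_nonneg b]

/-- Young's inequality for the exponents `p / (p - 2)`, `p`, `p`, with constants `1`. It is read off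
from the largest of the three numbers, which also covers `p = 2`. -/
theorem rpow_mul_mul_le (hp : 2 ≤ p) {x y z : ℝ} (hx : 0 ≤ x) (hy : 0 ≤ y) (hz : 0 ≤ z) :
    x ^ (p - 2) * y * z ≤ x ^ p + y ^ p + z ^ p := by
  have hp2 : 0 ≤ p - 2 := by linarith
  have hmax : ∀ m, 0 ≤ m → x ≤ m → y ≤ m → z ≤ m → x ^ (p - 2) * y * z ≤ m ^ p := by
    intro m hm h1 h2 h3
    rw [← rpow_sub_one_mul_self hp hm, ← rpow_sub_two_mul_self hp hm]
    gcongr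
  have := Real.rpow_nonneg hx p
  have := Real.rpow_nonneg hy p
  have := Real.rpow_nonneg hz p
  rcases le_total x y with h1 | h1 <;> rcases le_total y z with h2 | h2 <;>
    rcases le_total x z with h3 | h3
  · linarith [hmax z hz h3 h2 le_rfl]
  · linarith [hmax z hz (h1.trans h2) h2 le_rfl]
  · linarith [hmax y hy h1 le_rfl h2]
  · linarith [hmax y hy h1 le_rfl h2]
  · linarith [hmax z hz h3 h2 le_rfl]
  · linarith [hmax x hx le_rfl h1 h3]
  · linarith [hmax x hx le_rfl h1 (h2.trans h1)]
  · linarith [hmax x hx le_rfl h1 h3]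

theorem add_rpow_le_two_rpow_mul (hp : 2 ≤ p) {x y : ℝ} (hx : 0 ≤ x) (hy : 0 ≤ y) :
    (x + y) ^ p ≤ 2 ^ p * (x ^ p + y ^ p) := by
  have h : x + y ≤ 2 * max x y := by linarith [le_max_left x y, le_max_right x y]
  calc (x + y) ^ p ≤ (2 * max x y) ^ p := by gcongr
    _ = 2 ^ p * (max x y) ^ p := by rw [Real.mul_rpow (by norm_num) (by positivity)]
    _ ≤ _ := by
        have := Real.rpow_nonneg hx p
        have := Real.rpow_nonneg hy p
        gcongr
        rcases max_choice x y with h | h <;> rw [h] <;> linarith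

theorem norm_sub_rpow_le {G : Type*} [NormedAddCommGroup G] (hp : 2 ≤ p) (a b : G) :
    ‖a - b‖ ^ p ≤ 2 ^ p * (‖a‖ ^ p + ‖b‖ ^ p) :=
  (Real.rpow_le_rpow (norm_nonneg _) (norm_sub_le a b) (by linarith)).trans
    (add_rpow_le_two_rpow_mul hp (norm_nonneg a) (norm_nonneg b))

end Pointwise

section Lebesgue

variable {F : Type*} [NormedAddCommGroup F] [InnerProductSpace ℝ F] {p : ℝ}
  {α : Type*} [MeasurableSpace α] {μ : Measure α}

/-- `|f|^{p-2} f ∈ L^q` for `f ∈ L^p`. -/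
theorem memLp_pPower {f : α → F} (hp : 2 ≤ p) (hf : MemLp f (ENNReal.ofReal p) μ) :
    MemLp (fun x => pPower p (f x)) (ENNReal.ofReal (conjExp p)) μ := by
  have hc := holderConjugate_conjExp hp
  have h1 := hf.norm_rpow_div (ENNReal.ofReal (p - 1))
  rw [ENNReal.toReal_ofReal (by linarith), ← ENNReal.ofReal_div_of_pos (by linarith)] at h1
  refine h1.congr_norm ((continuous_pPower hp).comp_aestronglyMeasurable hf.1)
    (Eventually.of_forall fun x => ?_)
  rw [norm_pPower hp, Real.norm_of_nonneg (by positivity)]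

theorem integrable_norm_rpow {G : Type*} [NormedAddCommGroup G] {f : α → G} (hp : 0 < p)
    (hf : MemLp f (ENNReal.ofReal p) μ) : Integrable (fun x => ‖f x‖ ^ p) μ := by
  have := hf.integrable_norm_rpow (by simpa using hp) ENNReal.ofReal_ne_top
  rwa [ENNReal.toReal_ofReal hp.le] at this

theorem ofReal_integral_rpow {G : Type*} [NormedAddCommGroup G] {f : α → G} (hp : 0 < p)
    (hf : MemLp f (ENNReal.ofReal p) μ) :
    ENNReal.ofReal (∫ x, ‖f x‖ ^ p ∂μ) = ∫⁻ x, ‖f x‖ₑ ^ p ∂μ := by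
  rw [ofReal_integral_eq_lintegral_ofReal (integrable_norm_rpow hp hf)
    (Eventually.of_forall fun x => by positivity)]
  refine lintegral_congr fun x => ?_
  rw [← ENNReal.ofReal_rpow_of_nonneg (norm_nonneg _) hp.le, ofReal_norm]

theorem eLpNorm_rpow_eq {G : Type*} [NormedAddCommGroup G] (f : α → G) (hp : 0 < p) :
    eLpNorm f (ENNReal.ofReal p) μ ^ p = ∫⁻ x, ‖f x‖ₑ ^ p ∂μ := by
  rw [eLpNorm_eq_lintegral_rpow_enorm_toReal (by simpa using hp) ENNReal.ofReal_ne_top,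
    ENNReal.toReal_ofReal hp.le, ← ENNReal.rpow_mul, one_div, inv_mul_cancel₀ hp.ne',
    ENNReal.rpow_one]

end Lebesgue

/-! ### Correlation integrals -/

section Correlation

variable {d : ℕ} {P Q : ℝ≥0∞}

/-- The correlation `y ↦ ∫ f(x + y) g(x) dx` of two scalar functions. -/
noncomputable def corr (f g : Vec d → ℝ) (y : Vec d) : ℝ := ∫ x, f (x + y) * g x

theorem memLp_translate {E : Type*} [NormedAddCommGroup E] {f : Vec d → E} (hf : MemLp f P volume)
    (y : Vec d) : MemLp (fun x => f (x + y)) P volume :=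
  hf.comp_measurePreserving (measurePreserving_add_right volume y)

theorem lintegral_enorm_mul_le [P.HolderConjugate Q] {α : Type*} [MeasurableSpace α]
    {μ : Measure α} {f g : α → ℝ} (hf : AEStronglyMeasurable f μ) (hg : AEStronglyMeasurable g μ) :
    ∫⁻ x, ‖f x * g x‖ₑ ∂μ ≤ eLpNorm f P μ * eLpNorm g Q μ := by
  have h : eLpNorm (f • g) 1 μ ≤ eLpNorm f P μ * eLpNorm g Q μ :=
    eLpNorm_smul_le_mul_eLpNorm (p := P) (q := Q) (r := 1) hg hf
  rwa [eLpNorm_one_eq_lintegral_enorm] at h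

theorem enorm_integral_mul_le [P.HolderConjugate Q] {α : Type*} [MeasurableSpace α]
    {μ : Measure α} {f g : α → ℝ} (hf : MemLp f P μ) (hg : MemLp g Q μ) :
    ‖∫ x, f x * g x ∂μ‖ₑ ≤ eLpNorm f P μ * eLpNorm g Q μ := by
  exact (enorm_integral_le_lintegral_enorm _).trans (lintegral_enorm_mul_le hf.1 hg.1)

theorem integrable_corr [P.HolderConjugate Q] {f g : Vec d → ℝ} (hf : MemLp f P volume)
    (hg : MemLp g Q volume) (y : Vec d) : Integrable (fun x => f (x + y) * g x) :=
  (memLp_translate hf y).integrable_mul hg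

theorem eLpNorm_translate {E : Type*} [NormedAddCommGroup E] {f : Vec d → E}
    (hf : MemLp f P volume) (y : Vec d) :
    eLpNorm (fun x => f (x + y)) P volume = eLpNorm f P volume :=
  eLpNorm_comp_measurePreserving hf.1 (measurePreserving_add_right volume y)

theorem enorm_corr_le [P.HolderConjugate Q] {f g : Vec d → ℝ} (hf : MemLp f P volume)
    (hg : MemLp g Q volume) (y : Vec d) :
    ‖corr f g y‖ₑ ≤ eLpNorm f P volume * eLpNorm g Q volume := by
  rw [← eLpNorm_translate hf y]
  exact enorm_integral_mul_le (memLp_translate hf y) hg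

/-- Translations are strongly continuous in `L^P`, for finite `P`. -/
theorem tendsto_eLpNorm_translate_sub {E : Type*} [NormedAddCommGroup E] (h1 : 1 ≤ P) (hP : P ≠ ∞)
    {f : Vec d → E} (hf : MemLp f P volume) (y₀ : Vec d) :
    Tendsto (fun y => eLpNorm (fun x => f (x + y) - f (x + y₀)) P volume) (𝓝 y₀) (𝓝 0) := by
  have : Fact (1 ≤ P) := ⟨h1⟩
  let g : C(Vec d, C(Vec d, Vec d)) :=
    (ContinuousMap.mk (fun a : Vec d × Vec d => a.2 + a.1) (by fun_prop)).curry
  have hg : ∀ y, MeasurePreserving (g y) (volume : Measure (Vec d)) volume :=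
    fun y => measurePreserving_add_right volume y
  have h2 : Continuous (fun y => Lp.compMeasurePreserving (g y) (hg y) (hf.toLp f)) :=
    continuous_const.compMeasurePreservingLp g.continuous hg hP
  have h3 := (h2.tendsto y₀)
  simp only [Lp.toLp_compMeasurePreserving] at h3
  rw [Lp.tendsto_Lp_iff_tendsto_eLpNorm'' _ (fun y => hf.comp_measurePreserving (hg y)) _
    (hf.comp_measurePreserving (hg y₀))] at h3
  exact h3

theorem corr_sub [P.HolderConjugate Q] {f g : Vec d → ℝ} (hf : MemLp f P volume)
    (hg : MemLp g Q volume) (y y₀ : Vec d) :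
    corr f g y - corr f g y₀ = ∫ x, (f (x + y) - f (x + y₀)) * g x := by
  unfold corr
  rw [← integral_sub (integrable_corr hf hg y) (integrable_corr hf hg y₀)]
  simp only [sub_mul]

theorem continuous_corr [hPQ : P.HolderConjugate Q] (hP : P ≠ ∞) {f g : Vec d → ℝ}
    (hf : MemLp f P volume) (hg : MemLp g Q volume) : Continuous (corr f g) := by
  rw [continuous_iff_continuousAt]
  intro y₀
  rw [ContinuousAt, tendsto_iff_edist_tendsto_0]
  have h := tendsto_eLpNorm_translate_sub (ENNReal.HolderConjugate.one_le P Q) hP hf y₀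
  have h2 := ENNReal.Tendsto.mul_const (b := eLpNorm g Q volume) h (Or.inr hg.2.ne)
  rw [zero_mul] at h2
  refine tendsto_of_tendsto_of_tendsto_of_le_of_le tendsto_const_nhds h2 (fun _ => zero_le)
    fun y => ?_
  dsimp only
  rw [edist_eq_enorm_sub, corr_sub hf hg]
  exact enorm_integral_mul_le ((memLp_translate hf y).sub (memLp_translate hf y₀)) hg

/-- Correlations vanish at infinity. -/
theorem tendsto_corr_cocompact [hPQ : P.HolderConjugate Q] (hP : P ≠ ∞) (hQ : Q ≠ ∞)
    {f g : Vec d → ℝ} (hf : MemLp f P volume) (hg : MemLp g Q volume) :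
    Tendsto (corr f g) (cocompact (Vec d)) (𝓝 0) := by
  rw [EMetric.tendsto_nhds]
  intro ε hε
  -- replace `f` and `g` by compactly supported functions, at the cost of `ε / 3` each
  set A := eLpNorm f P volume with hA
  have hAt : A ≠ ∞ := hf.2.ne
  obtain ⟨η₁, hη₁, hη₁'⟩ : ∃ η : ℝ≥0∞, η ≠ 0 ∧ A * η ≤ ε / 3 := by
    refine ⟨ε / 3 / (A + 1), ?_, ?_⟩
    · simp [hε.ne', hAt, ENNReal.div_eq_zero_iff]
    · calc A * (ε / 3 / (A + 1)) ≤ (A + 1) * (ε / 3 / (A + 1)) := by gcongr; exact le_self_add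
        _ ≤ ε / 3 := ENNReal.mul_div_le
  obtain ⟨g', hg'c, hg'1, hg'2, hg'3⟩ := hg.exists_hasCompactSupport_eLpNorm_sub_le hQ hη₁
  set B := eLpNorm g' Q volume with hB
  have hBt : B ≠ ∞ := hg'3.2.ne
  obtain ⟨η₂, hη₂, hη₂'⟩ : ∃ η : ℝ≥0∞, η ≠ 0 ∧ η * B ≤ ε / 3 := by
    refine ⟨ε / 3 / (B + 1), ?_, ?_⟩
    · simp [hε.ne', hBt, ENNReal.div_eq_zero_iff]
    · calc ε / 3 / (B + 1) * B ≤ ε / 3 / (B + 1) * (B + 1) := by gcongr; exact le_self_add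
        _ ≤ ε / 3 := by rw [mul_comm]; exact ENNReal.mul_div_le
  obtain ⟨f', hf'c, hf'1, hf'2, hf'3⟩ := hf.exists_hasCompactSupport_eLpNorm_sub_le hP hη₂
  -- away from a compact set the supports of `f'(· + y)` and `g'` are disjoint
  have hK : IsCompact ((fun a : Vec d × Vec d => a.1 - a.2) '' (tsupport f' ×ˢ tsupport g')) :=
    (hf'c.isCompact.prod hg'c.isCompact).image (by fun_prop)
  rcases eq_or_ne ε ∞ with rfl | hεt
  · exact Eventually.of_forall fun y => edist_lt_top _ _
  filter_upwards [hK.compl_mem_cocompact] with y hy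
  have hzero : corr f' g' y = 0 := by
    refine integral_eq_zero_of_ae (Eventually.of_forall fun x => ?_)
    by_contra hne
    have h1 : f' (x + y) ≠ 0 := fun h => hne (by simp [h])
    have h2 : g' x ≠ 0 := fun h => hne (by simp [h])
    exact hy ⟨(x + y, x), ⟨subset_tsupport _ h1, subset_tsupport _ h2⟩, by simp⟩
  have hsplit : corr f g y = corr f (g - g') y + corr (f - f') g' y := by
    have e1 : corr f g y = corr f (g - g') y + corr f g' y := by
      unfold corr
      rw [← integral_add (integrable_corr hf (hg.sub hg'3) y) (integrable_corr hf hg'3 y)]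
      simp only [Pi.sub_apply]; congr 1; ext x; ring
    have e2 : corr f g' y = corr (f - f') g' y + corr f' g' y := by
      unfold corr
      rw [← integral_add (integrable_corr (hf.sub hf'3) hg'3 y) (integrable_corr hf'3 hg'3 y)]
      simp only [Pi.sub_apply]; congr 1; ext x; ring
    rw [e1, e2, hzero, add_zero]
  have hε3 : ε / 3 ≠ 0 ∧ ε / 3 ≠ ∞ := ⟨by simp [hε.ne'], by simp [ENNReal.div_eq_top, hεt]⟩
  rw [edist_zero_right, hsplit]
  calc ‖corr f (g - g') y + corr (f - f') g' y‖ₑ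
      ≤ ‖corr f (g - g') y‖ₑ + ‖corr (f - f') g' y‖ₑ := enorm_add_le _ _
    _ ≤ ε / 3 + ε / 3 := by
        gcongr
        · exact (enorm_corr_le hf (hg.sub hg'3) y).trans (le_trans (by gcongr) hη₁')
        · exact (enorm_corr_le (hf.sub hf'3) hg'3 y).trans (le_trans (by gcongr) hη₂')
    _ < ε / 3 + ε / 3 + ε / 3 := ENNReal.lt_add_right (by simp [hε3.2]) hε3.1
    _ = ε := ENNReal.add_thirds ε

/-! ### Fubini for correlations -/

theorem aestronglyMeasurable_comp_add {E : Type*} [NormedAddCommGroup E] {f : Vec d → E}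
    (hf : AEStronglyMeasurable f volume) :
    AEStronglyMeasurable (fun z : Vec d × Vec d => f (z.1 + z.2)) (volume.prod volume) :=
  (hf.comp_quasiMeasurePreserving Measure.quasiMeasurePreserving_snd).comp_measurePreserving
    (measurePreserving_prod_add (volume : Measure (Vec d)) volume)

theorem integrable_prod_corr [P.HolderConjugate Q] {f g φ : Vec d → ℝ} (hf : MemLp f P volume)
    (hg : MemLp g Q volume) (hφ : Integrable φ) :
    Integrable (fun z : Vec d × Vec d => f (z.1 + z.2) * g z.1 * φ z.2) (volume.prod volume) := by
  have hm : AEStronglyMeasurable (fun z : Vec d × Vec d => f (z.1 + z.2) * g z.1 * φ z.2)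
      (volume.prod volume) :=
    ((aestronglyMeasurable_comp_add hf.1).mul hg.1.comp_fst).mul hφ.1.comp_snd
  refine ⟨hm, ?_⟩
  rw [HasFiniteIntegral, lintegral_prod_symm _ hm.enorm]
  have hb : ∀ y, ∫⁻ x, ‖f (x + y) * g x * φ y‖ₑ ≤
      eLpNorm f P volume * eLpNorm g Q volume * ‖φ y‖ₑ := by
    intro y
    simp_rw [enorm_mul _ (φ y)]
    rw [lintegral_mul_const' _ _ enorm_ne_top, ← eLpNorm_translate hf y]
    gcongr
    exact lintegral_enorm_mul_le (memLp_translate hf y).1 hg.1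
  calc ∫⁻ y, ∫⁻ x, ‖f (x + y) * g x * φ y‖ₑ
      ≤ ∫⁻ y, eLpNorm f P volume * eLpNorm g Q volume * ‖φ y‖ₑ := lintegral_mono hb
    _ = eLpNorm f P volume * eLpNorm g Q volume * ∫⁻ y, ‖φ y‖ₑ :=
        lintegral_const_mul' _ _ (ENNReal.mul_ne_top hf.2.ne hg.2.ne)
    _ < ∞ := ENNReal.mul_lt_top (ENNReal.mul_lt_top hf.2 hg.2) hφ.2

theorem integrable_prod_corr' [P.HolderConjugate Q] {f g φ : Vec d → ℝ} (hf : MemLp f P volume)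
    (hg : MemLp g Q volume) (hφ : Integrable φ) :
    Integrable (fun z : Vec d × Vec d => f z.2 * g z.1 * φ (z.2 - z.1)) (volume.prod volume) := by
  have h := (measurePreserving_prod_sub (volume : Measure (Vec d)) volume)
    |>.integrable_comp_of_integrable (integrable_prod_corr hf hg hφ)
  refine h.congr (Eventually.of_forall fun z => ?_)
  simp

theorem integrable_corr_mul [P.HolderConjugate Q] {f g φ : Vec d → ℝ} (hf : MemLp f P volume)
    (hg : MemLp g Q volume) (hφ : Integrable φ) : Integrable (fun y => corr f g y * φ y) := by
  refine (integrable_prod_corr hf hg hφ).integral_prod_right.congr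
    (Eventually.of_forall fun y => ?_)
  simp only [corr, integral_mul_const]

/-- A correlation integrated against `φ`: `f` is tested with translates of `φ`. -/
theorem integral_corr_mul_eq [P.HolderConjugate Q] {f g φ : Vec d → ℝ} (hf : MemLp f P volume)
    (hg : MemLp g Q volume) (hφ : Integrable φ) :
    ∫ y, corr f g y * φ y = ∫ x, g x * ∫ z, f z * φ (z - x) := by
  calc ∫ y, corr f g y * φ y = ∫ y, ∫ x, f (x + y) * g x * φ y := by
        simp only [corr, integral_mul_const]
    _ = ∫ x, ∫ y, f (x + y) * g x * φ y :=
        (integral_integral_swap (integrable_prod_corr hf hg hφ)).symm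
    _ = _ := by
        congr 1; ext x
        rw [← integral_const_mul, ← integral_add_left_eq_self _ (-x)]
        congr 1; ext y
        have h1 : x + (-x + y) = y := by abel
        have h2 : -x + y = y - x := by abel
        rw [h1, h2]; ring

/-- A correlation integrated against `φ`: `g` is tested with reflected translates of `φ`. -/
theorem integral_corr_mul_eq' [P.HolderConjugate Q] {f g φ : Vec d → ℝ} (hf : MemLp f P volume)
    (hg : MemLp g Q volume) (hφ : Integrable φ) :
    ∫ y, corr f g y * φ y = ∫ z, f z * ∫ x, g x * φ (z - x) := by
  rw [integral_corr_mul_eq hf hg hφ]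
  calc ∫ x, g x * ∫ z, f z * φ (z - x) = ∫ x, ∫ z, f z * g x * φ (z - x) := by
        congr 1; ext x; rw [← integral_const_mul]; congr 1; ext z; ring
    _ = ∫ z, ∫ x, f z * g x * φ (z - x) :=
        integral_integral_swap (integrable_prod_corr' hf hg hφ)
    _ = _ := by
        congr 1; ext z; rw [← integral_const_mul]; congr 1; ext x; ring

/-! ### Test functions -/

theorem IsTest.integrable {φ : Vec d → ℝ} (hφ : IsTest φ) : Integrable φ :=
  hφ.1.continuous.integrable_of_hasCompactSupport hφ.2

theorem IsTest.partialD {φ : Vec d → ℝ} (hφ : IsTest φ) (i : Fin d) : IsTest (partialD i φ) := by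
  refine ⟨?_, ?_⟩
  · have := hφ.1.fderiv_right (m := ((⊤ : ℕ∞) : WithTop ℕ∞)) (by exact_mod_cast le_top)
    exact this.clm_apply contDiff_const
  · exact hφ.2.fderiv_apply (𝕜 := ℝ) _

theorem IsTest.differentiable {φ : Vec d → ℝ} (hφ : IsTest φ) : Differentiable ℝ φ :=
  hφ.1.differentiable (by simp)

theorem IsTest.comp_sub_right {φ : Vec d → ℝ} (hφ : IsTest φ) (a : Vec d) :
    IsTest (fun z => φ (z - a)) :=
  ⟨hφ.1.comp (contDiff_id.sub contDiff_const),
    hφ.2.comp_homeomorph (Homeomorph.subRight a)⟩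

theorem IsTest.comp_sub_left {φ : Vec d → ℝ} (hφ : IsTest φ) (a : Vec d) :
    IsTest (fun x => φ (a - x)) :=
  ⟨hφ.1.comp (contDiff_const.sub contDiff_id),
    hφ.2.comp_homeomorph (Homeomorph.subLeft a)⟩

theorem partialD_comp_sub_right (φ : Vec d → ℝ) (i : Fin d) (a z : Vec d) :
    partialD i (fun z => φ (z - a)) z = partialD i φ (z - a) := by
  unfold partialD
  rw [fderiv_comp_sub]

theorem partialD_comp_sub_left {φ : Vec d → ℝ} (hφ : Differentiable ℝ φ) (i : Fin d)
    (a x : Vec d) : partialD i (fun x => φ (a - x)) x = -partialD i φ (a - x) := by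
  unfold partialD
  have h : HasFDerivAt (fun x => φ (a - x)) ((fderiv ℝ φ (a - x)).comp
      (-ContinuousLinearMap.id ℝ (Vec d))) x :=
    (hφ (a - x)).hasFDerivAt.comp x ((hasFDerivAt_id x).const_sub a)
  rw [h.fderiv]; simp

end Correlation

/-! ### Weak derivatives and integration by parts -/

section WeakDerivative

variable {d : ℕ} {P Q : ℝ≥0∞}

theorem eq_of_integral_mul_test_eq {f g : Vec d → ℝ} (hf : Continuous f)
    (hg : Continuous g) (h : ∀ φ : Vec d → ℝ, IsTest φ → ∫ x, f x * φ x = ∫ x, g x * φ x) :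
    f = g := by
  have h1 : f =ᵐ[volume] g :=
    ae_eq_of_integral_contDiff_smul_eq (μ := (volume : Measure (Vec d))) hf.locallyIntegrable
      hg.locallyIntegrable fun φ hφ hφ' => by
        simpa only [smul_eq_mul, mul_comm] using h φ ⟨hφ, hφ'⟩
  exact hf.ae_eq_iff_eq volume hg |>.1 h1

/-- A weak derivative of the first factor of a correlation is one of the correlation. -/
theorem integral_corr_mul_partialD [P.HolderConjugate Q] {f f' g : Vec d → ℝ} {i : Fin d}
    (hf : MemLp f P volume) (hf' : MemLp f' P volume) (hg : MemLp g Q volume)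
    (h : HasWeakPartial i f f') {φ : Vec d → ℝ} (hφ : IsTest φ) :
    ∫ y, corr f g y * partialD i φ y = -∫ y, corr f' g y * φ y := by
  rw [integral_corr_mul_eq hf hg (hφ.partialD i).integrable,
    integral_corr_mul_eq hf' hg hφ.integrable, ← integral_neg]
  congr 1; ext x
  have := h.2.2 _ (hφ.comp_sub_right x)
  simp only [partialD_comp_sub_right] at this
  rw [this]; ring

theorem hasWeakPartial_corr [P.HolderConjugate Q] (hP : P ≠ ∞) {f f' g : Vec d → ℝ} {i : Fin d}
    (hf : MemLp f P volume) (hf' : MemLp f' P volume) (hg : MemLp g Q volume)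
    (h : HasWeakPartial i f f') : HasWeakPartial i (corr f g) (corr f' g) :=
  ⟨(continuous_corr hP hf hg).locallyIntegrable, (continuous_corr hP hf' hg).locallyIntegrable,
    fun _ hφ => integral_corr_mul_partialD hf hf' hg h hφ⟩

/-- A weak derivative of the second factor of a correlation is, up to sign, one of the
correlation. -/
theorem integral_corr_mul_partialD_right [P.HolderConjugate Q] {f g g' : Vec d → ℝ} {i : Fin d}
    (hf : MemLp f P volume) (hg : MemLp g Q volume) (hg' : MemLp g' Q volume)
    (h : HasWeakPartial i g g') {φ : Vec d → ℝ} (hφ : IsTest φ) :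
    ∫ y, corr f g y * partialD i φ y = ∫ y, corr f g' y * φ y := by
  rw [integral_corr_mul_eq' hf hg (hφ.partialD i).integrable,
    integral_corr_mul_eq' hf hg' hφ.integrable]
  congr 1; ext z
  have := h.2.2 _ (hφ.comp_sub_left z)
  simp only [partialD_comp_sub_left hφ.differentiable, mul_neg, integral_neg, neg_inj] at this
  rw [this]

theorem integral_mul_comp_sub_eq (H φ : Vec d → ℝ) (a : Vec d) :
    ∫ y, H (y + a) * φ y = ∫ y, H y * φ (y - a) := by
  rw [← integral_add_right_eq_self (fun y => H y * φ (y - a)) a]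
  simp

theorem hasDerivAt_integral_mul_translate {H : Vec d → ℝ} {i : Fin d} (hH : Continuous H)
    {φ : Vec d → ℝ} (hφ : IsTest φ) (s : ℝ) :
    HasDerivAt (fun s : ℝ => ∫ y, H y * φ (y - s • EuclideanSpace.single i 1))
      (-∫ y, H y * partialD i φ (y - s • EuclideanSpace.single i 1)) s := by
  set e : Vec d := EuclideanSpace.single i 1
  set ψ : Vec d → ℝ := fun x => φ (0 - x) with hψdef
  have hψ : IsTest ψ := hφ.comp_sub_left 0
  have h1 := hψ.2.hasFDerivAt_convolution_right (μ := (volume : Measure (Vec d)))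
    (ContinuousLinearMap.mul ℝ ℝ) hH.locallyIntegrable (hψ.1.of_le (by exact_mod_cast le_top))
    (s • e)
  have h2 : HasDerivAt (fun s : ℝ => s • e) e s := by simpa using (hasDerivAt_id s).smul_const e
  have h3 := h1.comp_hasDerivAt s h2
  rw [convolution_precompR_apply _ hH.locallyIntegrable (hψ.2.fderiv ℝ)
    (hψ.1.continuous_fderiv (by simp))] at h3
  have e1 : (fun s : ℝ => ∫ y, H y * φ (y - s • e)) =
      (H ⋆[ContinuousLinearMap.mul ℝ ℝ, volume] ψ) ∘ fun s => s • e := by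
    ext s
    simp only [Function.comp_def, convolution_def, hψdef, ContinuousLinearMap.mul_apply']
    congr 1; ext y; congr 2; abel
  have e2 : -∫ y, H y * partialD i φ (y - s • e) =
      (H ⋆[ContinuousLinearMap.mul ℝ ℝ, volume] fun a => (fderiv ℝ ψ a) e) (s • e) := by
    rw [← integral_neg, convolution_def]
    congr 1; ext y
    have := partialD_comp_sub_left hφ.differentiable i 0 (s • e - y)
    simp only [partialD] at this
    simp only [ContinuousLinearMap.mul_apply']
    rw [hψdef, this, partialD]
    have h4 : (0 : Vec d) - (s • e - y) = y - s • e := by abel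
    rw [h4]; ring
  rw [e1, e2]
  exact h3

/-- The fundamental theorem of calculus along a coordinate axis, for a continuous function with a
continuous weak partial derivative: both sides are continuous in `y` and agree as distributions. -/
theorem HasWeakPartial.sub_eq_integral {H G : Vec d → ℝ} {i : Fin d} (hH : Continuous H)
    (hG : Continuous G) (h : HasWeakPartial i H G) (y : Vec d) (k : ℝ) :
    H (y + k • EuclideanSpace.single i 1) - H y =
      ∫ s in (0 : ℝ)..k, G (y + s • EuclideanSpace.single i 1) := by
  set e : Vec d := EuclideanSpace.single i 1
  have hcont : Continuous fun y => ∫ s in (0 : ℝ)..k, G (y + s • e) :=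
    intervalIntegral.continuous_parametric_intervalIntegral_of_continuous' (by fun_prop) 0 k
  have key : (fun y => H (y + k • e) - H y) = fun y => ∫ s in (0 : ℝ)..k, G (y + s • e) := by
    refine eq_of_integral_mul_test_eq (by fun_prop) hcont fun φ hφ => ?_
    have hder : ∀ s : ℝ, HasDerivAt (fun s : ℝ => ∫ y, H y * φ (y - s • e))
        (∫ y, G (y + s • e) * φ y) s := by
      intro s
      have := hasDerivAt_integral_mul_translate (i := i) hH hφ s
      have h2 := h.2.2 _ (hφ.comp_sub_right (s • e))
      simp only [partialD_comp_sub_right] at h2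
      rw [h2, neg_neg] at this
      rw [integral_mul_comp_sub_eq]
      exact this
    have hint : Integrable (Function.uncurry fun (s : ℝ) (y : Vec d) => G (y + s • e) * φ y)
        ((volume.restrict (uIoc 0 k)).prod volume) := by
      obtain ⟨C, hC⟩ := ((isCompact_uIcc (a := (0 : ℝ)) (b := k)).prod hφ.2.isCompact)
        |>.exists_bound_of_continuousOn (f := fun z : ℝ × Vec d => G (z.2 + z.1 • e))
          (by fun_prop)
      have hfin : IsFiniteMeasure (volume.restrict (uIoc 0 k)) :=
        ⟨by simp [uIoc]⟩
      have hdom := (integrable_const (μ := volume.restrict (uIoc 0 k)) C).mul_prod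
        hφ.integrable.norm
      have hφc := hφ.1.continuous
      refine hdom.mono' (Continuous.aestronglyMeasurable (by unfold Function.uncurry; fun_prop)) ?_
      have hae : ∀ᵐ z ∂((volume.restrict (uIoc 0 k)).prod (volume : Measure (Vec d))),
          z.1 ∈ uIoc 0 k :=
        Measure.quasiMeasurePreserving_fst.ae (ae_restrict_mem measurableSet_uIoc)
      filter_upwards [hae] with z hz
      simp only [Function.uncurry, norm_mul]
      by_cases hzφ : z.2 ∈ tsupport φ
      · gcongr
        exact hC z ⟨uIoc_subset_uIcc hz, hzφ⟩
      · rw [image_eq_zero_of_notMem_tsupport hzφ]; simp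
    have hswap : ∫ s in (0 : ℝ)..k, ∫ y, G (y + s • e) * φ y =
        ∫ y, (∫ s in (0 : ℝ)..k, G (y + s • e)) * φ y := by
      simp_rw [intervalIntegral.intervalIntegral_eq_integral_uIoc, smul_eq_mul]
      rw [integral_integral_swap hint, ← integral_const_mul]
      congr 1; ext y
      rw [integral_mul_const]; ring
    have hcontder : Continuous fun s : ℝ => ∫ y, G (y + s • e) * φ y := by
      refine continuous_iff_continuousAt.2 fun s => ?_
      have := (hasDerivAt_integral_mul_translate (i := i) hG hφ s).continuousAt
      simpa only [integral_mul_comp_sub_eq] using this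
    have hftc := intervalIntegral.integral_eq_sub_of_hasDerivAt (a := 0) (b := k)
      (fun s _ => hder s) (hcontder.intervalIntegrable 0 k)
    rw [hswap] at hftc
    rw [hftc]
    simp only [zero_smul, sub_zero]
    rw [← integral_mul_comp_sub_eq, ← integral_sub]
    · simp only [sub_mul]
    · exact (Continuous.integrable_of_hasCompactSupport
        (by have := hφ.1.continuous; fun_prop) hφ.2.mul_left)
    · exact (Continuous.integrable_of_hasCompactSupport
        (by have := hφ.1.continuous; fun_prop) hφ.2.mul_left)
  exact congrFun key y

/-- A continuous weak partial derivative of a continuous function is a classical one. -/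
theorem HasWeakPartial.hasDerivAt {H G : Vec d → ℝ} {i : Fin d} (hH : Continuous H)
    (hG : Continuous G) (h : HasWeakPartial i H G) (s : ℝ) :
    HasDerivAt (fun s : ℝ => H (s • EuclideanSpace.single i 1))
      (G (s • EuclideanSpace.single i 1)) s := by
  have h1 : (fun s : ℝ => H (s • EuclideanSpace.single i 1)) = fun k : ℝ =>
      H 0 + ∫ s in (0 : ℝ)..k, G (s • EuclideanSpace.single i 1) := by
    ext k
    have := h.sub_eq_integral hH hG 0 k
    simp only [zero_add] at this
    linarith
  rw [h1]
  have hc : Continuous fun s : ℝ => G (s • EuclideanSpace.single i 1) := by fun_prop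
  exact ((hc.integral_hasStrictDerivAt 0 s).hasDerivAt).const_add _

/-- Differentiation of a correlation along a coordinate axis. -/
theorem hasDerivAt_corr [P.HolderConjugate Q] (hP : P ≠ ∞) {f f' g : Vec d → ℝ} {i : Fin d}
    (hf : MemLp f P volume) (hf' : MemLp f' P volume) (hg : MemLp g Q volume)
    (h : HasWeakPartial i f f') (s : ℝ) :
    HasDerivAt (fun s : ℝ => corr f g (s • EuclideanSpace.single i 1))
      (corr f' g (s • EuclideanSpace.single i 1)) s :=
  (hasWeakPartial_corr hP hf hf' hg h).hasDerivAt (continuous_corr hP hf hg)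
    (continuous_corr hP hf' hg) s

theorem corr_zero_eq (f g : Vec d → ℝ) : corr f g 0 = ∫ x, f x * g x := by simp [corr]

/-- Integration by parts between a field that only has a weak divergence in `L^Q` and the weak
gradient of an `L^P` function: both sides are values at `0` of continuous correlations that
agree as distributions. -/
theorem sum_integral_mul_eq_neg [P.HolderConjugate Q] (hQ : Q ≠ ∞) {ι : Type*} [Fintype ι]
    (m : ι → Fin d) {a : ι → Vec d → ℝ} {b w : Vec d → ℝ} {W : ι → Vec d → ℝ}
    (ha : ∀ i, MemLp (a i) Q volume) (hb : MemLp b Q volume) (hw : MemLp w P volume)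
    (hW : ∀ i, MemLp (W i) P volume)
    (hdiv : ∀ φ : Vec d → ℝ, IsTest φ → ∑ i, ∫ x, a i x * partialD (m i) φ x = -∫ x, b x * φ x)
    (hgrad : ∀ i, HasWeakPartial (m i) w (W i)) :
    ∑ i, ∫ x, a i x * W i x = -∫ x, b x * w x := by
  have hc1 : Continuous fun y => ∑ i, corr (a i) (W i) y :=
    continuous_finsetSum _ fun i _ => continuous_corr hQ (ha i) (hW i)
  have key : (fun y => ∑ i, corr (a i) (W i) y) = fun y => -corr b w y := by
    refine eq_of_integral_mul_test_eq hc1 (continuous_corr hQ hb hw).neg fun φ hφ => ?_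
    simp only [Finset.sum_mul, neg_mul, integral_neg]
    rw [integral_finsetSum _ fun i _ => integrable_corr_mul (ha i) (hW i) hφ.integrable]
    simp_rw [← integral_corr_mul_partialD_right (ha _) hw (hW _) (hgrad _) hφ]
    rw [← integral_finsetSum _ fun i _ =>
      integrable_corr_mul (ha i) hw (hφ.partialD (m i)).integrable]
    rw [integral_finsetSum _ fun i _ =>
      integrable_corr_mul (ha i) hw (hφ.partialD (m i)).integrable]
    simp_rw [integral_corr_mul_eq (ha _) hw (hφ.partialD (m _)).integrable]
    rw [integral_corr_mul_eq hb hw hφ.integrable, ← integral_finsetSum, ← integral_neg]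
    · congr 1; ext x
      have := hdiv _ (hφ.comp_sub_right x)
      simp only [partialD_comp_sub_right] at this
      rw [← Finset.mul_sum, this]; ring
    · intro i _
      refine (integrable_prod_corr' (ha i) hw (hφ.partialD (m i)).integrable).integral_prod_left
        |>.congr (Eventually.of_forall fun x => ?_)
      simp only
      rw [← integral_const_mul]; congr 1; ext z; ring
  have := congrFun key 0
  simpa only [corr_zero_eq] using this

theorem partialD_comm {φ : Vec d → ℝ} (hφ : IsTest φ) (i j : Fin d) :
    partialD i (partialD j φ) = partialD j (partialD i φ) := by
  ext x
  have hd : DifferentiableAt ℝ (fderiv ℝ φ) x :=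
    ((hφ.1.fderiv_right (m := ((⊤ : ℕ∞) : WithTop ℕ∞))
      (by exact_mod_cast le_top)).differentiable (by simp)) x
  have hs : IsSymmSndFDerivAt ℝ φ x :=
    hφ.1.contDiffAt.isSymmSndFDerivAt (by
      rw [minSmoothness_of_isRCLikeNormedField]; exact WithTop.coe_le_coe.2 (le_top : (2 : ℕ∞) ≤ ⊤))
  have hk : ∀ i j : Fin d, partialD i (partialD j φ) x =
      fderiv ℝ (fderiv ℝ φ) x (EuclideanSpace.single i 1) (EuclideanSpace.single j 1) := by
    intro i j
    unfold partialD
    rw [fderiv_clm_apply hd (differentiableAt_const _)]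
    simp
  rw [hk, hk]
  exact hs _ _

/-- A gradient in `L^Q` is orthogonal to the divergence-free fields of class `W^{1,P}`, whatever
the growth of the potential: the correlation `∑ i, corr (∂_i π) (w_i)` has vanishing derivatives
and tends to zero at infinity. -/
theorem sum_integral_grad_mul_eq_zero [P.HolderConjugate Q] (hP : P ≠ ∞) (hQ : Q ≠ ∞)
    {π : Vec d → ℝ} {g w W : Fin d → Vec d → ℝ} (hd : 0 < d)
    (hg : ∀ i, MemLp (g i) Q volume) (hw : ∀ i, MemLp (w i) P volume)
    (hW : ∀ i, MemLp (W i) P volume) (hπ : ∀ i, HasWeakPartial i π (g i))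
    (hwW : ∀ i, HasWeakPartial i (w i) (W i)) (hdiv : ∀ᵐ x, ∑ i, W i x = 0) :
    ∑ i, ∫ x, g i x * w i x = 0 := by
  let j : Fin d := ⟨0, hd⟩
  set F : Vec d → ℝ := fun y => ∑ i, corr (g i) (w i) y with hF
  have hFc : Continuous F := continuous_finsetSum _ fun i _ => continuous_corr hQ (hg i) (hw i)
  have hsum : ∀ y, ∑ i, corr (g j) (W i) y = 0 := by
    intro y
    unfold corr
    rw [← integral_finsetSum _ fun i _ => integrable_corr (hg j) (hW i) y]
    refine integral_eq_zero_of_ae ?_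
    filter_upwards [hdiv] with x hx
    rw [← Finset.mul_sum, hx]; simp
  have hweak : HasWeakPartial j F (fun _ => 0) := by
    refine ⟨hFc.locallyIntegrable, continuous_const.locallyIntegrable, fun φ hφ => ?_⟩
    have hinner : ∀ i x, ∫ z, g i z * partialD j φ (z - x) = ∫ z, g j z * partialD i φ (z - x) := by
      intro i x
      have h1 := (hπ i).2.2 _ ((hφ.partialD j).comp_sub_right x)
      have h2 := (hπ j).2.2 _ ((hφ.partialD i).comp_sub_right x)
      simp only [partialD_comp_sub_right] at h1 h2
      rw [partialD_comm hφ i j] at h1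
      linarith
    simp only [hF, Finset.sum_mul, zero_mul, integral_zero, neg_zero]
    rw [integral_finsetSum _ fun i _ =>
      integrable_corr_mul (hg i) (hw i) (hφ.partialD j).integrable]
    calc ∑ i, ∫ y, corr (g i) (w i) y * partialD j φ y
        = ∑ i, ∫ y, corr (g j) (w i) y * partialD i φ y := by
          refine Finset.sum_congr rfl fun i _ => ?_
          rw [integral_corr_mul_eq (hg i) (hw i) (hφ.partialD j).integrable,
            integral_corr_mul_eq (hg j) (hw i) (hφ.partialD i).integrable]
          simp only [hinner]
      _ = ∑ i, ∫ y, corr (g j) (W i) y * φ y := Finset.sum_congr rfl fun i _ =>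
          integral_corr_mul_partialD_right (hg j) (hw i) (hW i) (hwW i) hφ
      _ = ∫ y, (∑ i, corr (g j) (W i) y) * φ y := by
          rw [← integral_finsetSum _ fun i _ =>
            integrable_corr_mul (hg j) (hW i) hφ.integrable]
          simp only [Finset.sum_mul]
      _ = 0 := by simp [hsum]
  have hconst : ∀ s : ℝ, F (s • EuclideanSpace.single j 1) = F 0 := by
    intro s
    have := is_const_of_deriv_eq_zero
      (f := fun s : ℝ => F (s • EuclideanSpace.single j 1))
      (fun s => (hweak.hasDerivAt hFc continuous_const s).differentiableAt)
      (fun s => (hweak.hasDerivAt hFc continuous_const s).deriv) s 0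
    simpa using this
  have hlim : Tendsto F (cocompact (Vec d)) (𝓝 0) := by
    have := tendsto_finsetSum Finset.univ fun i _ =>
      tendsto_corr_cocompact hQ hP (hg i) (hw i)
    simpa using this
  have hcoc : Tendsto (fun s : ℝ => s • (EuclideanSpace.single j 1 : Vec d)) atTop
      (cocompact (Vec d)) := by
    rw [← Metric.cobounded_eq_cocompact, ← comap_norm_atTop, tendsto_comap_iff]
    refine tendsto_atTop_mono (fun s => ?_) tendsto_id
    simp [norm_smul, le_abs_self]
  have h0 : F 0 = 0 :=
    tendsto_nhds_unique ((tendsto_const_nhds).congr fun s => (hconst s).symm) (hlim.comp hcoc)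
  simpa only [hF, corr_zero_eq] using h0

end WeakDerivative

/-! ### Difference quotients of Sobolev fields -/

section Sobolev

variable {d : ℕ} {P Q : ℝ≥0∞}

/-- The correlation `y ↦ ∫ f(x + y) · g(x) dx` of two vector fields, as the sum of the correlations
of their components. -/
noncomputable def vcorr (f g : Vec d → Vec d) (y : Vec d) : ℝ :=
  ∑ j, corr (fun x => f x j) (fun x => g x j) y

/-- The `i`-th row of a matrix; for a gradient it is the derivative in the direction `e_i`. -/
def row (i : Fin d) (A : Mat d) : Vec d := WithLp.toLp 2 fun j => A (i, j)

@[simp] theorem row_apply (i j : Fin d) (A : Mat d) : row i A j = A (i, j) := rfl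

theorem vec_inner_eq_sum {ι : Type*} [Fintype ι] (a b : EuclideanSpace ℝ ι) :
    inner ℝ a b = ∑ j, a j * b j := by
  simp [PiLp.inner_apply, mul_comm]

theorem sum_inner_row (A B : Mat d) : ∑ i, inner ℝ (row i A) (row i B) = inner ℝ A B := by
  simp only [vec_inner_eq_sum, row_apply, Fintype.sum_prod_type]

theorem norm_row_le (i : Fin d) (A : Mat d) : ‖row i A‖ ≤ ‖A‖ := by
  have h : ‖row i A‖ ^ 2 ≤ ‖A‖ ^ 2 := by
    rw [← real_inner_self_eq_norm_sq, ← real_inner_self_eq_norm_sq A, ← sum_inner_row]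
    exact Finset.single_le_sum (f := fun i => inner ℝ (row i A) (row i A))
      (fun i _ => real_inner_self_nonneg) (Finset.mem_univ i)
  exact le_of_sq_le_sq h (norm_nonneg A)

theorem continuous_row (i : Fin d) : Continuous (row i : Mat d → Vec d) := by
  unfold row
  exact (PiLp.continuous_toLp 2 _).comp (by fun_prop)

theorem memLp_row {A : Vec d → Mat d} (hA : MemLp A P volume) (i : Fin d) :
    MemLp (fun x => row i (A x)) P volume :=
  hA.of_le ((continuous_row i).comp_aestronglyMeasurable hA.1)
    (Eventually.of_forall fun x => norm_row_le i (A x))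

theorem memLp_coord {ι : Type*} [Fintype ι] {α : Type*} [MeasurableSpace α] {μ : Measure α}
    {f : α → EuclideanSpace ℝ ι} (hf : MemLp f P μ) (j : ι) : MemLp (fun x => f x j) P μ :=
  hf.of_le ((EuclideanSpace.proj j : EuclideanSpace ℝ ι →L[ℝ] ℝ).continuous
    |>.comp_aestronglyMeasurable hf.1) (Eventually.of_forall fun x => PiLp.norm_apply_le (f x) j)

theorem integrable_inner [P.HolderConjugate Q] {ι : Type*} [Fintype ι] {α : Type*}
    [MeasurableSpace α] {μ : Measure α} {f g : α → EuclideanSpace ℝ ι} (hf : MemLp f P μ)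
    (hg : MemLp g Q μ) : Integrable (fun x => inner ℝ (f x) (g x)) μ := by
  simp only [vec_inner_eq_sum]
  exact integrable_finsetSum _ fun j _ => (memLp_coord hf j).integrable_mul (memLp_coord hg j)

theorem integral_inner_eq_sum [P.HolderConjugate Q] {ι : Type*} [Fintype ι] {α : Type*}
    [MeasurableSpace α] {μ : Measure α} {f g : α → EuclideanSpace ℝ ι} (hf : MemLp f P μ)
    (hg : MemLp g Q μ) : ∫ x, inner ℝ (f x) (g x) ∂μ = ∑ j, ∫ x, f x j * g x j ∂μ := by
  simp only [vec_inner_eq_sum]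
  exact integral_finsetSum _ fun j _ => (memLp_coord hf j).integrable_mul (memLp_coord hg j)

theorem vcorr_eq_integral [P.HolderConjugate Q] {f g : Vec d → Vec d} (hf : MemLp f P volume)
    (hg : MemLp g Q volume) (y : Vec d) : vcorr f g y = ∫ x, inner ℝ (f (x + y)) (g x) :=
  (integral_inner_eq_sum (memLp_translate hf y) hg).symm

theorem vcorr_zero [P.HolderConjugate Q] {f g : Vec d → Vec d} (hf : MemLp f P volume)
    (hg : MemLp g Q volume) : vcorr f g 0 = ∫ x, inner ℝ (f x) (g x) := by
  rw [vcorr_eq_integral hf hg]; simp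

/-- Reflection exchanges the two factors of a correlation. -/
theorem vcorr_neg (f g : Vec d → Vec d) (y : Vec d) : vcorr f g (-y) = vcorr g f y := by
  unfold vcorr corr
  refine Finset.sum_congr rfl fun j _ => ?_
  rw [← integral_add_right_eq_self _ y]
  congr 1; ext x
  rw [add_neg_cancel_right, mul_comm]

theorem hasDerivAt_vcorr [P.HolderConjugate Q] (hP : P ≠ ∞) {f f' g : Vec d → Vec d} {i : Fin d}
    (hf : MemLp f P volume) (hf' : MemLp f' P volume) (hg : MemLp g Q volume)
    (h : ∀ j, HasWeakPartial i (fun x => f x j) (fun x => f' x j)) (s : ℝ) :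
    HasDerivAt (fun s : ℝ => vcorr f g (s • EuclideanSpace.single i 1))
      (vcorr f' g (s • EuclideanSpace.single i 1)) s := by
  unfold vcorr
  exact HasDerivAt.fun_sum fun j _ =>
    hasDerivAt_corr hP (memLp_coord hf j) (memLp_coord hf' j) (memLp_coord hg j) (h j) s

theorem vcorr_sub_zero [P.HolderConjugate Q] {f g : Vec d → Vec d} (hf : MemLp f P volume)
    (hg : MemLp g Q volume) (y : Vec d) :
    vcorr f g y - vcorr f g 0 = ∫ x, inner ℝ (f (x + y) - f x) (g x) := by
  rw [vcorr_eq_integral hf hg, vcorr_zero hf hg, ← integral_sub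
    (integrable_inner (memLp_translate hf y) hg) (integrable_inner hf hg)]
  simp only [inner_sub_left]

/-- The pairing of two increments is a symmetric second difference of a correlation. -/
theorem integral_inner_translate_sub [P.HolderConjugate Q] {f g : Vec d → Vec d}
    (hf : MemLp f P volume) (hg : MemLp g Q volume) (y : Vec d) :
    ∫ x, inner ℝ (f (x + y) - f x) (g (x + y) - g x) =
      2 * vcorr f g 0 - vcorr f g y - vcorr f g (-y) := by
  have hfy := memLp_translate hf y
  have hgy := memLp_translate hg y
  have h1 := integral_sub (integrable_inner (hfy.sub hf) hgy) (integrable_inner (hfy.sub hf) hg)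
  simp only [Pi.sub_apply, ← inner_sub_right] at h1
  rw [h1, ← vcorr_sub_zero hf hg]
  have h2 := integral_sub (integrable_inner hfy hgy) (integrable_inner hf hgy)
  simp only [← inner_sub_left] at h2
  rw [h2, integral_add_right_eq_self (fun x => inner ℝ (f x) (g x)), ← vcorr_zero hf hg, vcorr_neg,
    vcorr_eq_integral hg hf]
  simp only [real_inner_comm]
  ring

/-- A function that vanishes at `0` and is dominated by one with zero derivative there has zero
derivative there. -/
theorem eq_zero_of_hasDerivAt_of_abs_le {T S : ℝ → ℝ} {T' : ℝ} (hT : HasDerivAt T T' 0)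
    (hS : HasDerivAt S 0 0) (hT0 : T 0 = 0) (hS0 : S 0 = 0) (h : ∀ s, |T s| ≤ S s) : T' = 0 := by
  have h1 : HasDerivAt T 0 0 := by
    rw [hasDerivAt_iff_isLittleO] at hS ⊢
    simp only [hT0, hS0, sub_zero, smul_zero] at hS ⊢
    refine (Asymptotics.IsBigO.of_bound 1 (Eventually.of_forall fun s => ?_)).trans_isLittleO hS
    rw [one_mul, Real.norm_eq_abs, Real.norm_eq_abs]
    exact (h s).trans (le_abs_self _)
  exact hT.unique h1

/-- The second derivative at a global maximum is nonpositive. -/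
theorem nonpos_of_hasDerivAt_of_le {k k' : ℝ → ℝ} {k'' : ℝ} (hk : ∀ s, HasDerivAt k (k' s) s)
    (hk' : HasDerivAt k' k'' 0) (hmax : ∀ s, k s ≤ k 0) : k'' ≤ 0 := by
  by_contra hpos
  push Not at hpos
  have hd : deriv k = k' := funext fun s => (hk s).deriv
  have h0 : k' 0 = 0 :=
    IsLocalMax.hasDerivAt_eq_zero (Eventually.of_forall hmax) (hk 0)
  have hmin : IsLocalMin k 0 := isLocalMin_of_deriv_deriv_pos
    (by rw [hd, hk'.deriv]; exact hpos) (by rw [hd, h0]) (hk 0).continuousAt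
  have hconst : k =ᶠ[𝓝 0] fun _ => k 0 := by
    filter_upwards [hmin] with s hs using le_antisymm (hmax s) hs
  have h1 : k' =ᶠ[𝓝 0] fun _ => 0 := by
    have := hconst.deriv
    rw [hd] at this
    simpa using this
  have h2 : k'' = 0 := (hk'.congr_of_eventuallyEq h1.symm).unique (hasDerivAt_const 0 0)
  exact hpos.ne' h2

variable {p : ℝ}

/-- The regularizing term dissipates: `∂_i v_p · ∂_i v` has non-negative integral. The function
`s ↦ ∫ v_p(x + s e_i) · v(x) dx`, once symmetrized, is largest at `s = 0` because `v ↦ v_p` is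
monotone, and `-∫ ∂_i v_p · ∂_i v` is its second derivative there. -/
theorem integral_inner_partial_pPower_nonneg (hp : 2 ≤ p) {v v' m' : Vec d → Vec d} {i : Fin d}
    (hv : MemLp v (ENNReal.ofReal p) volume) (hv' : MemLp v' (ENNReal.ofReal p) volume)
    (hm' : MemLp m' (ENNReal.ofReal (conjExp p)) volume)
    (hvv' : ∀ j, HasWeakPartial i (fun x => v x j) (fun x => v' x j))
    (hmm' : ∀ j, HasWeakPartial i (fun x => pPower p (v x) j) (fun x => m' x j)) :
    0 ≤ ∫ x, inner ℝ (m' x) (v' x) := by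
  have := (holderConjugate_conjExp hp).ennrealOfReal
  have hm := memLp_pPower hp hv
  set m := fun x => pPower p (v x)
  set e : Vec d := EuclideanSpace.single i 1
  set c : ℝ → ℝ := fun s => vcorr m v (s • e)
  set c₁ : ℝ → ℝ := fun s => vcorr m' v (s • e)
  have hc : ∀ s, HasDerivAt c (c₁ s) s :=
    hasDerivAt_vcorr ENNReal.ofReal_ne_top hm hm' hv hmm'
  have hneg : ∀ s : ℝ, HasDerivAt (fun s : ℝ => -s) (-1) s := fun s => (hasDerivAt_id s).neg
  have hc₁ : HasDerivAt c₁ (-∫ x, inner ℝ (m' x) (v' x)) 0 := by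
    have h1 := hasDerivAt_vcorr ENNReal.ofReal_ne_top hv hv' hm' hvv' (-0)
    have h2 := h1.scomp 0 (hneg 0)
    have h3 : vcorr v' m' ((-0 : ℝ) • e) = ∫ x, inner ℝ (m' x) (v' x) := by
      rw [neg_zero, zero_smul, vcorr_zero hv' hm']
      simp only [real_inner_comm]
    rw [h3] at h2
    simp only [neg_smul, one_smul] at h2
    refine h2.congr_of_eventuallyEq (Eventually.of_forall fun s => ?_)
    simp only [c₁, Function.comp_apply, neg_smul, vcorr_neg]
    rfl
  have hmax : ∀ s, c s + c (-s) ≤ c 0 + c (-0) := by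
    intro s
    have h1 := integral_inner_translate_sub hm hv (s • e)
    have h2 : 0 ≤ ∫ x, inner ℝ (m (x + s • e) - m x) (v (x + s • e) - v x) :=
      integral_nonneg fun x => inner_pPower_sub_nonneg hp _ _
    simp only [c, neg_zero, zero_smul, neg_smul]
    linarith
  have h := nonpos_of_hasDerivAt_of_le (k := fun s => c s + c (-s)) (k' := fun s => c₁ s - c₁ (-s))
    (k'' := (-∫ x, inner ℝ (m' x) (v' x)) + (-∫ x, inner ℝ (m' x) (v' x)))
    (fun s => by
      have := (hc s).add ((hc (-s)).scomp s (hneg s))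
      simpa [sub_eq_add_neg] using! this)
    (by
      have h4 : HasDerivAt c₁ (-∫ x, inner ℝ (m' x) (v' x)) (-0) := by rw [neg_zero]; exact hc₁
      have := hc₁.sub (h4.scomp 0 (hneg 0))
      simpa using! this) hmax
  linarith

/-- Translation in `W^{1,p}`: `‖v(· + s e_i) - v‖_p ≤ |s| ‖∂_i v‖_p`. The increment `Δ` is paired
with `|Δ|^{p-2} Δ`, and the mean value theorem is applied to the correlation of `v` with that field. -/
theorem integral_translate_sub_rpow_le (hp : 2 ≤ p) {v v' : Vec d → Vec d} {i : Fin d}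
    (hv : MemLp v (ENNReal.ofReal p) volume) (hv' : MemLp v' (ENNReal.ofReal p) volume)
    (hvv' : ∀ j, HasWeakPartial i (fun x => v x j) (fun x => v' x j)) (s : ℝ) :
    ∫ x, ‖v (x + s • EuclideanSpace.single i 1) - v x‖ ^ p ≤ |s| ^ p * ∫ x, ‖v' x‖ ^ p := by
  have hp0 : 0 < p := by linarith
  have hc := holderConjugate_conjExp hp
  have := hc.ennrealOfReal
  set e : Vec d := EuclideanSpace.single i 1
  rcases eq_or_ne s 0 with rfl | hs
  · simp [Real.zero_rpow hp0.ne']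
  have hΔ : MemLp (fun x => v (x + s • e) - v x) (ENNReal.ofReal p) volume :=
    (memLp_translate hv _).sub hv
  set Δ := fun x => v (x + s • e) - v x with hΔdef
  have hG := memLp_pPower hp hΔ
  set G := fun x => pPower p (Δ x) with hGdef
  set X := ∫ x, ‖Δ x‖ ^ p
  set Y := ∫ x, ‖v' x‖ ^ p
  have hX : vcorr v G (s • e) - vcorr v G 0 = X := by
    rw [vcorr_sub_zero hv hG]
    refine integral_congr_ae (Eventually.of_forall fun x => ?_)
    simp only [hGdef]
    rw [real_inner_comm, ← inner_pPower_self hp]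
  have habs : 0 < |s| := abs_pos.2 hs
  have hbound : ∀ σ : ℝ, ‖vcorr v' G (σ • e)‖ ≤ (|s| ^ p * Y / p + X / conjExp p) / |s| := by
    intro σ
    rw [vcorr_eq_integral hv' hG, le_div_iff₀ habs, mul_comm, ← Real.norm_of_nonneg habs.le,
      ← norm_smul, ← integral_smul]
    have hi1 : Integrable fun x => ‖v' (x + σ • e)‖ ^ p :=
      integrable_norm_rpow hp0 (memLp_translate hv' _)
    have hi2 : Integrable fun x => ‖Δ x‖ ^ p := integrable_norm_rpow hp0 hΔ
    have hY : ∫ x, ‖v' (x + σ • e)‖ ^ p = Y :=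
      integral_add_right_eq_self (fun x => ‖v' x‖ ^ p) (σ • e)
    have hrhs : |s| ^ p * Y / p + X / conjExp p =
        ∫ x, (|s| ^ p * ‖v' (x + σ • e)‖ ^ p / p + ‖Δ x‖ ^ p / conjExp p) := by
      rw [integral_add ((hi1.const_mul _).div_const _) (hi2.div_const _), integral_div,
        integral_const_mul, hY, integral_div]
    rw [Real.norm_of_nonneg habs.le, hrhs]
    refine norm_integral_le_of_norm_le (((hi1.const_mul _).div_const _).add (hi2.div_const _))
      (Eventually.of_forall fun x => ?_)
    have hy := Real.young_inequality_of_nonneg (a := |s| * ‖v' (x + σ • e)‖)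
      (b := ‖Δ x‖ ^ (p - 1)) (by positivity) (by positivity) hc
    rw [Real.mul_rpow habs.le (norm_nonneg _), ← Real.rpow_mul (norm_nonneg _)] at hy
    have h1 : (p - 1) * conjExp p = p := by
      have : p - 1 ≠ 0 := by linarith
      unfold conjExp; field_simp
    rw [h1] at hy
    refine le_trans ?_ hy
    rw [norm_smul, Real.norm_of_nonneg habs.le, mul_assoc]
    gcongr
    refine (norm_inner_le_norm _ _).trans_eq ?_
    simp only [hGdef]
    rw [norm_pPower hp]
  have hmvt := Convex.norm_image_sub_le_of_norm_hasDerivWithin_le (s := Set.univ)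
    (f := fun σ : ℝ => vcorr v G (σ • e)) (x := 0) (y := s)
    (fun σ _ => (hasDerivAt_vcorr ENNReal.ofReal_ne_top hv hv' hG hvv' σ).hasDerivWithinAt)
    (fun σ _ => hbound σ) convex_univ (mem_univ _) (mem_univ _)
  simp only [zero_smul, sub_zero] at hmvt
  rw [hX, Real.norm_eq_abs s, div_mul_cancel₀ _ habs.ne'] at hmvt
  have h2 : X ≤ |s| ^ p * Y / p + X / conjExp p := (le_abs_self X).trans hmvt
  have h3 : X / conjExp p = X - X / p := by
    have : p - 1 ≠ 0 := by linarith
    unfold conjExp; field_simp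
  rw [h3] at h2
  have h4 : X / p ≤ |s| ^ p * Y / p := by linarith
  exact (div_le_div_iff_of_pos_right hp0).1 h4

/-- A substitute for the chain rule `|∂_i v_p| ≤ (p - 1) |v|^{p-2} |∂_i v|`, in integrated form:
the left-hand side is the derivative of a correlation, whose difference quotients are bounded by
the Lipschitz estimate for `a ↦ |a|^{p-2} a`. -/
theorem abs_integral_inner_partial_pPower_le (hp : 2 ≤ p) {v v' m' F : Vec d → Vec d} {i : Fin d}
    (hv : MemLp v (ENNReal.ofReal p) volume) (hv' : MemLp v' (ENNReal.ofReal p) volume)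
    (hm' : MemLp m' (ENNReal.ofReal (conjExp p)) volume) (hF : MemLp F (ENNReal.ofReal p) volume)
    (hvv' : ∀ j, HasWeakPartial i (fun x => v x j) (fun x => v' x j))
    (hmm' : ∀ j, HasWeakPartial i (fun x => pPower p (v x) j) (fun x => m' x j)) :
    |∫ x, inner ℝ (m' x) (F x)| ≤
      p * (2 ^ p * (2 * ∫ x, ‖v x‖ ^ p) + (∫ x, ‖v' x‖ ^ p) + ∫ x, ‖F x‖ ^ p) := by
  have hp0 : 0 < p := by linarith
  have := (holderConjugate_conjExp hp).ennrealOfReal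
  have hm := memLp_pPower hp hv
  set m := fun x => pPower p (v x) with hmdef
  set e : Vec d := EuclideanSpace.single i 1
  have hder := hasDerivAt_vcorr ENNReal.ofReal_ne_top hm hm' hF hmm' 0
  rw [zero_smul, vcorr_zero hm' hF] at hder
  have hiF : Integrable fun x => ‖F x‖ ^ p := integrable_norm_rpow hp0 hF
  have hiv : Integrable fun x => ‖v x‖ ^ p := integrable_norm_rpow hp0 hv
  rw [← Real.norm_eq_abs]
  refine hder.le_of_lip' (by positivity) (Eventually.of_forall fun s => ?_)
  rcases eq_or_ne s 0 with rfl | hs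
  · simp
  have habs : 0 < |s| := abs_pos.2 hs
  simp only [zero_smul, sub_zero]
  rw [vcorr_sub_zero hm hF, Real.norm_eq_abs s]
  have hivt : Integrable fun x => ‖v (x + s • e)‖ ^ p :=
    integrable_norm_rpow hp0 (memLp_translate hv _)
  have hiΔ : Integrable fun x => ‖v (x + s • e) - v x‖ ^ p :=
    integrable_norm_rpow hp0 ((memLp_translate hv _).sub hv)
  have hpt : ∀ x, ‖inner ℝ (m (x + s • e) - m x) (F x)‖ ≤
      p * |s| * (2 ^ p * (‖v x‖ ^ p + ‖v (x + s • e)‖ ^ p)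
        + (|s| ^ p)⁻¹ * ‖v (x + s • e) - v x‖ ^ p + ‖F x‖ ^ p) := by
    intro x
    refine (norm_inner_le_norm _ _).trans ?_
    have h1 := norm_pPower_sub_le hp (v x) (v (x + s • e))
    -- dividing the increment by `|s|` makes its `p`-th power comparable to that of `∂_i v`
    have h2 := rpow_mul_mul_le hp (x := ‖v x‖ + ‖v (x + s • e)‖)
      (y := |s|⁻¹ * ‖v (x + s • e) - v x‖) (z := ‖F x‖) (by positivity) (by positivity)
      (by positivity)
    have h3 := add_rpow_le_two_rpow_mul hp (norm_nonneg (v x)) (norm_nonneg (v (x + s • e)))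
    rw [Real.mul_rpow (by positivity) (by positivity), Real.inv_rpow habs.le] at h2
    calc ‖m (x + s • e) - m x‖ * ‖F x‖
        ≤ (p * (‖v x‖ + ‖v (x + s • e)‖) ^ (p - 2) * ‖v (x + s • e) - v x‖) * ‖F x‖ := by gcongr
      _ = p * |s| * ((‖v x‖ + ‖v (x + s • e)‖) ^ (p - 2) * (|s|⁻¹ * ‖v (x + s • e) - v x‖)
            * ‖F x‖) := by field_simp
      _ ≤ _ := by gcongr; linarith
  have hint : Integrable fun x => 2 ^ p * (‖v x‖ ^ p + ‖v (x + s • e)‖ ^ p)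
        + (|s| ^ p)⁻¹ * ‖v (x + s • e) - v x‖ ^ p + ‖F x‖ ^ p :=
    (((hiv.add hivt).const_mul _).add (hiΔ.const_mul _)).add hiF
  refine (norm_integral_le_of_norm_le (hint.const_mul (p * |s|))
    (Eventually.of_forall hpt)).trans ?_
  rw [integral_const_mul, mul_comm p, mul_assoc, mul_comm _ |s|]
  gcongr
  have hi1 : Integrable fun x => 2 ^ p * (‖v x‖ ^ p + ‖v (x + s • e)‖ ^ p) :=
    (hiv.add hivt).const_mul _
  have hi2 : Integrable fun x => (|s| ^ p)⁻¹ * ‖v (x + s • e) - v x‖ ^ p := hiΔ.const_mul _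
  have hi3 : Integrable fun x => 2 ^ p * (‖v x‖ ^ p + ‖v (x + s • e)‖ ^ p)
    + (|s| ^ p)⁻¹ * ‖v (x + s • e) - v x‖ ^ p := hi1.add hi2
  rw [integral_add hi3 hiF, integral_add hi1 hi2, integral_const_mul,
    integral_add hiv hivt, integral_add_right_eq_self (fun x => ‖v x‖ ^ p), integral_const_mul,
    ← two_mul]
  gcongr
  rw [inv_mul_le_iff₀ (by positivity)]
  exact integral_translate_sub_rpow_le hp hv hv' hvv' s

/-- The weak form of `a v_p · ∂_i v = a ∂_i (|v|^p / p)`, for a bounded coefficient `a` with bounded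
derivative. By convexity the difference quotients of `|v|^p` differ from `p v_p · ∂_i v` by at most
a difference quotient of the symmetrized correlation of `v_p` and `v`, which vanishes in the
limit. -/
theorem integral_mul_inner_pPower_partial (hp : 2 ≤ p) {v v' m' : Vec d → Vec d} {i : Fin d}
    (hv : MemLp v (ENNReal.ofReal p) volume) (hv' : MemLp v' (ENNReal.ofReal p) volume)
    (hm' : MemLp m' (ENNReal.ofReal (conjExp p)) volume)
    (hvv' : ∀ j, HasWeakPartial i (fun x => v x j) (fun x => v' x j))
    (hmm' : ∀ j, HasWeakPartial i (fun x => pPower p (v x) j) (fun x => m' x j))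
    {a : Vec d → ℝ} (ha : ContDiff ℝ 1 a) {K K' : ℝ} (haK : ∀ x, |a x| ≤ K)
    (haK' : ∀ x, |partialD i a x| ≤ K') :
    p * ∫ x, a x * inner ℝ (pPower p (v x)) (v' x) = -∫ x, partialD i a x * ‖v x‖ ^ p := by
  have hp0 : 0 < p := by linarith
  have := (holderConjugate_conjExp hp).ennrealOfReal
  have hm := memLp_pPower hp hv
  set m := fun x => pPower p (v x) with hmdef
  set e : Vec d := EuclideanSpace.single i 1 with he
  have hiv : Integrable fun x => ‖v x‖ ^ p := integrable_norm_rpow hp0 hv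
  have hg : MemLp (fun x => a x • m x) (ENNReal.ofReal (conjExp p)) volume := by
    refine hm.of_le_mul (c := K) (ha.continuous.aestronglyMeasurable.smul hm.1)
      (Eventually.of_forall fun x => ?_)
    rw [norm_smul]
    gcongr
    exact haK x
  set X : ℝ → ℝ := fun s => vcorr v (fun x => a x • m x) (s • e) with hXdef
  have hX : HasDerivAt X (∫ x, a x * inner ℝ (m x) (v' x)) 0 := by
    have h1 := hasDerivAt_vcorr ENNReal.ofReal_ne_top hv hv' hg hvv' 0
    rw [zero_smul, vcorr_zero hv' hg] at h1
    simpa only [inner_smul_right, real_inner_comm] using h1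
  set F : ℝ → Vec d → ℝ := fun s x => (a (x - s • e) - a x) * ‖v x‖ ^ p with hFdef
  have hatr : ∀ s : ℝ, Continuous fun x => a (x - s • e) := fun s => by
    have := ha.continuous
    fun_prop
  have hFint : ∀ s, Integrable (F s) := by
    intro s
    refine hiv.bdd_mul (c := K + K) ((hatr s).sub ha.continuous).aestronglyMeasurable
      (Eventually.of_forall fun x => ?_)
    exact (norm_sub_le _ _).trans (add_le_add (haK _) (haK _))
  -- the increment of `|v|^p` weighted with `a`, the translation having been moved onto `a`
  set R : ℝ → ℝ := fun s => ∫ x, F s x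
  have hR : HasDerivAt R (∫ x, -partialD i a x * ‖v x‖ ^ p) 0 := by
    have h1 := (hasDerivAt_integral_of_dominated_loc_of_deriv_le (μ := (volume : Measure (Vec d)))
      (F := F) (F' := fun s x => -partialD i a (x - s • e) * ‖v x‖ ^ p) (x₀ := 0)
      (s := Set.univ) (bound := fun x => K' * ‖v x‖ ^ p) univ_mem
      (Eventually.of_forall fun s => (hFint s).aestronglyMeasurable) (hFint 0)
      (by
        have h2 : Continuous fun x => partialD i a (x - (0 : ℝ) • e) := by
          unfold partialD
          exact ((ha.continuous_fderiv one_ne_zero).comp (by fun_prop)).clm_apply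
            continuous_const
        exact h2.neg.aestronglyMeasurable.mul hiv.aestronglyMeasurable)
      (Eventually.of_forall fun x s _ => by
        rw [norm_mul, norm_neg, Real.norm_of_nonneg (by positivity : 0 ≤ ‖v x‖ ^ p)]
        gcongr
        exact haK' _)
      (hiv.const_mul _)
      (Eventually.of_forall fun x s _ => by
        have h3 : HasDerivAt (fun s : ℝ => x - s • e) (-e) s := by
          simpa using ((hasDerivAt_id s).smul_const e).const_sub x
        have h4 := ((ha.differentiable one_ne_zero) (x - s • e)).hasFDerivAt.comp_hasDerivAt s h3
        have h5 := (h4.sub_const (a x)).mul_const (‖v x‖ ^ p)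
        simpa only [map_neg] using! h5)).2
    simpa only [zero_smul, sub_zero] using h1
  have hReq : ∀ s : ℝ, R s = ∫ x, a x * (‖v (x + s • e)‖ ^ p - ‖v x‖ ^ p) := by
    intro s
    have hivt : Integrable fun x => ‖v (x + s • e)‖ ^ p :=
      integrable_norm_rpow hp0 (memLp_translate hv _)
    have h1 : Integrable fun x => a x * ‖v (x + s • e)‖ ^ p :=
      hivt.bdd_mul (c := K) ha.continuous.aestronglyMeasurable (Eventually.of_forall haK)
    have h2 : Integrable fun x => a x * ‖v x‖ ^ p :=
      hiv.bdd_mul (c := K) ha.continuous.aestronglyMeasurable (Eventually.of_forall haK)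
    have h3 : Integrable fun x => a (x - s • e) * ‖v x‖ ^ p :=
      hiv.bdd_mul (c := K) (hatr s).aestronglyMeasurable (Eventually.of_forall fun x => haK _)
    simp only [R, hFdef, mul_sub, sub_mul]
    rw [integral_sub h1 h2, integral_sub h3 h2,
      ← integral_add_right_eq_self (fun x => a (x - s • e) * ‖v x‖ ^ p) (s • e)]
    simp only [add_sub_cancel_right]
  -- the bound for the convexity defect: a symmetric second difference
  set S : ℝ → ℝ := fun s => K * p * (2 * vcorr m v 0 - vcorr m v (s • e) - vcorr m v (-(s • e)))
  have hS : HasDerivAt S 0 0 := by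
    have h1 := hasDerivAt_vcorr ENNReal.ofReal_ne_top hm hm' hv hmm' 0
    have h2 : HasDerivAt (fun s : ℝ => vcorr m v ((-s) • e)) (-vcorr m' v ((0 : ℝ) • e)) 0 := by
      have h3 := hasDerivAt_vcorr ENNReal.ofReal_ne_top hm hm' hv hmm' (-0)
      have h4 := h3.scomp 0 (hasDerivAt_id (0 : ℝ)).neg
      exact h4.congr_deriv (by simp [e])
    have h5 := ((h1.const_sub (2 * vcorr m v 0)).sub h2).const_mul (K * p)
    simpa [S, neg_smul] using! h5
  have hT := eq_zero_of_hasDerivAt_of_abs_le (hR.sub ((hX.sub_const (X 0)).const_mul p)) hS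
    (by simp [R, hFdef]) (by simp only [S, zero_smul, neg_zero]; ring) (fun s => by
      have hXs : X s - X 0 = ∫ x, a x * inner ℝ (m x) (v (x + s • e) - v x) := by
        simp only [hXdef, zero_smul]
        rw [vcorr_sub_zero hv hg]
        simp only [inner_smul_right, real_inner_comm]
      have hi1 : Integrable fun x => a x * (‖v (x + s • e)‖ ^ p - ‖v x‖ ^ p) :=
        ((integrable_norm_rpow hp0 (memLp_translate hv _)).sub hiv).bdd_mul (c := K)
          ha.continuous.aestronglyMeasurable (Eventually.of_forall haK)
      have hi2 : Integrable fun x => a x * inner ℝ (m x) (v (x + s • e) - v x) :=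
        (integrable_inner hm ((memLp_translate hv _).sub hv)).bdd_mul (c := K)
          ha.continuous.aestronglyMeasurable (Eventually.of_forall haK)
      have hi3 := integrable_inner ((memLp_translate hm (s • e)).sub hm)
        ((memLp_translate hv (s • e)).sub hv)
      simp only [Pi.sub_apply, S]
      rw [hXs, hReq, ← integral_const_mul, ← integral_sub hi1 (hi2.const_mul p),
        ← integral_inner_translate_sub hm hv, ← integral_const_mul, ← Real.norm_eq_abs]
      refine norm_integral_le_of_norm_le (hi3.const_mul _) (Eventually.of_forall fun x => ?_)
      have h1 := inner_pPower_sub_le hp (v x) (v (x + s • e))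
      have h2 := inner_pPower_sub_le hp (v (x + s • e)) (v x)
      have h3 : a x * (‖v (x + s • e)‖ ^ p - ‖v x‖ ^ p)
            - p * (a x * inner ℝ (m x) (v (x + s • e) - v x))
          = a x * (‖v (x + s • e)‖ ^ p - ‖v x‖ ^ p
            - p * inner ℝ (m x) (v (x + s • e) - v x)) := by ring
      rw [h3, norm_mul, mul_assoc]
      refine mul_le_mul (haK x) ?_ (norm_nonneg _) ((abs_nonneg _).trans (haK x))
      rw [Real.norm_of_nonneg (by linarith)]
      have h4 : v x - v (x + s • e) = -(v (x + s • e) - v x) := by abel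
      rw [h4, inner_neg_right] at h2
      simp only [inner_sub_left, hmdef, mul_sub] at h1 h2 ⊢
      linarith)
  simp only [neg_mul, integral_neg] at hT
  linarith

end Sobolev

/-! ### Mollification -/

section Mollify

variable {d : ℕ} {P Q : ℝ≥0∞}

/-- The scalar convolution `f * κ`. -/
noncomputable def conv (f κ : Vec d → ℝ) (x : Vec d) : ℝ := ∫ t, f t * κ (x - t)

theorem conv_eq_convolution (f κ : Vec d → ℝ) :
    conv f κ = f ⋆[ContinuousLinearMap.mul ℝ ℝ, volume] κ := rfl

theorem memLp_comp_sub_left {E : Type*} [NormedAddCommGroup E] {κ : Vec d → E}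
    (hκ : MemLp κ P volume) (x : Vec d) : MemLp (fun t => κ (x - t)) P volume :=
  hκ.comp_measurePreserving (Measure.measurePreserving_sub_left volume x)

theorem IsTest.memLp {κ : Vec d → ℝ} (hκ : IsTest κ) : MemLp κ P volume :=
  hκ.1.continuous.memLp_of_hasCompactSupport hκ.2

/-- The convolution of an `L^P` function with a test function is bounded. -/
theorem exists_abs_conv_le [P.HolderConjugate Q] {f κ : Vec d → ℝ} (hf : MemLp f P volume)
    (hκ : IsTest κ) : ∃ K, ∀ x, |conv f κ x| ≤ K := by
  refine ⟨(eLpNorm f P volume * eLpNorm κ Q volume).toReal, fun x => ?_⟩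
  have hκ' : MemLp κ Q volume := hκ.memLp
  have h := enorm_integral_mul_le hf (memLp_comp_sub_left hκ' x)
  have h2 : eLpNorm (fun t => κ (x - t)) Q volume = eLpNorm κ Q volume :=
    eLpNorm_comp_measurePreserving hκ'.1 (Measure.measurePreserving_sub_left volume x)
  rw [h2] at h
  rw [← Real.norm_eq_abs, ← toReal_enorm]
  exact ENNReal.toReal_mono (ENNReal.mul_ne_top hf.2.ne hκ'.2.ne) h

theorem contDiff_conv {f κ : Vec d → ℝ} (hf : LocallyIntegrable f) (hκ : IsTest κ) :
    ContDiff ℝ ((⊤ : ℕ∞) : WithTop ℕ∞) (conv f κ) := by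
  rw [conv_eq_convolution]
  exact hκ.2.contDiff_convolution_right _ hf hκ.1

theorem partialD_conv {f κ : Vec d → ℝ} (hf : LocallyIntegrable f) (hκ : IsTest κ) (i : Fin d)
    (x : Vec d) : partialD i (conv f κ) x = conv f (partialD i κ) x := by
  have h1 := hκ.2.hasFDerivAt_convolution_right (μ := (volume : Measure (Vec d)))
    (ContinuousLinearMap.mul ℝ ℝ) hf (hκ.1.of_le (by exact_mod_cast le_top)) x
  unfold partialD
  rw [conv_eq_convolution, h1.fderiv, convolution_precompR_apply _ hf (hκ.2.fderiv ℝ)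
    (hκ.1.continuous_fderiv (by simp))]
  rfl

/-- Convolution with a test function turns weak derivatives into classical ones. -/
theorem HasWeakPartial.partialD_conv {f f' κ : Vec d → ℝ} {i : Fin d} (h : HasWeakPartial i f f')
    (hκ : IsTest κ) (x : Vec d) : partialD i (conv f κ) x = conv f' κ x := by
  rw [PNS.partialD_conv h.1 hκ]
  have := h.2.2 _ (hκ.comp_sub_left x)
  simp only [partialD_comp_sub_left hκ.differentiable, mul_neg, integral_neg, neg_inj] at this
  exact this

/-- Jensen's inequality for a probability density. -/
theorem lintegral_mul_rpow_le {α : Type*} [MeasurableSpace α] {μ : Measure α} {G k : α → ℝ≥0∞}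
    (hG : AEMeasurable G μ) (hk : AEMeasurable k μ) (hk1 : ∫⁻ t, k t ∂μ = 1)
    (hkt : ∀ t, k t ≠ ∞) {r : ℝ} (hr : 1 ≤ r) :
    (∫⁻ t, G t * k t ∂μ) ^ r ≤ ∫⁻ t, G t ^ r * k t ∂μ := by
  have hr0 : 0 < r := by linarith
  have h1r : 0 ≤ 1 - 1 / r := by rw [sub_nonneg, div_le_one hr0]; exact hr
  have h := ENNReal.lintegral_mul_norm_pow_le (μ := μ) (f := fun t => G t ^ r * k t) (g := k)
    ((hG.pow_const r).mul hk) hk (p := 1 / r) (q := 1 - 1 / r) (by positivity) h1r (by ring)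
  rw [hk1, ENNReal.one_rpow, mul_one] at h
  have heq : ∀ t, (G t ^ r * k t) ^ (1 / r) * k t ^ (1 - 1 / r) = G t * k t := by
    intro t
    rw [ENNReal.mul_rpow_of_nonneg _ _ (by positivity), ← ENNReal.rpow_mul,
      mul_one_div_cancel hr0.ne', ENNReal.rpow_one, mul_assoc]
    rcases eq_or_ne (k t) 0 with h0 | h0
    · rw [h0, ENNReal.zero_rpow_of_pos (by positivity)]; simp
    · rw [← ENNReal.rpow_add _ _ h0 (hkt t)]; simp
  simp only [heq] at h
  calc (∫⁻ t, G t * k t ∂μ) ^ r ≤ ((∫⁻ t, G t ^ r * k t ∂μ) ^ (1 / r)) ^ r := by gcongr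
    _ = _ := by rw [← ENNReal.rpow_mul, one_div_mul_cancel hr0.ne', ENNReal.rpow_one]

/-- Convolution with a probability density is a contraction of `L^r`. -/
theorem lintegral_conv_rpow_le {κ : Vec d → ℝ} (hκ : Continuous κ) (hκ0 : ∀ x, 0 ≤ κ x)
    (hκi : Integrable κ) (hκ1 : ∫ x, κ x = 1) {G : Vec d → ℝ≥0∞} (hG : AEMeasurable G)
    {r : ℝ} (hr : 1 ≤ r) :
    ∫⁻ x, (∫⁻ t, G t * ENNReal.ofReal (κ (x - t))) ^ r ≤ ∫⁻ x, G x ^ r := by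
  have h1 : ∫⁻ x, ENNReal.ofReal (κ x) = 1 := by
    rw [← ofReal_integral_eq_lintegral_ofReal hκi (Eventually.of_forall hκ0), hκ1,
      ENNReal.ofReal_one]
  calc ∫⁻ x, (∫⁻ t, G t * ENNReal.ofReal (κ (x - t))) ^ r
      ≤ ∫⁻ x, ∫⁻ t, G t ^ r * ENNReal.ofReal (κ (x - t)) := by
        refine lintegral_mono fun x => lintegral_mul_rpow_le hG
          (by fun_prop) ?_ (fun t => ENNReal.ofReal_ne_top) hr
        rw [lintegral_sub_left_eq_self (fun t => ENNReal.ofReal (κ t)) x, h1]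
    _ = ∫⁻ t, ∫⁻ x, G t ^ r * ENNReal.ofReal (κ (x - t)) := by
        refine lintegral_lintegral_swap ?_
        refine AEMeasurable.mul ?_ (by fun_prop)
        exact (hG.pow_const r).comp_quasiMeasurePreserving Measure.quasiMeasurePreserving_snd
    _ = ∫⁻ t, G t ^ r := by
        refine lintegral_congr fun t => ?_
        rw [lintegral_const_mul _ (by fun_prop),
          lintegral_sub_right_eq_self (fun x => ENNReal.ofReal (κ x)) t, h1, mul_one]

theorem lintegral_enorm_conv_rpow_le {f κ : Vec d → ℝ} (hκ : Continuous κ) (hκ0 : ∀ x, 0 ≤ κ x)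
    (hκi : Integrable κ) (hκ1 : ∫ x, κ x = 1) (hf : AEStronglyMeasurable f volume)
    {r : ℝ} (hr : 1 ≤ r) : ∫⁻ x, ‖conv f κ x‖ₑ ^ r ≤ ∫⁻ x, ‖f x‖ₑ ^ r := by
  refine le_trans (lintegral_mono fun x => ?_)
    (lintegral_conv_rpow_le hκ hκ0 hκi hκ1 hf.enorm hr)
  gcongr
  refine (enorm_integral_le_lintegral_enorm _).trans_eq (lintegral_congr fun t => ?_)
  rw [enorm_mul, ← ofReal_norm (κ (x - t)), Real.norm_of_nonneg (hκ0 _)]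

theorem isTest_J {ζ : Vec d → ℝ} (hζ : IsMollifier ζ) {ε : ℝ} (hε : 0 < ε) : IsTest (J ζ ε) := by
  refine ⟨contDiff_const.mul (hζ.test.1.comp (contDiff_const_smul _)), ?_⟩
  refine HasCompactSupport.mul_left ?_
  exact hζ.test.2.comp_smul (inv_ne_zero hε.ne')

theorem J_nonneg {ζ : Vec d → ℝ} (hζ : IsMollifier ζ) {ε : ℝ} (hε : 0 < ε) (x : Vec d) :
    0 ≤ J ζ ε x :=
  mul_nonneg (by positivity) (hζ.nonneg _)

theorem integral_J {ζ : Vec d → ℝ} (hζ : IsMollifier ζ) {ε : ℝ} (hε : 0 < ε) :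
    ∫ x, J ζ ε x = 1 := by
  unfold J
  rw [integral_const_mul, Measure.integral_comp_smul, finrank_euclideanSpace, Fintype.card_fin,
    hζ.integral_eq_one, abs_of_nonneg (by positivity)]
  have : ε ^ d ≠ 0 := by positivity
  simp [this]

theorem mollify_eq (ζ : Vec d → ℝ) (ε : ℝ) (w : Vec d → Vec d) (x : Vec d) :
    mollify ζ ε w x = ∫ t, J ζ ε (x - t) • w t := by
  rw [mollify, convolution_eq_swap]
  rfl

theorem mollify_apply {ζ : Vec d → ℝ} (hζ : IsMollifier ζ) {ε : ℝ} (hε : 0 < ε)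
    {w : Vec d → Vec d} (hw : LocallyIntegrable w) (x : Vec d) (j : Fin d) :
    mollify ζ ε w x j = conv (fun x => w x j) (J ζ ε) x := by
  have hJ := isTest_J hζ hε
  have hint : Integrable fun t => J ζ ε (x - t) • w t := by
    have h := (hJ.2.convolutionExists_left (μ := (volume : Measure (Vec d)))
      (ContinuousLinearMap.lsmul ℝ ℝ) hJ.1.continuous hw) x
    exact h.integrable_swap
  rw [mollify_eq]
  have h := (EuclideanSpace.proj j : Vec d →L[ℝ] ℝ).integral_comp_comm hint
  simp only [EuclideanSpace.coe_proj, PiLp.smul_apply, smul_eq_mul] at h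
  rw [← h, conv]
  congr 1; ext t; ring

theorem lintegral_enorm_mollify_rpow_le {ζ : Vec d → ℝ} (hζ : IsMollifier ζ) {ε : ℝ} (hε : 0 < ε)
    {w : Vec d → Vec d} (hw : AEStronglyMeasurable w volume) {r : ℝ} (hr : 1 ≤ r) :
    ∫⁻ x, ‖mollify ζ ε w x‖ₑ ^ r ≤ ∫⁻ x, ‖w x‖ₑ ^ r := by
  have hJ := isTest_J hζ hε
  refine le_trans (lintegral_mono fun x => ?_)
    (lintegral_conv_rpow_le hJ.1.continuous (J_nonneg hζ hε) hJ.integrable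
      (integral_J hζ hε) hw.enorm hr)
  gcongr
  rw [mollify_eq]
  refine (enorm_integral_le_lintegral_enorm _).trans_eq (lintegral_congr fun t => ?_)
  rw [enorm_smul, ← ofReal_norm (J ζ ε (x - t)), Real.norm_of_nonneg (J_nonneg hζ hε _), mul_comm]

/-- The product rule for the weak divergence of `u ⊗ f` with a smooth divergence-free `u`. -/
theorem sum_integral_transport {u : Fin d → Vec d → ℝ}
    (hu : ∀ i, ContDiff ℝ ((⊤ : ℕ∞) : WithTop ℕ∞) (u i)) (hdiv : ∀ x, ∑ i, partialD i (u i) x = 0)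
    {f : Vec d → ℝ} {f' : Fin d → Vec d → ℝ} (hf : ∀ i, HasWeakPartial i f (f' i))
    {φ : Vec d → ℝ} (hφ : IsTest φ) (hfl : LocallyIntegrable f) :
    ∑ i, ∫ x, (u i x * f x) * partialD i φ x = -∫ x, (∑ i, u i x * f' i x) * φ x := by
  have htest : ∀ i, IsTest fun x => u i x * φ x := fun i => ⟨(hu i).mul hφ.1, hφ.2.mul_left⟩
  have hpd : ∀ i x, partialD i (fun x => u i x * φ x) x =
      u i x * partialD i φ x + partialD i (u i) x * φ x := by
    intro i x
    unfold partialD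
    rw [fderiv_fun_mul ((hu i).differentiable (by simp) x) (hφ.differentiable x)]
    simp [mul_comm]
  have hcont : ∀ i, Continuous (partialD i (u i)) := fun i =>
    ((hu i).continuous_fderiv (by simp)).clm_apply continuous_const
  have hI : ∀ {g k : Vec d → ℝ}, LocallyIntegrable g → Continuous k → HasCompactSupport k →
      Integrable fun x => g x * k x := fun hg hk hks => by
    simpa only [smul_eq_mul, mul_comm] using hg.integrable_smul_left_of_hasCompactSupport hk hks
  have h1 : ∀ i, ∫ x, (u i x * f x) * partialD i φ x =
      -(∫ x, u i x * f' i x * φ x) - ∫ x, f x * (partialD i (u i) x * φ x) := by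
    intro i
    have h2 := (hf i).2.2 _ (htest i)
    have h3 : ∫ x, u i x * f' i x * φ x = ∫ x, f' i x * (u i x * φ x) := by
      congr 1; ext x; ring
    rw [h3, ← h2, ← integral_sub]
    · congr 1; ext x; rw [hpd]; ring
    · exact hI hfl ((htest i).partialD i).1.continuous ((htest i).partialD i).2
    · exact hI hfl ((hcont i).mul hφ.1.continuous) hφ.2.mul_left
  simp only [h1, Finset.sum_sub_distrib, Finset.sum_neg_distrib]
  rw [← integral_finsetSum, ← integral_finsetSum]
  · have h4 : ∀ x, ∑ i, f x * (partialD i (u i) x * φ x) = 0 := fun x => by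
      rw [← Finset.mul_sum, ← Finset.sum_mul, hdiv]; simp
    simp only [h4, integral_zero, sub_zero, Finset.sum_mul]
  · intro i _
    exact hI hfl ((hcont i).mul hφ.1.continuous) hφ.2.mul_left
  · intro i _
    have := hI (hf i).2.1 (htest i).1.continuous (htest i).2
    refine this.congr (Eventually.of_forall fun x => ?_)
    simp only; ring

end Mollify

/-! ### A Gagliardo-Nirenberg inequality -/

section GagliardoNirenberg

variable {d : ℕ} {p : ℝ}

/-- Fatou's lemma for an almost everywhere convergent sequence with bounded integrals. -/
theorem lintegral_le_of_ae_tendsto {α : Type*} [MeasurableSpace α] {μ : Measure α}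
    {F : ℕ → α → ℝ≥0∞} {G : α → ℝ≥0∞} {B : ℕ → ℝ≥0∞} {b : ℝ≥0∞} (hF : ∀ n, AEMeasurable (F n) μ)
    (hFG : ∀ᵐ x ∂μ, Tendsto (fun n => F n x) atTop (𝓝 (G x))) (hB : ∀ n, ∫⁻ x, F n x ∂μ ≤ B n)
    (hb : Tendsto B atTop (𝓝 b)) : ∫⁻ x, G x ∂μ ≤ b :=
  calc ∫⁻ x, G x ∂μ = ∫⁻ x, liminf (fun n => F n x) atTop ∂μ :=
        lintegral_congr_ae (hFG.mono fun _ hx => hx.liminf_eq.symm)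
    _ ≤ liminf (fun n => ∫⁻ x, F n x ∂μ) atTop := lintegral_liminf_le' hF
    _ ≤ liminf B atTop := liminf_le_liminf (Eventually.of_forall hB)
    _ = b := hb.liminf_eq

theorem sum_rpow_le {ι : Type*} [Fintype ι] (a : ι → ℝ≥0∞) {r : ℝ} (hr : 0 < r) :
    (∑ i, a i) ^ r ≤ (Fintype.card ι : ℝ≥0∞) ^ r * ∑ i, a i ^ r := by
  rcases isEmpty_or_nonempty ι with h | h
  · simp [hr]
  obtain ⟨i₀, -, hi₀⟩ := Finset.exists_max_image Finset.univ a Finset.univ_nonempty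
  have h1 : ∑ i, a i ≤ Fintype.card ι * a i₀ := by
    have := Finset.sum_le_card_nsmul Finset.univ a (a i₀) hi₀
    simpa using this
  calc (∑ i, a i) ^ r ≤ (Fintype.card ι * a i₀) ^ r := by gcongr
    _ = (Fintype.card ι : ℝ≥0∞) ^ r * a i₀ ^ r := ENNReal.mul_rpow_of_nonneg _ _ hr.le
    _ ≤ _ := by
        gcongr
        exact Finset.single_le_sum (f := fun i => a i ^ r) (fun i _ => zero_le)
          (Finset.mem_univ i₀)

theorem enorm_fderiv_le_sum (f : Vec d → ℝ) (x : Vec d) :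
    ‖fderiv ℝ f x‖ₑ ≤ ∑ i, ‖partialD i f x‖ₑ := by
  have h : ‖fderiv ℝ f x‖ ≤ ∑ i, ‖partialD i f x‖ := by
    refine ContinuousLinearMap.opNorm_le_bound _ (by positivity) fun y => ?_
    have hy : y = ∑ i, y i • (EuclideanSpace.single i (1 : ℝ) : Vec d) := by
      ext j
      simp [Pi.single_apply]
    conv_lhs => rw [hy]
    rw [map_sum, Finset.sum_mul]
    refine (norm_sum_le _ _).trans (Finset.sum_le_sum fun i _ => ?_)
    rw [map_smul, norm_smul, mul_comm]
    unfold partialD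
    gcongr
    exact PiLp.norm_apply_le y i
  simp_rw [← ofReal_norm]
  rw [← ENNReal.ofReal_sum_of_nonneg fun i _ => norm_nonneg _]
  exact ENNReal.ofReal_le_ofReal h

/-- The Sobolev inequality of exponent `1`, applied to `|f|^p` cut off at large distances. -/
theorem lintegral_rpow_le_of_contDiff (hd : 2 ≤ d) (hp : 2 ≤ p) {f : Vec d → ℝ}
    (hf : ContDiff ℝ 1 f) (hfp : ∫⁻ x, ‖f x‖ₑ ^ p ≠ ∞) :
    ∫⁻ x, ‖f x‖ₑ ^ (p * (d / (d - 1) : ℝ)) ≤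
      lintegralPowLePowLIntegralFDerivConst (volume : Measure (Vec d)) (d / (d - 1) : ℝ) *
        (ENNReal.ofReal p * ∫⁻ x, ‖f x‖ₑ ^ (p - 1) * ‖fderiv ℝ f x‖ₑ) ^ (d / (d - 1) : ℝ) := by
  set d' : ℝ := d / (d - 1) with hd'
  have hd2 : (2 : ℝ) ≤ d := by exact_mod_cast hd
  have hd'0 : 0 < d' := div_pos (by linarith) (by linarith)
  have hconj : Real.HolderConjugate (Module.finrank ℝ (Vec d)) d' := by
    rw [finrank_euclideanSpace, Fintype.card_fin]
    exact Real.HolderConjugate.conjExponent (by linarith)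
  -- the cutoffs `X n` tend to `1`, and their gradients are at most `B / (n + 1)`
  let χ : ContDiffBump (0 : Vec d) := ⟨1, 2, one_pos, one_lt_two⟩
  have hχ : ContDiff ℝ 1 (χ : Vec d → ℝ) := χ.contDiff
  obtain ⟨B, hB⟩ := (hχ.continuous_fderiv one_ne_zero).bounded_above_of_compact_support
    (χ.hasCompactSupport.fderiv ℝ)
  have hB0 : 0 ≤ B := (norm_nonneg _).trans (hB 0)
  let c : ℕ → ℝ := fun n => 1 / ((n : ℝ) + 1)
  have hc0 : ∀ n, 0 < c n := fun n => by positivity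
  have hc : Tendsto c atTop (𝓝 0) := tendsto_one_div_add_atTop_nhds_zero_nat
  let X : ℕ → Vec d → ℝ := fun n x => χ (c n • x)
  have hX : ∀ n, ContDiff ℝ 1 (X n) := fun n => hχ.comp (contDiff_const_smul _)
  have hXB : ∀ n x, ‖fderiv ℝ (X n) x‖ ≤ c n * B := by
    intro n x
    have h1 : HasFDerivAt (X n)
        ((fderiv ℝ χ (c n • x)).comp (c n • ContinuousLinearMap.id ℝ _)) x :=
      ((hχ.differentiable one_ne_zero) _).hasFDerivAt.comp x
        ((hasFDerivAt_id x).const_smul (c n))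
    rw [h1.fderiv, ContinuousLinearMap.comp_smul, ContinuousLinearMap.comp_id, norm_smul,
      Real.norm_of_nonneg (hc0 n).le]
    exact mul_le_mul_of_nonneg_left (hB _) (hc0 n).le
  have hX1 : ∀ n x, ‖X n x‖ ≤ 1 := fun n x => by
    rw [Real.norm_of_nonneg χ.nonneg]; exact χ.le_one
  have hFp : ContDiff ℝ 1 fun x => ‖f x‖ ^ p := hf.norm_rpow (by linarith)
  let u : ℕ → Vec d → ℝ := fun n x => X n x * ‖f x‖ ^ p
  have hu : ∀ n, ContDiff ℝ 1 (u n) := fun n => (hX n).mul hFp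
  have hus : ∀ n, HasCompactSupport (u n) := fun n =>
    HasCompactSupport.mul_right (χ.hasCompactSupport.comp_smul (hc0 n).ne')
  set A := ∫⁻ x, ‖f x‖ₑ ^ p with hA
  set D := ENNReal.ofReal p * ∫⁻ x, ‖f x‖ₑ ^ (p - 1) * ‖fderiv ℝ f x‖ₑ with hD
  have henp : ∀ x, ‖‖f x‖ ^ p‖ₑ = ‖f x‖ₑ ^ p := fun x => by
    rw [Real.enorm_rpow_of_nonneg (norm_nonneg _) (by linarith), enorm_norm]
  have hfd : ∀ n x, ‖fderiv ℝ (u n) x‖ₑ ≤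
      ENNReal.ofReal (c n * B) * ‖f x‖ₑ ^ p +
        ENNReal.ofReal p * (‖f x‖ₑ ^ (p - 1) * ‖fderiv ℝ f x‖ₑ) := by
    intro n x
    have h1 : fderiv ℝ (u n) x = X n x • fderiv ℝ (fun x => ‖f x‖ ^ p) x
        + ‖f x‖ ^ p • fderiv ℝ (X n) x :=
      fderiv_fun_mul ((hX n).differentiable one_ne_zero x) (hFp.differentiable one_ne_zero x)
    have h2 := norm_fderiv_norm_rpow_le (hf.differentiable one_ne_zero) (x := x)
      (p := p) (by linarith)
    rw [h1, add_comm (X n x • _)]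
    have h3 : ‖‖f x‖ ^ p • fderiv ℝ (X n) x + X n x • fderiv ℝ (fun x => ‖f x‖ ^ p) x‖ₑ ≤
        ‖‖f x‖ ^ p • fderiv ℝ (X n) x‖ₑ + ‖X n x • fderiv ℝ (fun x => ‖f x‖ ^ p) x‖ₑ := by
      simp_rw [← ofReal_norm]
      rw [← ENNReal.ofReal_add (norm_nonneg _) (norm_nonneg _)]
      exact ENNReal.ofReal_le_ofReal (norm_add_le _ _)
    refine h3.trans (add_le_add ?_ ?_)
    · rw [enorm_smul, henp, mul_comm, ← ofReal_norm (fderiv ℝ (X n) x)]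
      gcongr
      exact hXB n x
    · rw [enorm_smul, ← ofReal_norm, ← ofReal_norm, ← ENNReal.ofReal_mul (norm_nonneg _),
        ← ofReal_norm (f x), ← ofReal_norm (fderiv ℝ f x),
        ENNReal.ofReal_rpow_of_nonneg (norm_nonneg _) (by linarith),
        ← ENNReal.ofReal_mul (by positivity), ← ENNReal.ofReal_mul (by positivity)]
      refine ENNReal.ofReal_le_ofReal ?_
      calc _ ≤ 1 * ‖fderiv ℝ (fun x => ‖f x‖ ^ p) x‖ := by gcongr; exact hX1 n x
        _ ≤ _ := by rw [one_mul, ← mul_assoc]; exact h2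
  have hbound : ∀ n, ∫⁻ x, ‖u n x‖ₑ ^ d' ≤
      lintegralPowLePowLIntegralFDerivConst (volume : Measure (Vec d)) d' *
        (ENNReal.ofReal (c n * B) * A + D) ^ d' := by
    intro n
    refine (lintegral_pow_le_pow_lintegral_fderiv volume (hu n) (hus n) hconj).trans ?_
    gcongr
    refine (lintegral_mono (hfd n)).trans_eq ?_
    have hmf : Measurable fun x => ‖f x‖ₑ ^ p := by
      have := hf.continuous
      fun_prop
    have hmf' : Measurable fun x => ‖f x‖ₑ ^ (p - 1) * ‖fderiv ℝ f x‖ₑ := by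
      have := hf.continuous
      have := hf.continuous_fderiv one_ne_zero
      exact Measurable.mul (by fun_prop) this.enorm.measurable
    rw [lintegral_add_left (hmf.const_mul _), lintegral_const_mul _ hmf,
      lintegral_const_mul _ hmf']
  refine lintegral_le_of_ae_tendsto (F := fun n x => ‖u n x‖ₑ ^ d') (fun n => ?_) ?_ hbound ?_
  · have := (hu n).continuous
    exact (by fun_prop : Measurable fun x => ‖u n x‖ₑ ^ d').aemeasurable
  · refine Eventually.of_forall fun x => ?_
    have hev : ∀ᶠ n in atTop, X n x = 1 := by
      have h1 : Tendsto (fun n => c n • x) atTop (𝓝 0) := by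
        simpa using hc.smul_const x
      filter_upwards [h1 (Metric.closedBall_mem_nhds 0 one_pos)] with n hn
      exact χ.one_of_mem_closedBall hn
    refine tendsto_const_nhds.congr' ?_
    filter_upwards [hev] with n hn
    simp only [u, hn, one_mul]
    rw [henp, ENNReal.rpow_mul]
  · have h1 : Tendsto (fun n => ENNReal.ofReal (c n * B) * A + D) atTop (𝓝 D) := by
      have h2 : Tendsto (fun n => ENNReal.ofReal (c n * B)) atTop (𝓝 0) := by
        have := ENNReal.tendsto_ofReal (hc.mul_const B)
        simpa using this
      have h3 := (ENNReal.Tendsto.mul_const h2 (Or.inr hfp)).add (tendsto_const_nhds (x := D))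
      simpa using h3
    exact ENNReal.Tendsto.const_mul ((ENNReal.continuous_rpow_const.tendsto D).comp h1)
      (Or.inr ENNReal.coe_ne_top)

/-- `‖f‖_{pd'}^p ≤ C ‖f‖_p^{p-1} ‖∇f‖_p` with `d' = d / (d - 1)`, raised to the power `d'`.
The inequality passes from the mollifications of `f` to `f` by Fatou's lemma. -/
theorem gagliardo_nirenberg (hd : 2 ≤ d) (hp : 2 ≤ p) {f : Vec d → ℝ} {g : Fin d → Vec d → ℝ}
    (hf : MemLp f (ENNReal.ofReal p) volume) (hg : ∀ i, MemLp (g i) (ENNReal.ofReal p) volume)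
    (hfg : ∀ i, HasWeakPartial i f (g i)) :
    ∫⁻ x, ‖f x‖ₑ ^ (p * (d / (d - 1) : ℝ)) ≤
      lintegralPowLePowLIntegralFDerivConst (volume : Measure (Vec d)) (d / (d - 1) : ℝ) *
        (ENNReal.ofReal p * ((∫⁻ x, ‖f x‖ₑ ^ p) ^ ((p - 1) / p) *
          ((d : ℝ≥0∞) ^ p * ∑ i, ∫⁻ x, ‖g i x‖ₑ ^ p) ^ (1 / p))) ^ (d / (d - 1) : ℝ) := by
  have hp0 : 0 < p := by linarith
  have hd2 : (2 : ℝ) ≤ d := by exact_mod_cast hd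
  have hd'0 : (0 : ℝ) < d / (d - 1) := div_pos (by linarith) (by linarith)
  let φ : ℕ → ContDiffBump (0 : Vec d) := fun n =>
    ⟨1 / ((n : ℝ) + 1), 2 / ((n : ℝ) + 1), by positivity, by gcongr; norm_num⟩
  have hφt : Tendsto (fun n => (φ n).rOut) atTop (𝓝 0) := by
    have := (tendsto_one_div_add_atTop_nhds_zero_nat (𝕜 := ℝ)).const_mul 2
    rw [mul_zero] at this
    refine this.congr fun n => ?_
    simp only [φ]; ring
  have hφK : ∀ᶠ n in atTop, (φ n).rOut ≤ 2 * (φ n).rIn :=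
    Eventually.of_forall fun n => le_of_eq (by simp only [φ]; ring)
  let κ : ℕ → Vec d → ℝ := fun n => (φ n).normed volume
  have hκ : ∀ n, IsTest (κ n) := fun n => ⟨(φ n).contDiff_normed, (φ n).hasCompactSupport_normed⟩
  have hκ0 : ∀ n x, 0 ≤ κ n x := fun n x => (φ n).nonneg_normed x
  have hκ1 : ∀ n, ∫ x, κ n x = 1 := fun n => (φ n).integral_normed
  have hfl : LocallyIntegrable f := (hfg ⟨0, by omega⟩).1
  have hae : ∀ᵐ x, Tendsto (fun n => conv f (κ n) x) atTop (𝓝 (f x)) := by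
    filter_upwards [ContDiffBump.ae_convolution_tendsto_right_of_locallyIntegrable hφt hφK hfl]
      with x hx
    refine hx.congr fun n => ?_
    rw [convolution_lsmul_swap, conv]
    congr 1; ext t; rw [smul_eq_mul, mul_comm]
  have hcd : ∀ n, ContDiff ℝ 1 (conv f (κ n)) := fun n =>
    (contDiff_conv hfl (hκ n)).of_le (by exact_mod_cast le_top)
  have hA : ∫⁻ x, ‖f x‖ₑ ^ p ≠ ∞ := by
    rw [← eLpNorm_rpow_eq f hp0]
    exact (ENNReal.rpow_lt_top_of_nonneg hp0.le hf.2.ne).ne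
  have hAn : ∀ n, ∫⁻ x, ‖conv f (κ n) x‖ₑ ^ p ≤ ∫⁻ x, ‖f x‖ₑ ^ p := fun n =>
    lintegral_enorm_conv_rpow_le (hκ n).1.continuous (hκ0 n) (hκ n).integrable (hκ1 n) hf.1
      (by linarith)
  have hGn : ∀ n, ∫⁻ x, ‖fderiv ℝ (conv f (κ n)) x‖ₑ ^ p ≤
      (d : ℝ≥0∞) ^ p * ∑ i, ∫⁻ x, ‖g i x‖ₑ ^ p := by
    intro n
    have hm : ∀ i, Measurable fun x => ‖conv (g i) (κ n) x‖ₑ ^ p := fun i => by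
      have := (contDiff_conv (hfg i).2.1 (hκ n)).continuous
      fun_prop
    calc ∫⁻ x, ‖fderiv ℝ (conv f (κ n)) x‖ₑ ^ p
        ≤ ∫⁻ x, (d : ℝ≥0∞) ^ p * ∑ i, ‖conv (g i) (κ n) x‖ₑ ^ p := by
          refine lintegral_mono fun x => ?_
          have h1 := enorm_fderiv_le_sum (conv f (κ n)) x
          simp only [(hfg _).partialD_conv (hκ n)] at h1
          have h2 := sum_rpow_le (fun i => ‖conv (g i) (κ n) x‖ₑ) hp0
          rw [Fintype.card_fin] at h2
          refine le_trans ?_ h2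
          gcongr
      _ = (d : ℝ≥0∞) ^ p * ∑ i, ∫⁻ x, ‖conv (g i) (κ n) x‖ₑ ^ p := by
          rw [lintegral_const_mul _ (Finset.measurable_fun_sum _ fun i _ => hm i),
            lintegral_finsetSum _ fun i _ => hm i]
      _ ≤ _ := by
          gcongr _ * ?_
          refine Finset.sum_le_sum fun i _ => ?_
          exact lintegral_enorm_conv_rpow_le (hκ n).1.continuous (hκ0 n) (hκ n).integrable
            (hκ1 n) (hg i).1 (by linarith)
  refine lintegral_le_of_ae_tendsto
    (F := fun n x => ‖conv f (κ n) x‖ₑ ^ (p * (d / (d - 1) : ℝ)))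
    (fun n => ?_) ?_ (fun n => ?_) tendsto_const_nhds
  · have := (hcd n).continuous
    exact (by fun_prop : Measurable
      fun x => ‖conv f (κ n) x‖ₑ ^ (p * (d / (d - 1) : ℝ))).aemeasurable
  · filter_upwards [hae] with x hx
    exact (ENNReal.continuous_rpow_const.tendsto _).comp ((continuous_enorm.tendsto _).comp hx)
  · refine (lintegral_rpow_le_of_contDiff hd hp (hcd n) (ne_top_of_le_ne_top hA (hAn n))).trans ?_
    gcongr
    have hm1 : AEMeasurable (fun x => ‖conv f (κ n) x‖ₑ ^ p) volume := by
      have := (hcd n).continuous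
      exact (by fun_prop : Measurable fun x => ‖conv f (κ n) x‖ₑ ^ p).aemeasurable
    have hm2 : AEMeasurable (fun x => ‖fderiv ℝ (conv f (κ n)) x‖ₑ ^ p) volume := by
      have := ((hcd n).continuous_fderiv one_ne_zero).enorm.measurable
      exact (this.pow_const p).aemeasurable
    have hH := ENNReal.lintegral_mul_norm_pow_le hm1 hm2 (p := (p - 1) / p) (q := 1 / p)
      (div_nonneg (by linarith) hp0.le) (by positivity) (by field_simp; ring)
    simp only [← ENNReal.rpow_mul, mul_div_cancel₀ _ hp0.ne',
      ENNReal.rpow_one] at hH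
    exact hH.trans (mul_le_mul' (ENNReal.rpow_le_rpow (hAn n) (div_nonneg (by linarith) hp0.le))
      (ENNReal.rpow_le_rpow (hGn n) (by positivity)))

theorem rpow_le_rpow_add_rpow (x : ℝ≥0∞) {a b c : ℝ} (hab : a ≤ b) (hbc : b ≤ c) :
    x ^ b ≤ x ^ a + x ^ c := by
  rcases le_total x 1 with h | h
  · exact (ENNReal.rpow_le_rpow_of_exponent_ge h hab).trans le_self_add
  · exact (ENNReal.rpow_le_rpow_of_exponent_le h hbc).trans le_add_self

/-- An `L^{pq}` bound, linear in the dissipation. Because `p ≥ d`, the exponent `p q` does not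
exceed `p d / (d - 1)`, and the power of the gradient in the resulting bound is at most `p`. -/
theorem exists_lintegral_rpow_mul_conjExp_le (hd : 2 ≤ d) (hp : (d : ℝ) ≤ p) (K : ℝ≥0) :
    ∃ C : ℝ≥0, ∀ (v : Vec d → Vec d) (Dv : Vec d → Mat d), MemLp v (ENNReal.ofReal p) volume →
      MemLp Dv (ENNReal.ofReal p) volume → HasWeakGrad v Dv → ∫⁻ x, ‖v x‖ₑ ^ p ≤ K →
      ∫⁻ x, ‖v x‖ₑ ^ (p * conjExp p) ≤ C * (1 + ∫⁻ x, ‖Dv x‖ₑ ^ p) := by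
  have hd2 : (2 : ℝ) ≤ d := by exact_mod_cast hd
  have hp2 : 2 ≤ p := hd2.trans hp
  have hp0 : 0 < p := by linarith
  have hq1 : 1 ≤ conjExp p := by unfold conjExp; rw [le_div_iff₀] <;> linarith
  have hqd : conjExp p ≤ (d / (d - 1) : ℝ) := by
    unfold conjExp
    rw [div_le_div_iff₀ (by linarith) (by linarith)]
    nlinarith
  have hd'0 : (0 : ℝ) < d / (d - 1) := div_pos (by linarith) (by linarith)
  have hd'p : (d / (d - 1) : ℝ) ≤ p := by
    rw [div_le_iff₀ (by linarith)]; nlinarith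
  set d' : ℝ := d / (d - 1)
  set S : ℝ≥0∞ := lintegralPowLePowLIntegralFDerivConst (volume : Measure (Vec d)) d' *
    (ENNReal.ofReal p * ((K : ℝ≥0∞) ^ ((p - 1) / p) * ((d : ℝ≥0∞) ^ p * d) ^ (1 / p))) ^ d'
    with hS
  have hpp : 0 ≤ (p - 1) / p := div_nonneg (by linarith) hp0.le
  have hSt : S ≠ ∞ := by
    refine ENNReal.mul_ne_top ENNReal.coe_ne_top (ENNReal.rpow_ne_top_of_nonneg hd'0.le ?_)
    refine ENNReal.mul_ne_top ENNReal.ofReal_ne_top (ENNReal.mul_ne_top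
      (ENNReal.rpow_ne_top_of_nonneg hpp ENNReal.coe_ne_top)
      (ENNReal.rpow_ne_top_of_nonneg (by positivity) (ENNReal.mul_ne_top
        (ENNReal.rpow_ne_top_of_nonneg hp0.le (by simp)) (by simp))))
  set C : ℝ≥0∞ := (d : ℝ≥0∞) ^ (p * conjExp p) * (d * (K + S)) with hC
  have hpq0 : 0 < p * conjExp p := by positivity
  have hCt : C ≠ ∞ := ENNReal.mul_ne_top (ENNReal.rpow_ne_top_of_nonneg hpq0.le (by simp))
    (ENNReal.mul_ne_top (by simp) (by simp [hSt]))
  refine ⟨C.toNNReal, fun v Dv hv hDv hgrad hK => ?_⟩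
  rw [ENNReal.coe_toNNReal hCt]
  set G := ∫⁻ x, ‖Dv x‖ₑ ^ p
  have hcoord : ∀ {ι : Type} [Fintype ι] (a : EuclideanSpace ℝ ι) (j : ι), ‖a j‖ₑ ≤ ‖a‖ₑ :=
    fun a j => by
      rw [← ofReal_norm, ← ofReal_norm]
      exact ENNReal.ofReal_le_ofReal (PiLp.norm_apply_le a j)
  have hj : ∀ j, ∫⁻ x, ‖v x j‖ₑ ^ (p * conjExp p) ≤ (K + S) * (1 + G) := by
    intro j
    have hvj := memLp_coord hv j
    have h1 : ∫⁻ x, ‖v x j‖ₑ ^ p ≤ K :=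
      (lintegral_mono fun x => by gcongr; exact hcoord _ _).trans hK
    have hgn := gagliardo_nirenberg hd hp2 hvj (fun i => memLp_coord hDv (i, j))
      (fun i => hgrad i j)
    have h2 : ∑ i, ∫⁻ x, ‖Dv x (i, j)‖ₑ ^ p ≤ d * G := by
      have := Finset.sum_le_card_nsmul Finset.univ (fun i => ∫⁻ x, ‖Dv x (i, j)‖ₑ ^ p) G
        (fun i _ => lintegral_mono fun x => by gcongr; exact hcoord _ _)
      simpa using this
    have h3 : ∫⁻ x, ‖v x j‖ₑ ^ (p * d') ≤ S * (1 + G) := by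
      refine hgn.trans ?_
      calc _ ≤ lintegralPowLePowLIntegralFDerivConst (volume : Measure (Vec d)) d' *
            (ENNReal.ofReal p * ((K : ℝ≥0∞) ^ ((p - 1) / p) *
              ((d : ℝ≥0∞) ^ p * (d * G)) ^ (1 / p))) ^ d' := by gcongr
        _ = S * G ^ (d' / p) := by
            rw [← mul_assoc ((d : ℝ≥0∞) ^ p), ENNReal.mul_rpow_of_nonneg _ G (by positivity),
              ← mul_assoc ((K : ℝ≥0∞) ^ _), ← mul_assoc (ENNReal.ofReal p),
              ENNReal.mul_rpow_of_nonneg _ _ hd'0.le, ← ENNReal.rpow_mul, one_div_mul_eq_div,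
              hS, mul_assoc]
        _ ≤ S * (1 + G) := by
            gcongr
            have := rpow_le_rpow_add_rpow G (a := 0) (b := d' / p) (c := 1)
              (by positivity) (by rw [div_le_one hp0]; exact hd'p)
            simpa using this
    calc ∫⁻ x, ‖v x j‖ₑ ^ (p * conjExp p)
        ≤ ∫⁻ x, (‖v x j‖ₑ ^ p + ‖v x j‖ₑ ^ (p * d')) :=
          lintegral_mono fun x => rpow_le_rpow_add_rpow _ (by nlinarith) (by gcongr)
      _ = (∫⁻ x, ‖v x j‖ₑ ^ p) + ∫⁻ x, ‖v x j‖ₑ ^ (p * d') :=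
          lintegral_add_left' (hvj.1.enorm.pow_const p) _
      _ ≤ K * (1 + G) + S * (1 + G) := by
          gcongr
          calc _ ≤ (K : ℝ≥0∞) * 1 := by rw [mul_one]; exact h1
            _ ≤ _ := by gcongr; exact le_self_add
      _ = _ := by rw [add_mul]
  have hnorm : ∀ a : Vec d, ‖a‖ₑ ≤ ∑ j, ‖a j‖ₑ := by
    intro a
    have h : ‖a‖ ≤ ∑ j, ‖a j‖ := by
      rw [EuclideanSpace.norm_eq]
      refine Real.sqrt_le_iff.2 ⟨by positivity, ?_⟩
      exact Finset.sum_sq_le_sq_sum_of_nonneg fun i _ => norm_nonneg _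
    simp_rw [← ofReal_norm]
    rw [← ENNReal.ofReal_sum_of_nonneg fun i _ => norm_nonneg _]
    exact ENNReal.ofReal_le_ofReal h
  calc ∫⁻ x, ‖v x‖ₑ ^ (p * conjExp p)
      ≤ ∫⁻ x, (d : ℝ≥0∞) ^ (p * conjExp p) * ∑ j, ‖v x j‖ₑ ^ (p * conjExp p) := by
        refine lintegral_mono fun x => ?_
        have h2 := sum_rpow_le (fun j => ‖v x j‖ₑ) hpq0
        rw [Fintype.card_fin] at h2
        refine le_trans ?_ h2
        gcongr
        exact hnorm _
    _ = (d : ℝ≥0∞) ^ (p * conjExp p) * ∑ j, ∫⁻ x, ‖v x j‖ₑ ^ (p * conjExp p) := by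
        have hm : ∀ j ∈ Finset.univ, AEMeasurable (fun x => ‖v x j‖ₑ ^ (p * conjExp p)) volume :=
          fun j _ => (memLp_coord hv j).1.enorm.pow_const _
        rw [lintegral_const_mul'' _ (Finset.aemeasurable_fun_sum _ hm),
          lintegral_finsetSum' _ hm]
    _ ≤ (d : ℝ≥0∞) ^ (p * conjExp p) * ∑ _j : Fin d, (K + S) * (1 + G) := by
        gcongr with j
        exact hj j
    _ = C * (1 + G) := by
        simp only [Finset.sum_const, Finset.card_univ, Fintype.card_fin, nsmul_eq_mul, hC]
        ring

end GagliardoNirenberg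

/-! ### The momentum equation at a fixed time -/

section Slice

variable {d : ℕ} {p ν ε : ℝ} {ζ : Vec d → ℝ} {v : Vec d → Vec d} {π : Vec d → ℝ}
  {Dv Dvp : Vec d → Mat d} {dt gπ pL lap : Vec d → Vec d}

/-- The spatial content of the regularized `p`-Navier-Stokes system at a fixed time; `dt`, `gπ`,
`pL` and `lap` stand for `∂_t v_p`, `∇π`, `Δ_p v` and `Δ v_p`. -/
structure IsSlice (ζ : Vec d → ℝ) (p ν ε : ℝ) (v : Vec d → Vec d) (π : Vec d → ℝ)
    (Dv Dvp : Vec d → Mat d) (dt gπ pL lap : Vec d → Vec d) : Prop where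
  v_mem : MemLp v (ENNReal.ofReal p) volume
  Dv_mem : MemLp Dv (ENNReal.ofReal p) volume
  Dvp_mem : MemLp Dvp (ENNReal.ofReal (conjExp p)) volume
  dt_mem : MemLp dt (ENNReal.ofReal (conjExp p)) volume
  gπ_mem : MemLp gπ (ENNReal.ofReal (conjExp p)) volume
  pL_mem : MemLp pL (ENNReal.ofReal (conjExp p)) volume
  lap_mem : MemLp lap (ENNReal.ofReal (conjExp p)) volume
  Dv_grad : HasWeakGrad v Dv
  Dvp_grad : HasWeakGrad (fun x => pPower p (v x)) Dvp
  gπ_grad : HasWeakGradScalar π gπ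
  pL_div : HasWeakDiv (fun x => pPower p (Dv x)) pL
  lap_div : HasWeakDiv Dvp lap
  momentum : ∀ᵐ x, ∀ j, dt x j + ∑ i, mollify ζ ε v x i * Dvp x (i, j)
    = -(gπ x j) + ν * pL x j + ε * lap x j
  div_free : ∀ᵐ x, ∑ i, Dv x (i, i) = 0

theorem HasWeakDiv.integral_inner_eq_neg {P Q : ℝ≥0∞} [P.HolderConjugate Q] (hQ : Q ≠ ∞)
    {A : Vec d → Mat d} {b w : Vec d → Vec d} {W : Vec d → Mat d} (h : HasWeakDiv A b)
    (hA : MemLp A Q volume) (hb : MemLp b Q volume) (hw : MemLp w P volume)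
    (hW : MemLp W P volume) (hwW : HasWeakGrad w W) :
    ∫ x, inner ℝ (b x) (w x) = -∫ x, inner ℝ (A x) (W x) := by
  rw [integral_inner_eq_sum hb hw, integral_inner_eq_sum hA hW, Fintype.sum_prod_type_right,
    ← Finset.sum_neg_distrib]
  refine Finset.sum_congr rfl fun j _ => ?_
  rw [sum_integral_mul_eq_neg hQ (fun i => i) (fun i => memLp_coord hA (i, j)) (memLp_coord hb j)
    (memLp_coord hw j) (fun i => memLp_coord hW (i, j)) (h.2.2 j) (fun i => hwW i j), neg_neg]

namespace IsSlice

theorem sum_partialD_conv_eq_zero (h : IsSlice ζ p ν ε v π Dv Dvp dt gπ pL lap)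
    (hζ : IsMollifier ζ) (hε : 0 < ε) (x : Vec d) :
    ∑ i, partialD i (conv (fun x => v x i) (J ζ ε)) x = 0 := by
  have hJ := isTest_J hζ hε
  simp only [(h.Dv_grad _ _).partialD_conv hJ, conv]
  rw [← integral_finsetSum]
  · refine integral_eq_zero_of_ae ?_
    filter_upwards [h.div_free] with t ht
    rw [← Finset.sum_mul, ht]; simp
  · intro i _
    have := (h.Dv_grad i i).2.1.integrable_smul_left_of_hasCompactSupport
      (hJ.comp_sub_left x).1.continuous (hJ.comp_sub_left x).2
    simpa only [smul_eq_mul, mul_comm] using this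

theorem locallyIntegrable (h : IsSlice ζ p ν ε v π Dv Dvp dt gπ pL lap) (hp : 2 ≤ p) :
    LocallyIntegrable v :=
  h.v_mem.locallyIntegrable (by
    rw [← ENNReal.ofReal_one]; exact ENNReal.ofReal_le_ofReal (by linarith))

/-- The momentum equation tested with a divergence-free field: the pressure drops out, and the other
terms are integrated by parts. -/
theorem integral_inner_dt (h : IsSlice ζ p ν ε v π Dv Dvp dt gπ pL lap) (hd : 0 < d)
    (hp : 2 ≤ p) (hζ : IsMollifier ζ) (hε : 0 < ε) {w : Vec d → Vec d} {W : Vec d → Mat d}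
    (hw : MemLp w (ENNReal.ofReal p) volume) (hW : MemLp W (ENNReal.ofReal p) volume)
    (hwW : HasWeakGrad w W) (hdiv : ∀ᵐ x, ∑ i, W x (i, i) = 0) :
    ∫ x, inner ℝ (dt x) (w x) =
      (∑ i, ∫ x, conv (fun x => v x i) (J ζ ε) x *
        inner ℝ (pPower p (v x)) (row i (W x)))
      - ν * (∫ x, inner ℝ (pPower p (Dv x)) (W x)) - ε * ∫ x, inner ℝ (Dvp x) (W x) := by
  have hPQ := (holderConjugate_conjExp hp).ennrealOfReal
  have hJ := isTest_J hζ hε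
  set u : Fin d → Vec d → ℝ := fun i => conv (fun x => v x i) (J ζ ε) with hudef
  have hu : ∀ i, ContDiff ℝ ((⊤ : ℕ∞) : WithTop ℕ∞) (u i) := fun i =>
    contDiff_conv (h.Dv_grad i i).1 hJ
  have huK : ∀ i, ∃ K, ∀ x, |u i x| ≤ K := fun i =>
    exists_abs_conv_le (Q := ENNReal.ofReal (conjExp p)) (memLp_coord h.v_mem i) hJ
  choose K hK using huK
  have hm := memLp_pPower hp h.v_mem
  have huf : ∀ (i : Fin d) {f : Vec d → ℝ}, MemLp f (ENNReal.ofReal (conjExp p)) volume →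
      MemLp (fun x => u i x * f x) (ENNReal.ofReal (conjExp p)) volume := by
    intro i f hf
    refine hf.of_le_mul (c := K i) ((hu i).continuous.aestronglyMeasurable.mul hf.1)
      (Eventually.of_forall fun x => ?_)
    rw [norm_mul]
    gcongr
    exact hK i x
  have hb : ∀ j, MemLp (fun x => ∑ i, u i x * Dvp x (i, j)) (ENNReal.ofReal (conjExp p)) volume :=
    fun j => memLp_finsetSum _ fun i _ => huf i (memLp_coord h.Dvp_mem (i, j))
  have hconv : ∀ j, ∫ x, (∑ i, u i x * Dvp x (i, j)) * w x j =
      -∑ i, ∫ x, (u i x * pPower p (v x) j) * W x (i, j) := by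
    intro j
    rw [sum_integral_mul_eq_neg ENNReal.ofReal_ne_top (fun i => i)
      (fun i => huf i (memLp_coord hm j)) (hb j) (memLp_coord hw j)
      (fun i => memLp_coord hW (i, j))
      (fun φ hφ => sum_integral_transport hu (h.sum_partialD_conv_eq_zero hζ hε)
        (fun i => h.Dvp_grad i j) hφ (h.Dvp_grad ⟨0, hd⟩ j).1) (fun i => hwW i j), neg_neg]
  have hpress : ∫ x, inner ℝ (gπ x) (w x) = 0 := by
    rw [integral_inner_eq_sum h.gπ_mem hw]
    exact sum_integral_grad_mul_eq_zero ENNReal.ofReal_ne_top ENNReal.ofReal_ne_top hd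
      (fun i => memLp_coord h.gπ_mem i) (fun i => memLp_coord hw i)
      (fun i => memLp_coord hW (i, i)) h.gπ_grad (fun i => hwW i i) hdiv
  have hpL := h.pL_div.integral_inner_eq_neg ENNReal.ofReal_ne_top (memLp_pPower hp h.Dv_mem)
    h.pL_mem hw hW hwW
  have hlap := h.lap_div.integral_inner_eq_neg ENNReal.ofReal_ne_top h.Dvp_mem h.lap_mem hw hW hwW
  have hiconv : ∀ j, Integrable fun x => (∑ i, u i x * Dvp x (i, j)) * w x j := fun j =>
    (hb j).integrable_mul (memLp_coord hw j)
  have hipress := integrable_inner h.gπ_mem hw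
  have hipL := integrable_inner h.pL_mem hw
  have hilap := integrable_inner h.lap_mem hw
  have hae : ∀ᵐ x, inner ℝ (dt x) (w x) = -(∑ j, (∑ i, u i x * Dvp x (i, j)) * w x j)
      - inner ℝ (gπ x) (w x) + ν * inner ℝ (pL x) (w x) + ε * inner ℝ (lap x) (w x) := by
    filter_upwards [h.momentum] with x hx
    simp only [vec_inner_eq_sum, Finset.mul_sum, ← Finset.sum_neg_distrib,
      ← Finset.sum_sub_distrib, ← Finset.sum_add_distrib]
    refine Finset.sum_congr rfl fun j _ => ?_
    have hxj := hx j
    simp only [mollify_apply hζ hε (h.locallyIntegrable hp)] at hxj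
    have hdt : dt x j = -(∑ i, u i x * Dvp x (i, j)) - gπ x j + ν * pL x j + ε * lap x j := by
      linarith
    rw [hdt]; ring
  have hic : Integrable fun x => -(∑ j, (∑ i, u i x * Dvp x (i, j)) * w x j) :=
    (integrable_finsetSum _ fun j _ => hiconv j).neg
  have hi1 : Integrable fun x => -(∑ j, (∑ i, u i x * Dvp x (i, j)) * w x j)
      - inner ℝ (gπ x) (w x) := hic.sub hipress
  have hi2 : Integrable fun x => -(∑ j, (∑ i, u i x * Dvp x (i, j)) * w x j)
      - inner ℝ (gπ x) (w x) + ν * inner ℝ (pL x) (w x) := hi1.add (hipL.const_mul ν)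
  rw [integral_congr_ae hae, integral_add hi2 (hilap.const_mul ε),
    integral_add hi1 (hipL.const_mul ν), integral_sub hic hipress, integral_neg,
    integral_finsetSum _ fun j _ => hiconv j, hpress, integral_const_mul, integral_const_mul,
    hpL, hlap]
  have hfin : ∑ j, ∫ x, (∑ i, u i x * Dvp x (i, j)) * w x j =
      -∑ i, ∫ x, u i x * inner ℝ (pPower p (v x)) (row i (W x)) := by
    simp only [hconv, Finset.sum_neg_distrib]
    rw [Finset.sum_comm]
    congr 1
    refine Finset.sum_congr rfl fun i _ => ?_
    rw [← integral_finsetSum]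
    · congr 1; ext x
      rw [vec_inner_eq_sum, Finset.mul_sum]
      refine Finset.sum_congr rfl fun j _ => ?_
      rw [row_apply]; ring
    · intro j _
      exact (huf i (memLp_coord hm j)).integrable_mul (memLp_coord hW (i, j))
  rw [hfin]; ring

/-- The energy inequality at a fixed time. The convection term vanishes because `v_p · ∂_i v` is the
derivative of `|v|^p / p` and `J_ε * v` is divergence-free; the term with `ε` has a sign. -/
theorem integral_inner_dt_self_le (h : IsSlice ζ p ν ε v π Dv Dvp dt gπ pL lap) (hd : 0 < d)
    (hp : 2 ≤ p) (hζ : IsMollifier ζ) (hε : 0 < ε) :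
    ∫ x, inner ℝ (dt x) (v x) ≤ -(ν * ∫ x, ‖Dv x‖ ^ p) := by
  have hPQ := (holderConjugate_conjExp hp).ennrealOfReal
  have hp0 : 0 < p := by linarith
  have hJ := isTest_J hζ hε
  rw [h.integral_inner_dt hd hp hζ hε h.v_mem h.Dv_mem h.Dv_grad h.div_free]
  have hiv : Integrable fun x => ‖v x‖ ^ p := integrable_norm_rpow hp0 h.v_mem
  have hK' : ∀ i, ∃ K', ∀ x, |partialD i (conv (fun x => v x i) (J ζ ε)) x| ≤ K' := by
    intro i
    obtain ⟨K', hK'⟩ := exists_abs_conv_le (Q := ENNReal.ofReal (conjExp p))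
      (memLp_coord h.v_mem i) (hJ.partialD i)
    exact ⟨K', fun x => by rw [partialD_conv (h.Dv_grad i i).1 hJ]; exact hK' x⟩
  have hcd : ∀ i, ContDiff ℝ 1 (conv (fun x => v x i) (J ζ ε)) := fun i =>
    (contDiff_conv (h.Dv_grad i i).1 hJ).of_le (by exact_mod_cast le_top)
  have hconv : ∑ i, ∫ x, conv (fun x => v x i) (J ζ ε) x *
      inner ℝ (pPower p (v x)) (row i (Dv x)) = 0 := by
    have h1 : p * ∑ i, ∫ x, conv (fun x => v x i) (J ζ ε) x *
        inner ℝ (pPower p (v x)) (row i (Dv x)) = 0 := by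
      rw [Finset.mul_sum]
      have h2 : ∀ i, p * ∫ x, conv (fun x => v x i) (J ζ ε) x *
          inner ℝ (pPower p (v x)) (row i (Dv x)) =
          -∫ x, partialD i (conv (fun x => v x i) (J ζ ε)) x * ‖v x‖ ^ p := by
        intro i
        obtain ⟨K, hK⟩ := exists_abs_conv_le (Q := ENNReal.ofReal (conjExp p))
          (memLp_coord h.v_mem i) hJ
        obtain ⟨K', hK'⟩ := hK' i
        exact integral_mul_inner_pPower_partial hp h.v_mem (memLp_row h.Dv_mem i)
          (memLp_row h.Dvp_mem i) (h.Dv_grad i) (h.Dvp_grad i) (hcd i) hK hK'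
      simp only [h2, Finset.sum_neg_distrib]
      rw [← integral_finsetSum]
      · simp only [← Finset.sum_mul, h.sum_partialD_conv_eq_zero hζ hε, zero_mul, integral_zero,
          neg_zero]
      · intro i _
        obtain ⟨K', hK'⟩ := hK' i
        exact hiv.bdd_mul (c := K') (((hcd i).continuous_fderiv one_ne_zero).clm_apply
          continuous_const).aestronglyMeasurable (Eventually.of_forall hK')
    exact (mul_eq_zero.1 h1).resolve_left hp0.ne'
  have hDv : ∫ x, inner ℝ (pPower p (Dv x)) (Dv x) = ∫ x, ‖Dv x‖ ^ p := by
    simp only [inner_pPower_self hp]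
  have hDvp : 0 ≤ ∫ x, inner ℝ (Dvp x) (Dv x) := by
    simp only [← sum_inner_row]
    rw [integral_finsetSum _ fun i _ =>
      integrable_inner (memLp_row h.Dvp_mem i) (memLp_row h.Dv_mem i)]
    exact Finset.sum_nonneg fun i _ => integral_inner_partial_pPower_nonneg hp h.v_mem
      (memLp_row h.Dv_mem i) (memLp_row h.Dvp_mem i) (h.Dv_grad i) (h.Dvp_grad i)
  rw [hconv, hDv]
  nlinarith

end IsSlice

/-- The pairing of the momentum equation with a divergence-free field is controlled by `p`-th
powers of gradients, uniformly in the regularization. The convection term, of size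
`|J_ε * v| |v|^{p-1} |∇w|`, is where `‖v‖_{pq}`, and with it `p ≥ d`, enters. -/
theorem exists_abs_integral_inner_dt_le (hd : 2 ≤ d) (hp : (d : ℝ) ≤ p) (hν : 0 < ν) (K : ℝ≥0) :
    ∃ C : ℝ≥0, ∀ {ζ : Vec d → ℝ} {ε : ℝ} {v : Vec d → Vec d} {π : Vec d → ℝ}
      {Dv Dvp : Vec d → Mat d} {dt gπ pL lap : Vec d → Vec d},
      IsSlice ζ p ν ε v π Dv Dvp dt gπ pL lap → IsMollifier ζ → 0 < ε → ε < 1 →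
      ∫⁻ x, ‖v x‖ₑ ^ p ≤ K → ∀ {w : Vec d → Vec d} {W : Vec d → Mat d},
      MemLp w (ENNReal.ofReal p) volume → MemLp W (ENNReal.ofReal p) volume →
      HasWeakGrad w W → (∀ᵐ x, ∑ i, W x (i, i) = 0) →
      |∫ x, inner ℝ (dt x) (w x)| ≤ C * (1 + (∫ x, ‖Dv x‖ ^ p) + ∫ x, ‖W x‖ ^ p) := by
  have hd2 : (2 : ℝ) ≤ d := by exact_mod_cast hd
  have hp2 : 2 ≤ p := hd2.trans hp
  have hp0 : 0 < p := by linarith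
  have hc := holderConjugate_conjExp hp2
  have hq0 := hc.symm.pos
  have hPQ := hc.ennrealOfReal
  obtain ⟨C, hC⟩ := exists_lintegral_rpow_mul_conjExp_le hd hp K
  refine ⟨.mk (d * (2 * C + 1) + ν * 2 + d * (p * (2 ^ p * (2 * K) + 1))) (by positivity), ?_⟩
  intro ζ ε v π Dv Dvp dt gπ pL lap h hζ hε hε1 hK w W hw hW hwW hdiv
  have hJ := isTest_J hζ hε
  set G := ∫ x, ‖Dv x‖ ^ p with hG
  set H := ∫ x, ‖W x‖ ^ p with hH
  have hG0 : 0 ≤ G := integral_nonneg fun x => by positivity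
  have hH0 : 0 ≤ H := integral_nonneg fun x => by positivity
  have hiW : Integrable fun x => ‖W x‖ ^ p := integrable_norm_rpow hp0 hW
  have hiDv : Integrable fun x => ‖Dv x‖ ^ p := integrable_norm_rpow hp0 h.Dv_mem
  have hpq0 : 0 < p * conjExp p := by positivity
  have hpq : p + conjExp p = p * conjExp p := by
    have : p - 1 ≠ 0 := by linarith
    unfold conjExp; field_simp; ring
  -- the velocity and its mollification in the space of exponent `p q`
  have hvl := hC v Dv h.v_mem h.Dv_mem h.Dv_grad hK
  rw [← ofReal_integral_rpow hp0 h.Dv_mem, ← ENNReal.ofReal_one,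
    ← ENNReal.ofReal_add zero_le_one hG0, ← ENNReal.ofReal_coe_nnreal,
    ← ENNReal.ofReal_mul C.coe_nonneg] at hvl
  set u := mollify ζ ε v with hu
  have hul := (lintegral_enorm_mollify_rpow_le hζ hε h.v_mem.1 (r := p * conjExp p)
    (by nlinarith [hc.symm.lt])).trans hvl
  have hucont : Continuous u :=
    hJ.2.continuous_convolution_left _ hJ.1.continuous (h.locallyIntegrable hp2)
  have hmem : ∀ {z : Vec d → Vec d}, AEStronglyMeasurable z volume →
      ∫⁻ x, ‖z x‖ₑ ^ (p * conjExp p) ≤ ENNReal.ofReal (C * (1 + G)) →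
      MemLp z (ENNReal.ofReal (p * conjExp p)) volume := by
    intro z hz hzl
    refine ⟨hz, ?_⟩
    rw [← ENNReal.rpow_lt_top_iff_of_pos hpq0, eLpNorm_rpow_eq z hpq0]
    exact hzl.trans_lt ENNReal.ofReal_lt_top
  have hvm := hmem h.v_mem.1 hvl
  have hum := hmem hucont.aestronglyMeasurable hul
  have hCG : 0 ≤ C * (1 + G) := by positivity
  rw [← ofReal_integral_rpow hpq0 hvm, ENNReal.ofReal_le_ofReal_iff hCG] at hvl
  rw [← ofReal_integral_rpow hpq0 hum, ENNReal.ofReal_le_ofReal_iff hCG] at hul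
  have hiv := integrable_norm_rpow hpq0 hvm
  have hiu := integrable_norm_rpow hpq0 hum
  have hvK : ∫ x, ‖v x‖ ^ p ≤ K := by
    rw [← ofReal_integral_rpow hp0 h.v_mem, ← ENNReal.ofReal_coe_nnreal,
      ENNReal.ofReal_le_ofReal_iff K.coe_nonneg] at hK
    exact hK
  rw [h.integral_inner_dt (by omega) hp2 hζ hε hw hW hwW hdiv]
  -- convection
  have hconv : ∀ i, |∫ x, conv (fun x => v x i) (J ζ ε) x *
      inner ℝ (pPower p (v x)) (row i (W x))| ≤ 2 * (C * (1 + G)) + H := by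
    intro i
    have hint : Integrable fun x =>
        (‖u x‖ ^ (p * conjExp p) + ‖v x‖ ^ (p * conjExp p)) + ‖W x‖ ^ p := (hiu.add hiv).add hiW
    have hle := norm_integral_le_of_norm_le hint (f := fun x =>
      conv (fun x => v x i) (J ζ ε) x * inner ℝ (pPower p (v x)) (row i (W x)))
      (Eventually.of_forall fun x => by
        have h1 : ‖conv (fun x => v x i) (J ζ ε) x‖ ≤ ‖u x‖ := by
          rw [← mollify_apply hζ hε (h.locallyIntegrable hp2)]
          exact PiLp.norm_apply_le _ i
        have h2 : ‖inner ℝ (pPower p (v x)) (row i (W x))‖ ≤ ‖v x‖ ^ (p - 1) * ‖W x‖ := by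
          refine (norm_inner_le_norm _ _).trans ?_
          rw [norm_pPower hp2]
          gcongr
          exact norm_row_le i _
        rw [norm_mul]
        have h3 := Real.young_inequality_of_nonneg (a := ‖W x‖) (b := ‖u x‖ * ‖v x‖ ^ (p - 1))
          (by positivity) (by positivity) hc
        have h4 : (‖u x‖ * ‖v x‖ ^ (p - 1)) ^ conjExp p = ‖u x‖ ^ conjExp p * ‖v x‖ ^ p := by
          rw [Real.mul_rpow (by positivity) (by positivity), ← Real.rpow_mul (by positivity)]
          congr 2
          have : p - 1 ≠ 0 := by linarith
          unfold conjExp; field_simp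
        rw [h4] at h3
        have h5 : ‖u x‖ ^ conjExp p * ‖v x‖ ^ p ≤
            ‖u x‖ ^ (p * conjExp p) + ‖v x‖ ^ (p * conjExp p) := by
          have hmax : ∀ m, 0 ≤ m → ‖u x‖ ≤ m → ‖v x‖ ≤ m →
              ‖u x‖ ^ conjExp p * ‖v x‖ ^ p ≤ m ^ (p * conjExp p) := by
            intro m hm h1 h2
            rw [← hpq, add_comm, Real.rpow_add_of_nonneg hm hq0.le hp0.le]
            gcongr
          have := Real.rpow_nonneg (norm_nonneg (u x)) (p * conjExp p)
          have := Real.rpow_nonneg (norm_nonneg (v x)) (p * conjExp p)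
          rcases le_total ‖u x‖ ‖v x‖ with h6 | h6
          · linarith [hmax ‖v x‖ (norm_nonneg _) h6 le_rfl]
          · linarith [hmax ‖u x‖ (norm_nonneg _) le_rfl h6]
        have h7 : ‖W x‖ ^ p / p ≤ ‖W x‖ ^ p := div_le_self (by positivity) (by linarith)
        have h8 : ‖u x‖ ^ conjExp p * ‖v x‖ ^ p / conjExp p ≤ ‖u x‖ ^ conjExp p * ‖v x‖ ^ p :=
          div_le_self (by positivity) hc.symm.lt.le
        calc ‖conv (fun x => v x i) (J ζ ε) x‖ * ‖inner ℝ (pPower p (v x)) (row i (W x))‖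
            ≤ ‖u x‖ * (‖v x‖ ^ (p - 1) * ‖W x‖) := by gcongr
          _ = ‖W x‖ * (‖u x‖ * ‖v x‖ ^ (p - 1)) := by ring
          _ ≤ _ := by linarith)
    have hiuv : Integrable fun x => ‖u x‖ ^ (p * conjExp p) + ‖v x‖ ^ (p * conjExp p) :=
      hiu.add hiv
    rw [integral_add hiuv hiW, integral_add hiu hiv, Real.norm_eq_abs] at hle
    linarith
  -- viscosity
  have hvisc : |∫ x, inner ℝ (pPower p (Dv x)) (W x)| ≤ G + H := by
    have hle := norm_integral_le_of_norm_le (hiDv.add hiW)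
      (f := fun x => inner ℝ (pPower p (Dv x)) (W x)) (Eventually.of_forall fun x => by
        refine (norm_inner_le_norm _ _).trans ?_
        rw [norm_pPower hp2]
        have h1 := rpow_mul_mul_le hp2 (norm_nonneg (Dv x)) (norm_nonneg (Dv x))
          (norm_nonneg (W x))
        have hmax : ∀ m, 0 ≤ m → ‖Dv x‖ ≤ m → ‖W x‖ ≤ m →
            ‖Dv x‖ ^ (p - 1) * ‖W x‖ ≤ m ^ p := by
          intro m hm h1 h2
          rw [← rpow_sub_one_mul_self hp2 hm]
          gcongr
          linarith
        simp only [Pi.add_apply]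
        have := Real.rpow_nonneg (norm_nonneg (Dv x)) p
        have := Real.rpow_nonneg (norm_nonneg (W x)) p
        rcases le_total ‖Dv x‖ ‖W x‖ with h6 | h6
        · linarith [hmax ‖W x‖ (norm_nonneg _) h6 le_rfl]
        · linarith [hmax ‖Dv x‖ (norm_nonneg _) le_rfl h6])
    simp only [Pi.add_apply] at hle
    rwa [integral_add hiDv hiW, Real.norm_eq_abs] at hle
  -- regularization
  -- regularization
  have hrow : ∀ {A : Vec d → Mat d} (_ : MemLp A (ENNReal.ofReal p) volume) (i : Fin d),
      ∫ x, ‖row i (A x)‖ ^ p ≤ ∫ x, ‖A x‖ ^ p := fun hA i =>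
    integral_mono (integrable_norm_rpow hp0 (memLp_row hA i)) (integrable_norm_rpow hp0 hA)
      fun x => by
        dsimp only
        gcongr
        exact norm_row_le i _
  have hreg : |∫ x, inner ℝ (Dvp x) (W x)| ≤ d * (p * (2 ^ p * (2 * K) + G + H)) := by
    simp only [← sum_inner_row]
    rw [integral_finsetSum _ fun i _ =>
      integrable_inner (memLp_row h.Dvp_mem i) (memLp_row hW i)]
    refine (Finset.abs_sum_le_sum_abs _ _).trans ?_
    have := Finset.sum_le_card_nsmul Finset.univ
      (fun i => |∫ x, inner ℝ (row i (Dvp x)) (row i (W x))|)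
      (p * (2 ^ p * (2 * K) + G + H)) (fun i _ => by
        refine (abs_integral_inner_partial_pPower_le hp2 h.v_mem (memLp_row h.Dv_mem i)
          (memLp_row h.Dvp_mem i) (memLp_row hW i) (h.Dv_grad i) (h.Dvp_grad i)).trans ?_
        gcongr
        · exact hrow h.Dv_mem i
        · exact hrow hW i)
    simpa using this
  have hsum : |∑ i, ∫ x, conv (fun x => v x i) (J ζ ε) x *
      inner ℝ (pPower p (v x)) (row i (W x))| ≤ d * (2 * (C * (1 + G)) + H) := by
    refine (Finset.abs_sum_le_sum_abs _ _).trans ?_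
    have := Finset.sum_le_card_nsmul Finset.univ _ _ (fun i _ => hconv i)
    simpa only [Finset.card_univ, Fintype.card_fin, nsmul_eq_mul] using this
  have h1 : |ν * ∫ x, inner ℝ (pPower p (Dv x)) (W x)| ≤ ν * (G + H) := by
    rw [abs_mul, abs_of_pos hν]; gcongr
  have h2 : |ε * ∫ x, inner ℝ (Dvp x) (W x)| ≤ 1 * (d * (p * (2 ^ p * (2 * K) + G + H))) := by
    rw [abs_mul, abs_of_pos hε]; gcongr
  refine (abs_sub _ _).trans ((add_le_add ((abs_sub _ _).trans (add_le_add hsum h1)) h2).trans ?_)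
  rw [NNReal.coe_mk]
  have e1 : d * (2 * (C * (1 + G)) + H) ≤ d * (2 * C + 1) * (1 + G + H) := by
    have : (0:ℝ) ≤ d * (2 * C * H + 1 + G) := by positivity
    nlinarith
  have e2 : ν * (G + H) ≤ ν * 2 * (1 + G + H) := by nlinarith
  have e3 : 1 * (d * (p * (2 ^ p * (2 * K) + G + H))) ≤
      d * (p * (2 ^ p * (2 * K) + 1)) * (1 + G + H) := by
    have hk : (0 : ℝ) ≤ 2 ^ p * (2 * K) := by positivity
    have h3 : 2 ^ p * (2 * K) + G + H ≤ (2 ^ p * (2 * K) + 1) * (1 + G + H) := by nlinarith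
    calc _ = d * (p * (2 ^ p * (2 * K) + G + H)) := one_mul _
      _ ≤ d * (p * ((2 ^ p * (2 * K) + 1) * (1 + G + H))) := by gcongr
      _ = _ := by ring
  linarith

end Slice

/-! ### Integrability and continuity in time -/

section TimeLocal

variable {T : ℝ}

/-- An exhaustion of `(0, T)` by nonempty intervals with compact closure in `(0, T)`; the offset `3`
keeps the interval with `n = 0` nonempty. -/
theorem iUnion_Ioo_div (hT : 0 < T) :
    ⋃ n : ℕ, Ioo (T / (n + 3)) (T - T / (n + 3)) = Ioo 0 T := by
  ext t
  simp only [mem_iUnion, mem_Ioo]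
  constructor
  · rintro ⟨n, h1, h2⟩
    have : 0 < T / (n + 3 : ℝ) := by positivity
    exact ⟨by linarith, by linarith⟩
  · rintro ⟨h1, h2⟩
    obtain ⟨n, hn⟩ := exists_nat_gt (T / min t (T - t))
    have hm : 0 < min t (T - t) := lt_min h1 (by linarith)
    have h3 : T / (n + 3 : ℝ) < min t (T - t) := by
      rw [div_lt_iff₀ hm] at hn
      rw [div_lt_iff₀ (by positivity)]
      nlinarith
    exact ⟨n, h3.trans_le (min_le_left _ _), by linarith [h3.trans_le (min_le_right _ _)]⟩

theorem div_lt_sub_div (hT : 0 < T) (n : ℕ) :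
    0 < T / (n + 3 : ℝ) ∧ T / (n + 3 : ℝ) < T - T / (n + 3) ∧ T - T / (n + 3 : ℝ) < T := by
  have h1 : 0 < T / (n + 3 : ℝ) := by positivity
  have h2 : T / (n + 3 : ℝ) ≤ T / 3 := by gcongr; linarith [(n.cast_nonneg : (0 : ℝ) ≤ n)]
  exact ⟨h1, by linarith, by linarith⟩

theorem ae_restrict_Ioo_of_forall {P : ℝ → Prop} (hT : 0 < T)
    (h : ∀ a b, 0 < a → a < b → b < T → ∀ᵐ t ∂(volume.restrict (Ioo a b)), P t) :
    ∀ᵐ t ∂(volume.restrict (Ioo 0 T)), P t := by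
  rw [← iUnion_Ioo_div hT, ae_restrict_iUnion_iff]
  intro n
  obtain ⟨h1, h2, h3⟩ := div_lt_sub_div hT n
  exact h _ _ h1 h2 h3

theorem setLIntegral_Ioo_le_of_forall {g : ℝ → ℝ≥0∞} {K : ℝ≥0∞} (hT : 0 < T)
    (h : ∀ a b, 0 < a → a < b → b < T → ∫⁻ t in Ioo a b, g t ≤ K) :
    ∫⁻ t in Ioo 0 T, g t ≤ K := by
  rw [← iUnion_Ioo_div hT, setLIntegral_iUnion_of_directed]
  · refine iSup_le fun n => ?_
    obtain ⟨h1, h2, h3⟩ := div_lt_sub_div hT n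
    exact h _ _ h1 h2 h3
  · refine Monotone.directed_le fun m n hmn => ?_
    have h1 : T / (n + 3 : ℝ) ≤ T / (m + 3) := by gcongr
    exact Ioo_subset_Ioo h1 (by linarith)

variable {d : ℕ} {F : Type*} [NormedAddCommGroup F]

theorem aemeasurable_eLpNorm_slice {s : ℝ} (hs : 0 < s) {μ : Measure ℝ} [SFinite μ]
    {f : ℝ → Vec d → F} (hf : AEStronglyMeasurable (Function.uncurry f) (μ.prod volume)) :
    AEMeasurable (fun t => eLpNorm (f t) (ENNReal.ofReal s) volume) μ := by
  have h0 : ENNReal.ofReal s ≠ 0 := by simpa using hs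
  simp only [eLpNorm_eq_lintegral_rpow_enorm_toReal h0 ENNReal.ofReal_ne_top,
    ENNReal.toReal_ofReal hs.le]
  exact ((hf.enorm.pow_const s).lintegral_prod_right').pow_const _

theorem prod_restrict_le {a b : ℝ} (ha : 0 ≤ a) (hb : b ≤ T) :
    ((volume : Measure ℝ).restrict (Ioo a b)).prod (volume : Measure (Vec d)) ≤
      ((volume : Measure ℝ).restrict (Ioo 0 T)).prod volume :=
  Measure.prod_mono (Measure.restrict_mono (Ioo_subset_Ioo ha hb) le_rfl) le_rfl

theorem MemLpLoc.ae_memLp {r s : ℝ} (hT : 0 < T) (hr : 0 < r) (hs : 0 < s) {f : ℝ → Vec d → F}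
    (hf : MemLpLoc T r s f) :
    ∀ᵐ t ∂(volume.restrict (Ioo 0 T)), MemLp (f t) (ENNReal.ofReal s) volume := by
  refine ae_restrict_Ioo_of_forall hT fun a b ha hab hb => ?_
  have hm := hf.1.mono_measure (prod_restrict_le (d := d) ha.le hb.le)
  have hfin := ae_lt_top' ((aemeasurable_eLpNorm_slice hs hm).pow_const r)
    (hf.2 a b ha hab hb).ne
  filter_upwards [hm.prodMk_left, hfin] with t h1 h2
  exact ⟨h1, (ENNReal.rpow_lt_top_iff_of_pos hr).1 h2⟩

end TimeLocal

section TimePairing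

variable {d : ℕ} {T p : ℝ}

/-- A function in `L¹(a, b; L^q)` paired with a function bounded in `L^p` uniformly in time. -/
theorem integrable_norm_smul_prod (hp : 2 ≤ p) {f w : ℝ → Vec d → Vec d} {a b : ℝ} {K : ℝ≥0}
    (hf : MemLpLoc T 1 (conjExp p) f) (ha : 0 < a) (hab : a < b) (hb : b < T)
    (hw : AEStronglyMeasurable (Function.uncurry w) ((volume.restrict (Ioo a b)).prod volume))
    (hwK : ∀ t ∈ Ioo a b, eLpNorm (w t) (ENNReal.ofReal p) volume ≤ K) :
    Integrable (fun z : ℝ × Vec d => ‖w z.1 z.2‖ • f z.1 z.2)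
      ((volume.restrict (Ioo a b)).prod volume) := by
  have hPQ := (holderConjugate_conjExp hp).ennrealOfReal
  have hm := hf.1.mono_measure (prod_restrict_le (d := d) ha.le hb.le)
  have hint : AEStronglyMeasurable (fun z : ℝ × Vec d => ‖w z.1 z.2‖ • f z.1 z.2)
    ((volume.restrict (Ioo a b)).prod volume) := hw.norm.smul hm
  refine ⟨hint, ?_⟩
  rw [hasFiniteIntegral_iff_enorm, lintegral_prod _ hint.enorm]
  calc _ ≤ ∫⁻ t in Ioo a b, K * eLpNorm (f t) (ENNReal.ofReal (conjExp p)) volume ^ (1 : ℝ) := by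
        refine lintegral_mono_ae ?_
        filter_upwards [ae_restrict_mem measurableSet_Ioo, hm.prodMk_left, hw.prodMk_left]
          with t ht h1 h2
        simp only [enorm_smul, enorm_norm, ENNReal.rpow_one]
        have h3 := lintegral_enorm_mul_le (P := ENNReal.ofReal p)
          (Q := ENNReal.ofReal (conjExp p)) h2.norm h1.norm
        simp only [enorm_mul, enorm_norm, eLpNorm_norm] at h3
        refine h3.trans ?_
        exact (mul_le_mul_left (hwK t ht) _)
    _ < ∞ := by
        rw [lintegral_const_mul' _ _ ENNReal.coe_ne_top]
        exact ENNReal.mul_lt_top ENNReal.coe_lt_top (hf.2 a b ha hab hb)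

theorem integrable_inner_prod (hp : 2 ≤ p) {f w : ℝ → Vec d → Vec d} {a b : ℝ} {K : ℝ≥0}
    (hf : MemLpLoc T 1 (conjExp p) f) (ha : 0 < a) (hab : a < b) (hb : b < T)
    (hw : AEStronglyMeasurable (Function.uncurry w) ((volume.restrict (Ioo a b)).prod volume))
    (hwK : ∀ t ∈ Ioo a b, eLpNorm (w t) (ENNReal.ofReal p) volume ≤ K) :
    Integrable (fun z : ℝ × Vec d => inner ℝ (f z.1 z.2) (w z.1 z.2))
      ((volume.restrict (Ioo a b)).prod volume) := by
  have hm := hf.1.mono_measure (prod_restrict_le (d := d) ha.le hb.le)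
  refine (integrable_norm_smul_prod hp hf ha hab hb hw hwK).mono (hm.inner hw)
    (Eventually.of_forall fun z => ?_)
  rw [norm_smul, norm_norm, mul_comm]
  exact norm_inner_le_norm _ _

theorem intervalIntegrable_integral_inner (hp : 2 ≤ p) {f w : ℝ → Vec d → Vec d} {a b : ℝ}
    {K : ℝ≥0} (hf : MemLpLoc T 1 (conjExp p) f) (ha : 0 < a) (hab : a < b) (hb : b < T)
    (hw : AEStronglyMeasurable (Function.uncurry w) ((volume.restrict (Ioo a b)).prod volume))
    (hwK : ∀ t ∈ Ioo a b, eLpNorm (w t) (ENNReal.ofReal p) volume ≤ K) :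
    IntervalIntegrable (fun t => ∫ x, inner ℝ (f t x) (w t x)) volume a b := by
  rw [intervalIntegrable_iff_integrableOn_Ioo_of_le hab.le]
  exact (integrable_inner_prod hp hf ha hab hb hw hwK).integral_prod_left

theorem aestronglyMeasurable_uncurry_const {w : Vec d → Vec d} (hw : AEStronglyMeasurable w volume)
    (μ : Measure ℝ) [SFinite μ] :
    AEStronglyMeasurable (Function.uncurry fun _ : ℝ => w) (μ.prod volume) :=
  hw.comp_snd

/-- Fubini's theorem for the pairing of a time-independent field with an increment of a function
which is absolutely continuous in time with values in `L^q`. -/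
theorem integral_inner_intervalIntegral (hp : 2 ≤ p) {f : ℝ → Vec d → Vec d} {w : Vec d → Vec d}
    {a b : ℝ} (hf : MemLpLoc T 1 (conjExp p) f) (ha : 0 < a) (hab : a < b) (hb : b < T)
    (hw : MemLp w (ENNReal.ofReal p) volume) :
    ∫ x, inner ℝ (∫ t in a..b, f t x) (w x) = ∫ t in a..b, ∫ x, inner ℝ (f t x) (w x) := by
  have hwm := aestronglyMeasurable_uncurry_const hw.1 ((volume : Measure ℝ).restrict (Ioo a b))
  have hwK : ∀ t ∈ Ioo a b, eLpNorm ((fun _ : ℝ => w) t) (ENNReal.ofReal p) volume ≤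
      (eLpNorm w (ENNReal.ofReal p) volume).toNNReal := fun _ _ =>
    (ENNReal.coe_toNNReal hw.2.ne).ge
  have h1 := integrable_norm_smul_prod hp hf ha hab hb hwm hwK
  have h2 := integrable_inner_prod hp hf ha hab hb hwm hwK
  simp only [intervalIntegral.integral_of_le hab.le, integral_Ioc_eq_integral_Ioo]
  rw [integral_integral_swap h2]
  refine integral_congr_ae ?_
  filter_upwards [h1.prod_left_ae] with x hx
  -- `f · x` is known to be integrable only where `w x ≠ 0`
  rcases eq_or_ne (w x) 0 with h0 | h0
  · simp [h0]
  have hx' : Integrable (fun t => f t x) (volume.restrict (Ioo a b)) := by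
    refine (hx.smul (‖w x‖⁻¹)).congr (Eventually.of_forall fun t => ?_)
    simp [smul_smul, h0]
  simp only [real_inner_comm (w x)]
  exact (integral_inner hx' (w x)).symm

theorem integral_sub_inner_eq (hp : 2 ≤ p) {v dt : ℝ → Vec d → Vec d} {w : Vec d → Vec d}
    {a b : ℝ} (hdt : MemLpLoc T 1 (conjExp p) dt) (ha : 0 < a) (hab : a < b) (hb : b < T)
    (hderiv : ∀ᵐ x ∂(volume : Measure (Vec d)),
      pPower p (v b x) - pPower p (v a x) = ∫ r in a..b, dt r x)
    (hw : MemLp w (ENNReal.ofReal p) volume) :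
    ∫ x, inner ℝ (pPower p (v b x) - pPower p (v a x)) (w x) =
      ∫ t in a..b, ∫ x, inner ℝ (dt t x) (w x) := by
  rw [← integral_inner_intervalIntegral hp hdt ha hab hb hw]
  refine integral_congr_ae ?_
  filter_upwards [hderiv] with x hx
  rw [hx]

end TimePairing

section Continuity

variable {d : ℕ} {T p : ℝ} {v : ℝ → Vec d → Vec d}

/-- Continuity as a curve in the Banach space `Lp`; the value `0` outside `[0, T)` is immaterial. -/
theorem ContinuousInLp.continuousOn_toLp (hp : 1 ≤ p) (h : ContinuousInLp T p v) :
    haveI : Fact (1 ≤ ENNReal.ofReal p) := ⟨by simpa using hp⟩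
    ContinuousOn (fun t => if ht : t ∈ Ico 0 T then (h.1 t ht).toLp (v t) else 0) (Ico 0 T) := by
  have : Fact (1 ≤ ENNReal.ofReal p) := ⟨by simpa using hp⟩
  intro t₀ ht₀
  rw [ContinuousWithinAt, tendsto_iff_edist_tendsto_0]
  refine (h.2 t₀ ht₀).congr' ?_
  filter_upwards [self_mem_nhdsWithin] with t ht
  rw [dif_pos ht, dif_pos ht₀, Lp.edist_toLp_toLp]

theorem integral_norm_rpow_eq (hp : 0 < p) {f : Vec d → Vec d}
    (hf : MemLp f (ENNReal.ofReal p) volume) :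
    ∫ x, ‖f x‖ ^ p = (eLpNorm f (ENNReal.ofReal p) volume).toReal ^ p := by
  rw [ENNReal.toReal_rpow, eLpNorm_rpow_eq f hp, ← ofReal_integral_rpow hp hf,
    ENNReal.toReal_ofReal (integral_nonneg fun x => by positivity)]

theorem ContinuousInLp.continuousOn_integral (hp : 1 ≤ p) (h : ContinuousInLp T p v) :
    ContinuousOn (fun t => ∫ x, ‖v t x‖ ^ p) (Ico 0 T) := by
  have : Fact (1 ≤ ENNReal.ofReal p) := ⟨by simpa using hp⟩
  refine ((h.continuousOn_toLp hp).norm.rpow_const fun _ _ => .inr (by linarith)).congr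
    fun t ht => ?_
  simp only [dif_pos ht, Lp.norm_toLp]
  exact integral_norm_rpow_eq (by linarith) (h.1 t ht)

theorem ContinuousInLp.exists_eLpNorm_le (hp : 1 ≤ p) (h : ContinuousInLp T p v) {a b : ℝ}
    (ha : 0 ≤ a) (hb : b < T) :
    ∃ K : ℝ≥0, ∀ t ∈ Icc a b, eLpNorm (v t) (ENNReal.ofReal p) volume ≤ K := by
  have : Fact (1 ≤ ENNReal.ofReal p) := ⟨by simpa using hp⟩
  have hsub : Icc a b ⊆ Ico 0 T := fun t ht => ⟨ha.trans ht.1, ht.2.trans_lt hb⟩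
  obtain ⟨K, hK⟩ := isCompact_Icc.exists_bound_of_continuousOn
    ((h.continuousOn_toLp hp).mono hsub)
  refine ⟨K.toNNReal, fun t ht => ?_⟩
  have := hK t ht
  rw [dif_pos (hsub ht), Lp.norm_toLp] at this
  rw [← ENNReal.ofReal_toReal (h.1 t (hsub ht)).2.ne]
  exact ENNReal.ofReal_le_ofReal this

theorem ContinuousInLp.exists_eLpNorm_sub_le (hp : 1 ≤ p) (h : ContinuousInLp T p v) {a b : ℝ}
    (ha : 0 ≤ a) (hb : b < T) {η : ℝ≥0} (hη : 0 < η) :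
    ∃ δ > 0, ∀ s ∈ Icc a b, ∀ t ∈ Icc a b, |s - t| < δ →
      eLpNorm (v s - v t) (ENNReal.ofReal p) volume ≤ η := by
  have : Fact (1 ≤ ENNReal.ofReal p) := ⟨by simpa using hp⟩
  have hsub : Icc a b ⊆ Ico 0 T := fun t ht => ⟨ha.trans ht.1, ht.2.trans_lt hb⟩
  have hu := isCompact_Icc.uniformContinuousOn_of_continuous
    ((h.continuousOn_toLp hp).mono hsub)
  rw [EMetric.uniformContinuousOn_iff] at hu
  obtain ⟨δ, hδ, H⟩ := hu η (by simpa using hη)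
  obtain ⟨δ', hδ', hle⟩ := ENNReal.lt_iff_exists_nnreal_btwn.1 hδ
  refine ⟨δ', by simpa using hδ', fun s hs t ht hst => ?_⟩
  have := H hs ht (lt_of_le_of_lt (by
    rw [edist_dist, Real.dist_eq, ← ENNReal.ofReal_coe_nnreal]
    exact ENNReal.ofReal_le_ofReal hst.le) hle)
  rw [dif_pos (hsub hs), dif_pos (hsub ht), Lp.edist_toLp_toLp] at this
  exact this.le

/-- A function that does not increase over any short subinterval does not increase. -/
theorem le_of_forall_short_le {f : ℝ → ℝ} {a b δ : ℝ} (hab : a ≤ b) (hδ : 0 < δ)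
    (h : ∀ s t, a ≤ s → s < t → t ≤ b → t - s < δ → f t ≤ f s) : f b ≤ f a := by
  have key : ∀ n : ℕ, ∀ t, a ≤ t → t ≤ b → t - a < n * (δ / 2) → f t ≤ f a := by
    intro n
    induction n with
    | zero => intro t h1 _ h3; norm_num at h3; linarith
    | succ n ih =>
      intro t h1 h2 h3
      push_cast at h3
      rcases lt_or_ge (t - a) δ with h4 | h4
      · rcases h1.eq_or_lt with rfl | h1
        · exact le_rfl
        · exact h a t le_rfl h1 h2 h4
      · exact (h (t - δ / 2) t (by linarith) (by linarith) h2 (by linarith)).trans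
          (ih _ (by linarith) (by linarith) (by linarith))
  obtain ⟨n, hn⟩ := exists_nat_gt ((b - a) / (δ / 2))
  exact key n b hab le_rfl ((div_lt_iff₀ (by positivity)).1 hn)

end Continuity

/-! ### The energy inequality -/

section Energy

variable {d : ℕ} {p : ℝ}

theorem integral_inner_le_eLpNorm_mul {P Q : ℝ≥0∞} [P.HolderConjugate Q] {f g : Vec d → Vec d}
    (hf : MemLp f Q volume) (hg : MemLp g P volume) :
    ∫ x, inner ℝ (f x) (g x) ≤ (eLpNorm f Q volume).toReal * (eLpNorm g P volume).toReal := by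
  refine (le_abs_self _).trans ?_
  rw [← Real.norm_eq_abs, ← toReal_enorm, ← ENNReal.toReal_mul]
  refine ENNReal.toReal_mono (ENNReal.mul_ne_top hf.2.ne hg.2.ne) ?_
  have h := lintegral_enorm_mul_le (P := P) (Q := Q) hg.1.norm hf.1.norm
  simp only [eLpNorm_norm] at h
  rw [mul_comm]
  refine (enorm_integral_le_lintegral_enorm _).trans ((lintegral_mono fun x => ?_).trans h)
  rw [enorm_le_iff_norm_le, norm_mul, norm_norm, norm_norm, mul_comm]
  exact norm_inner_le_norm _ _

/-- Convexity of `m ↦ |m|^q / q`, integrated. At `m = |f|^{p-2} f` this function has the value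
`|f|^p / q` and the gradient `f`; here `1 / q = (p - 1) / p`. -/
theorem integral_norm_rpow_sub_le (hp : 2 ≤ p) {f g : Vec d → Vec d}
    (hf : MemLp f (ENNReal.ofReal p) volume) (hg : MemLp g (ENNReal.ofReal p) volume) :
    (p - 1) / p * ∫ x, ‖f x‖ ^ p ≤ (p - 1) / p * (∫ x, ‖g x‖ ^ p) +
      ∫ x, inner ℝ (pPower p (f x) - pPower p (g x)) (f x) := by
  have hp0 : 0 < p := by linarith
  have hPQ := (holderConjugate_conjExp hp).ennrealOfReal
  have hi := integrable_inner ((memLp_pPower hp hf).sub (memLp_pPower hp hg)) hf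
  simp only [Pi.sub_apply] at hi
  rw [← integral_const_mul, ← integral_const_mul, ← integral_add
    ((integrable_norm_rpow hp0 hg).const_mul _) hi]
  refine integral_mono ((integrable_norm_rpow hp0 hf).const_mul _)
    (((integrable_norm_rpow hp0 hg).const_mul _).add hi) fun x => ?_
  have h1 := inner_pPower_sub_le hp (g x) (f x)
  rw [inner_sub_right, inner_pPower_self hp] at h1
  rw [inner_sub_left, inner_pPower_self hp]
  have h2 : inner ℝ (pPower p (g x)) (f x) ≤ (‖f x‖ ^ p + (p - 1) * ‖g x‖ ^ p) / p := by
    rw [le_div_iff₀ hp0]; linarith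
  have h3 : (p - 1) / p * ‖f x‖ ^ p = ‖f x‖ ^ p - ‖f x‖ ^ p / p := by field_simp
  have h4 : (‖f x‖ ^ p + (p - 1) * ‖g x‖ ^ p) / p =
    ‖f x‖ ^ p / p + (p - 1) / p * ‖g x‖ ^ p := by ring
  linarith

/-- The chain rule for the energy, as an inequality. On a short interval convexity bounds the
increment of the energy by the pairing of `∂_t v_p` with the final value of `v`, which by uniform
continuity is close to the current value. -/
theorem energy_sub_le {T : ℝ} (hp : 2 ≤ p) {v dt : ℝ → Vec d → Vec d}
    (hv : ContinuousInLp T p v)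
    (hvm : AEStronglyMeasurable (Function.uncurry v) ((volume.restrict (Ioo 0 T)).prod volume))
    (hdt : MemLpLoc T 1 (conjExp p) dt)
    (hderiv : ∀ s t : ℝ, 0 < s → s < t → t < T → ∀ᵐ x ∂(volume : Measure (Vec d)),
      pPower p (v t x) - pPower p (v s x) = ∫ r in s..t, dt r x)
    {a b : ℝ} (ha : 0 < a) (hab : a < b) (hb : b < T) :
    (p - 1) / p * ∫ x, ‖v b x‖ ^ p ≤ (p - 1) / p * (∫ x, ‖v a x‖ ^ p) +
      ∫ r in a..b, ∫ x, inner ℝ (dt r x) (v r x) := by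
  have hp0 : 0 < p := by linarith
  have hp1 : 1 ≤ p := by linarith
  have hc := holderConjugate_conjExp hp
  have hPQ := hc.ennrealOfReal
  have hsub : Icc a b ⊆ Ico 0 T := fun t ht => ⟨ha.le.trans ht.1, ht.2.trans_lt hb⟩
  have hsub' : Icc a b ⊆ Ioo 0 T := fun t ht => ⟨ha.trans_le ht.1, ht.2.trans_lt hb⟩
  set E : ℝ → ℝ := fun t => (p - 1) / p * ∫ x, ‖v t x‖ ^ p with hE
  set R : ℝ → ℝ := fun r => ∫ x, inner ℝ (dt r x) (v r x) with hR
  set N : ℝ → ℝ := fun r => (eLpNorm (dt r) (ENNReal.ofReal (conjExp p)) volume).toReal with hN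
  obtain ⟨K, hK⟩ := hv.exists_eLpNorm_le hp1 ha.le hb
  have hRi : IntervalIntegrable R volume a b :=
    intervalIntegrable_integral_inner hp hdt ha hab hb
      (hvm.mono_measure (prod_restrict_le ha.le hb.le)) fun t ht => hK t (Ioo_subset_Icc_self ht)
  have hNi : IntervalIntegrable N volume a b := by
    rw [intervalIntegrable_iff_integrableOn_Ioo_of_le hab.le]
    refine integrable_toReal_of_lintegral_ne_top
      (aemeasurable_eLpNorm_slice hc.symm.pos (hdt.1.mono_measure (prod_restrict_le ha.le hb.le)))
      ?_
    simpa only [ENNReal.rpow_one] using (hdt.2 a b ha hab hb).ne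
  have hdtm := ae_restrict_of_ae_restrict_of_subset hsub'
    (hdt.ae_memLp (ha.trans (hab.trans hb)) one_pos hc.symm.pos)
  -- the inequality up to an error `η`
  have key : ∀ η : ℝ≥0, 0 < η → E b - E a - (∫ r in a..b, R r) ≤ η * ∫ r in a..b, N r := by
    intro η hη
    obtain ⟨δ, hδ, hδv⟩ := hv.exists_eLpNorm_sub_le hp1 ha.le hb hη
    have hmono : ∀ {s t : ℝ}, a ≤ s → s ≤ t → t ≤ b → uIcc s t ⊆ uIcc a b := by
      intro s t h1 h2 h3
      rw [uIcc_of_le h2, uIcc_of_le hab.le]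
      exact Icc_subset_Icc h1 h3
    have := le_of_forall_short_le
      (f := fun t => E t - (∫ r in a..t, R r) - η * ∫ r in a..t, N r) hab.le hδ ?_
    · simp only [intervalIntegral.integral_same] at this
      linarith
    intro s t has hst htb hts
    have hs0 : 0 < s := ha.trans_le has
    have htT : t < T := htb.trans_lt hb
    have hsplit : ∀ {f : ℝ → ℝ}, IntervalIntegrable f volume a b →
        ∫ r in a..t, f r = (∫ r in a..s, f r) + ∫ r in s..t, f r := fun hf =>
      (intervalIntegral.integral_add_adjacent_intervals (hf.mono_set (hmono le_rfl has
        (hst.le.trans htb))) (hf.mono_set (hmono has hst.le htb))).symm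
    have hRst := hRi.mono_set (hmono has hst.le htb)
    have hNst := hNi.mono_set (hmono has hst.le htb)
    have htmem : t ∈ Icc a b := ⟨has.trans hst.le, htb⟩
    have hvt := hv.1 t (hsub htmem)
    have hconv := integral_norm_rpow_sub_le hp hvt (hv.1 s (hsub ⟨has, hst.le.trans htb⟩))
    rw [integral_sub_inner_eq hp hdt hs0 hst htT (hderiv s t hs0 hst htT) hvt] at hconv
    have hle : ∫ r in s..t, ∫ x, inner ℝ (dt r x) (v t x) ≤ ∫ r in s..t, (R r + η * N r) := by
      refine intervalIntegral.integral_mono_ae_restrict hst.le ?_ (hRst.add (hNst.const_mul _)) ?_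
      · exact intervalIntegrable_integral_inner (w := fun _ => v t) hp hdt hs0 hst htT
          (aestronglyMeasurable_uncurry_const hvt.1 _) fun _ _ => hK t htmem
      filter_upwards [ae_restrict_of_ae_restrict_of_subset (Icc_subset_Icc has htb) hdtm,
        ae_restrict_mem measurableSet_Icc] with r hr hrm
      have hrm' : r ∈ Icc a b := Icc_subset_Icc has htb hrm
      have hvr := hv.1 r (hsub hrm')
      have h1 := integral_inner_le_eLpNorm_mul (P := ENNReal.ofReal p) hr (hvt.sub hvr)
      have h2 : (eLpNorm (v t - v r) (ENNReal.ofReal p) volume).toReal ≤ η :=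
        ENNReal.toReal_le_coe_of_le_coe (hδv t htmem r hrm' (by
          rw [abs_of_nonneg (by linarith [hrm.2])]; linarith [hrm.1]))
      have h3 : ∫ x, inner ℝ (dt r x) ((v t - v r) x) =
          (∫ x, inner ℝ (dt r x) (v t x)) - R r := by
        simp only [Pi.sub_apply, inner_sub_right]
        exact integral_sub (integrable_inner hr hvt) (integrable_inner hr hvr)
      have h4 := mul_le_mul_of_nonneg_left h2
        (ENNReal.toReal_nonneg : 0 ≤ N r)
      linarith
    rw [intervalIntegral.integral_add hRst (hNst.const_mul _),
      intervalIntegral.integral_const_mul] at hle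
    simp only [hsplit hRi, hsplit hNi]
    simp only [hE]
    linarith
  have hA : 0 ≤ ∫ r in a..b, N r :=
    intervalIntegral.integral_nonneg hab.le fun _ _ => ENNReal.toReal_nonneg
  suffices E b - E a - (∫ r in a..b, R r) ≤ 0 by linarith
  refine le_of_forall_pos_le_add fun e he => ?_
  refine (key (e / ((∫ r in a..b, N r) + 1)).toNNReal (by
    rw [Real.toNNReal_pos]; positivity)).trans ?_
  rw [Real.coe_toNNReal _ (by positivity), zero_add, div_mul_eq_mul_div,
    div_le_iff₀ (by linarith)]
  nlinarith

end Energy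

/-! ### A priori bounds -/

namespace IsStrongSolutionWith

variable {d : ℕ} {ζ : Vec d → ℝ} {p ν ε T : ℝ} {v₀ : Vec d → Vec d} {v : ℝ → Vec d → Vec d}
  {π : ℝ → Vec d → ℝ} {Dv Dvp : ℝ → Vec d → Mat d} {dt gπ pL lap : ℝ → Vec d → Vec d}

/-- At almost every time all the spatial statements hold at once. -/
theorem ae_isSlice (h : IsStrongSolutionWith ζ p ν ε T v₀ v π Dv Dvp dt gπ pL lap) (hT : 0 < T)
    (hp : 2 ≤ p) :
    ∀ᵐ t ∂(volume.restrict (Ioo 0 T)),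
      IsSlice ζ p ν ε (v t) (π t) (Dv t) (Dvp t) (dt t) (gπ t) (pL t) (lap t) := by
  have hp0 : 0 < p := by linarith
  have hq := (holderConjugate_conjExp hp).symm.pos
  filter_upwards [ae_restrict_mem measurableSet_Ioo, h.Dv_mem.ae_memLp hT hp0 hp0,
    h.Dvp_mem.ae_memLp hT one_pos hq, h.dtvp_mem.ae_memLp hT one_pos hq,
    h.gradπ_mem.ae_memLp hT one_pos hq, h.pLap_mem.ae_memLp hT one_pos hq,
    h.lap_mem.ae_memLp hT one_pos hq, h.Dv_grad, h.Dvp_grad, h.gradπ_grad, h.pLap_div, h.lap_div,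
    h.momentum, h.div_free] with t ht h1 h2 h3 h4 h5 h6 h7 h8 h9 h10 h11 h12 h13
  exact ⟨h.v_cont.1 t (Ioo_subset_Ico_self ht), h1, h2, h3, h4, h5, h6, h7, h8, h9, h10, h11, h12,
    h13⟩

theorem integrableOn_dissipation (h : IsStrongSolutionWith ζ p ν ε T v₀ v π Dv Dvp dt gπ pL lap)
    (hp : 2 ≤ p) {a b : ℝ} (ha : 0 < a) (hab : a < b) (hb : b < T) :
    IntegrableOn (fun r => (∫⁻ x, ‖Dv r x‖ₑ ^ p).toReal) (Ioo a b) := by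
  have hp0 : 0 < p := by linarith
  have hm := h.Dv_mem.1.mono_measure (prod_restrict_le ha.le hb.le)
  refine integrable_toReal_of_lintegral_ne_top ((hm.enorm.pow_const p).lintegral_prod_right') ?_
  simpa only [eLpNorm_rpow_eq _ hp0] using (h.Dv_mem.2 a b ha hab hb).ne

/-- The energy inequality between two positive times. -/
theorem energy_add_dissipation_le (h : IsStrongSolutionWith ζ p ν ε T v₀ v π Dv Dvp dt gπ pL lap)
    (hd : 0 < d) (hp : 2 ≤ p) (hζ : IsMollifier ζ) (hε : 0 < ε) {a b : ℝ} (ha : 0 < a)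
    (hab : a < b) (hb : b < T) :
    (p - 1) / p * (∫ x, ‖v b x‖ ^ p) + ν * (∫ r in a..b, (∫⁻ x, ‖Dv r x‖ₑ ^ p).toReal) ≤
      (p - 1) / p * ∫ x, ‖v a x‖ ^ p := by
  have hp0 : 0 < p := by linarith
  have h1 := energy_sub_le hp h.v_cont h.v_meas h.dtvp_mem h.dtvp_deriv ha hab hb
  have hsub : Icc a b ⊆ Ioo 0 T := fun t ht => ⟨ha.trans_le ht.1, ht.2.trans_lt hb⟩
  obtain ⟨K, hK⟩ := h.v_cont.exists_eLpNorm_le (by linarith) ha.le hb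
  have hi : IntervalIntegrable (fun r => (∫⁻ x, ‖Dv r x‖ₑ ^ p).toReal) volume a b := by
    rw [intervalIntegrable_iff_integrableOn_Ioo_of_le hab.le]
    exact h.integrableOn_dissipation hp ha hab hb
  have h2 : ∫ r in a..b, ∫ x, inner ℝ (dt r x) (v r x) ≤
      ∫ r in a..b, -ν * (∫⁻ x, ‖Dv r x‖ₑ ^ p).toReal := by
    refine intervalIntegral.integral_mono_ae_restrict hab.le ?_ (hi.const_mul _) ?_
    · exact intervalIntegrable_integral_inner hp h.dtvp_mem ha hab hb
        (h.v_meas.mono_measure (prod_restrict_le ha.le hb.le))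
        fun t ht => hK t (Ioo_subset_Icc_self ht)
    filter_upwards [ae_restrict_of_ae_restrict_of_subset hsub
      (h.ae_isSlice (ha.trans (hab.trans hb)) hp)] with r hr
    have := hr.integral_inner_dt_self_le hd hp hζ hε
    rwa [← neg_mul, ← ENNReal.toReal_ofReal (integral_nonneg fun x => by positivity :
      0 ≤ ∫ x, ‖Dv r x‖ ^ p), ofReal_integral_rpow hp0 hr.Dv_mem] at this
  rw [intervalIntegral.integral_const_mul] at h2
  linarith

/-- The energy is bounded by its initial value, which is its limit as `t → 0`. -/
theorem integral_le_integral_zero (h : IsStrongSolutionWith ζ p ν ε T v₀ v π Dv Dvp dt gπ pL lap)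
    (hd : 0 < d) (hp : 2 ≤ p) (hν : 0 < ν) (hζ : IsMollifier ζ) (hε : 0 < ε) {t : ℝ}
    (ht : 0 ≤ t) (htT : t < T) :
    ∫ x, ‖v t x‖ ^ p ≤ ∫ x, ‖v 0 x‖ ^ p := by
  rcases ht.eq_or_lt with rfl | ht
  · exact le_rfl
  have hcont := h.v_cont.continuousOn_integral (by linarith) 0 ⟨le_rfl, ht.trans htT⟩
  have hlim : Tendsto (fun t => ∫ x, ‖v t x‖ ^ p) (𝓝[>] 0) (𝓝 (∫ x, ‖v 0 x‖ ^ p)) :=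
    hcont.mono_left (by
      rw [← nhdsWithin_Ioo_eq_nhdsGT (ht.trans htT)]
      exact nhdsWithin_mono _ Ioo_subset_Ico_self)
  refine ge_of_tendsto hlim ?_
  filter_upwards [Ioo_mem_nhdsGT ht] with s hs
  have h1 := h.energy_add_dissipation_le hd hp hζ hε hs.1 hs.2 htT
  have h2 : 0 ≤ ∫ r in s..t, (∫⁻ x, ‖Dv r x‖ₑ ^ p).toReal :=
    intervalIntegral.integral_nonneg hs.2.le fun _ _ => ENNReal.toReal_nonneg
  have h3 : 0 < (p - 1) / p := div_pos (by linarith) (by linarith)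
  exact le_of_mul_le_mul_left (by nlinarith [mul_nonneg hν.le h2]) h3

/-- The `L^p` norm never exceeds that of `v₀`. -/
theorem lintegral_enorm_rpow_le (h : IsStrongSolutionWith ζ p ν ε T v₀ v π Dv Dvp dt gπ pL lap)
    (hd : 0 < d) (hp : 2 ≤ p) (hν : 0 < ν) (hζ : IsMollifier ζ) (hε : 0 < ε)
    (hv₀ : MemLp v₀ (ENNReal.ofReal p) volume) {t : ℝ} (ht : 0 ≤ t) (htT : t < T) :
    ∫⁻ x, ‖v t x‖ₑ ^ p ≤ eLpNorm v₀ (ENNReal.ofReal p) volume ^ p := by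
  have hp0 : 0 < p := by linarith
  rw [← ofReal_integral_rpow hp0 (h.v_cont.1 t ⟨ht, htT⟩)]
  refine (ENNReal.ofReal_le_ofReal (h.integral_le_integral_zero hd hp hν hζ hε ht htT)).trans ?_
  rw [ofReal_integral_rpow hp0 (h.v_cont.1 0 ⟨le_rfl, ht.trans_lt htT⟩), eLpNorm_rpow_eq _ hp0]
  refine le_trans (le_of_eq (lintegral_congr_ae ?_))
    (lintegral_enorm_mollify_rpow_le hζ hε hv₀.1 (by linarith))
  filter_upwards [h.v_init] with x hx
  rw [hx]

/-- The total dissipation is bounded in terms of `v₀`. -/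
theorem lintegral_dissipation_le (h : IsStrongSolutionWith ζ p ν ε T v₀ v π Dv Dvp dt gπ pL lap)
    (hd : 0 < d) (hp : 2 ≤ p) (hν : 0 < ν) (hζ : IsMollifier ζ) (hε : 0 < ε) (hT : 0 < T)
    (hv₀ : MemLp v₀ (ENNReal.ofReal p) volume) :
    ∫⁻ t in Ioo 0 T, ∫⁻ x, ‖Dv t x‖ₑ ^ p ≤
      ENNReal.ofReal ν⁻¹ * eLpNorm v₀ (ENNReal.ofReal p) volume ^ p := by
  have hp0 : 0 < p := by linarith
  refine setLIntegral_Ioo_le_of_forall hT fun a b ha hab hb => ?_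
  have h1 := h.energy_add_dissipation_le hd hp hζ hε ha hab hb
  have h2 : 0 ≤ ∫ x, ‖v b x‖ ^ p := integral_nonneg fun x => by positivity
  have h3 : 0 ≤ ∫ x, ‖v a x‖ ^ p := integral_nonneg fun x => by positivity
  have h4 : 0 ≤ (p - 1) / p := div_nonneg (by linarith) hp0.le
  have h5 : (p - 1) / p ≤ 1 := by rw [div_le_one hp0]; linarith
  have h6 : ∫ r in a..b, (∫⁻ x, ‖Dv r x‖ₑ ^ p).toReal ≤ ν⁻¹ * ∫ x, ‖v a x‖ ^ p := by
    rw [inv_mul_eq_div, le_div_iff₀ hν]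
    nlinarith [mul_nonneg h4 h2, mul_le_of_le_one_left h3 h5]
  have haT : a < T := hab.trans hb
  calc ∫⁻ t in Ioo a b, ∫⁻ x, ‖Dv t x‖ₑ ^ p
      = ∫⁻ t in Ioo a b, ENNReal.ofReal (∫⁻ x, ‖Dv t x‖ₑ ^ p).toReal := by
        refine lintegral_congr_ae ?_
        filter_upwards [ae_restrict_of_ae_restrict_of_subset (Ioo_subset_Ioo ha.le hb.le)
          (h.Dv_mem.ae_memLp hT hp0 hp0)] with t ht
        rw [ENNReal.ofReal_toReal]
        rw [← eLpNorm_rpow_eq _ hp0]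
        exact (ENNReal.rpow_lt_top_of_nonneg hp0.le ht.2.ne).ne
    _ = ENNReal.ofReal (∫ r in a..b, (∫⁻ x, ‖Dv r x‖ₑ ^ p).toReal) := by
        rw [intervalIntegral.integral_of_le hab.le, integral_Ioc_eq_integral_Ioo,
          ofReal_integral_eq_lintegral_ofReal (h.integrableOn_dissipation hp ha hab hb)
          (Eventually.of_forall fun _ => ENNReal.toReal_nonneg)]
    _ ≤ ENNReal.ofReal (ν⁻¹ * ∫ x, ‖v a x‖ ^ p) := ENNReal.ofReal_le_ofReal h6
    _ ≤ _ := by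
        rw [ENNReal.ofReal_mul (by positivity),
          ofReal_integral_rpow hp0 (h.v_cont.1 a ⟨ha.le, haT⟩)]
        gcongr
        exact h.lintegral_enorm_rpow_le hd hp hν hζ hε hv₀ ha.le haT

end IsStrongSolutionWith

/-! ### The estimate for time shifts -/

theorem HasWeakPartial.sub {d : ℕ} {i : Fin d} {f₁ f₂ g₁ g₂ : Vec d → ℝ}
    (h₁ : HasWeakPartial i f₁ g₁) (h₂ : HasWeakPartial i f₂ g₂) :
    HasWeakPartial i (fun x => f₁ x - f₂ x) (fun x => g₁ x - g₂ x) := by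
  refine ⟨h₁.1.sub h₂.1, h₁.2.1.sub h₂.2.1, fun φ hφ => ?_⟩
  have hi : ∀ {f : Vec d → ℝ} {ψ : Vec d → ℝ}, LocallyIntegrable f → IsTest ψ →
      Integrable (fun x => f x * ψ x) := fun hf hψ => by
    simpa only [smul_eq_mul, mul_comm] using
      hf.integrable_smul_left_of_hasCompactSupport hψ.1.continuous hψ.2
  simp only [sub_mul]
  rw [integral_sub (hi h₁.1 (hφ.partialD i)) (hi h₂.1 (hφ.partialD i)),
    integral_sub (hi h₁.2.1 hφ) (hi h₂.2.1 hφ), h₁.2.2 φ hφ, h₂.2.2 φ hφ]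
  ring

theorem HasWeakGrad.sub {d : ℕ} {w₁ w₂ : Vec d → Vec d} {A₁ A₂ : Vec d → Mat d}
    (h₁ : HasWeakGrad w₁ A₁) (h₂ : HasWeakGrad w₂ A₂) : HasWeakGrad (w₁ - w₂) (A₁ - A₂) :=
  fun i j => (h₁ i j).sub (h₂ i j)

theorem setLIntegral_Ioo_add_eq {g : ℝ → ℝ≥0∞} (t h : ℝ) :
    ∫⁻ r in Ioo t (t + h), g r = ∫⁻ s in Ioo 0 h, g (t + s) := by
  rw [← lintegral_indicator measurableSet_Ioo, ← lintegral_indicator measurableSet_Ioo,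
    ← lintegral_add_left_eq_self _ t]
  refine lintegral_congr fun s => ?_
  simp only [indicator, mem_Ioo, lt_add_iff_pos_right, add_lt_add_iff_left]

/-- Tonelli's theorem: each point `r` lies in `(t, t + h)` for a set of `t` of measure `h`. -/
theorem lintegral_setLIntegral_Ioo_add {g : ℝ → ℝ≥0∞} (hg : Measurable g) (h : ℝ) :
    ∫⁻ t, ∫⁻ r in Ioo t (t + h), g r = ENNReal.ofReal h * ∫⁻ r, g r := by
  simp only [setLIntegral_Ioo_add_eq]
  rw [lintegral_lintegral_swap (by fun_prop)]
  simp only [lintegral_add_right_eq_self]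
  rw [setLIntegral_const, Real.volume_Ioo, sub_zero, mul_comm]

namespace IsStrongSolutionWith

variable {d : ℕ} {ζ : Vec d → ℝ} {p ν ε T : ℝ} {v₀ : Vec d → Vec d} {v : ℝ → Vec d → Vec d}
  {π : ℝ → Vec d → ℝ} {Dv Dvp : ℝ → Vec d → Mat d} {dt gπ pL lap : ℝ → Vec d → Vec d}

/-- The increment over a time step `h`, measured by monotonicity of `a ↦ |a|^{p-2} a` against the
increment of `v_p`, which is a time integral of the momentum equation. -/
theorem eLpNorm_sub_rpow_le (h : IsStrongSolutionWith ζ p ν ε T v₀ v π Dv Dvp dt gπ pL lap)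
    (hp : 2 ≤ p) {C : ℝ≥0}
    (hC : ∀ᵐ r ∂(volume.restrict (Ioo 0 T)), ∀ {w : Vec d → Vec d} {W : Vec d → Mat d},
      MemLp w (ENNReal.ofReal p) volume → MemLp W (ENNReal.ofReal p) volume → HasWeakGrad w W →
      (∀ᵐ x, ∑ i, W x (i, i) = 0) →
      |∫ x, inner ℝ (dt r x) (w x)| ≤ C * (1 + (∫ x, ‖Dv r x‖ ^ p) + ∫ x, ‖W x‖ ^ p))
    {t k : ℝ} (ht : 0 < t) (hk : 0 < k) (htk : t + k < T)
    (h₁ : IsSlice ζ p ν ε (v t) (π t) (Dv t) (Dvp t) (dt t) (gπ t) (pL t) (lap t))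
    (h₂ : IsSlice ζ p ν ε (v (t + k)) (π (t + k)) (Dv (t + k)) (Dvp (t + k)) (dt (t + k))
      (gπ (t + k)) (pL (t + k)) (lap (t + k))) :
    eLpNorm (v (t + k) - v t) (ENNReal.ofReal p) volume ^ p ≤
      ENNReal.ofReal (2 ^ (p - 1)) * (C *
        ((1 + ENNReal.ofReal (2 ^ p) *
            ((∫⁻ x, ‖Dv (t + k) x‖ₑ ^ p) + ∫⁻ x, ‖Dv t x‖ₑ ^ p)) * ENNReal.ofReal k +
          ∫⁻ r in Ioo t (t + k), ∫⁻ x, ‖Dv r x‖ₑ ^ p)) := by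
  have hp0 : 0 < p := by linarith
  have hPQ := (holderConjugate_conjExp hp).ennrealOfReal
  have htk' : t < t + k := by linarith
  set w := v (t + k) - v t with hw
  set W := Dv (t + k) - Dv t with hW
  have hwm : MemLp w (ENNReal.ofReal p) volume := h₂.v_mem.sub h₁.v_mem
  have hWm : MemLp W (ENNReal.ofReal p) volume := h₂.Dv_mem.sub h₁.Dv_mem
  have hdiv : ∀ᵐ x, ∑ i, W x (i, i) = 0 := by
    filter_upwards [h₁.div_free, h₂.div_free] with x e₁ e₂
    simp [hW, Finset.sum_sub_distrib, e₁, e₂]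
  have hWle : ∫ x, ‖W x‖ ^ p ≤ 2 ^ p * ((∫ x, ‖Dv (t + k) x‖ ^ p) + ∫ x, ‖Dv t x‖ ^ p) := by
    have i₁ := integrable_norm_rpow hp0 h₁.Dv_mem
    have i₂ := integrable_norm_rpow hp0 h₂.Dv_mem
    rw [← integral_add i₂ i₁, ← integral_const_mul]
    exact integral_mono (integrable_norm_rpow hp0 hWm) ((i₂.add i₁).const_mul _)
      fun x => norm_sub_rpow_le hp _ _
  have hmono : ∫ x, ‖w x‖ ^ p ≤
      2 ^ (p - 1) * ∫ r in t..t + k, ∫ x, inner ℝ (dt r x) (w x) := by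
    rw [← integral_sub_inner_eq hp h.dtvp_mem ht htk' htk (h.dtvp_deriv _ _ ht htk' htk) hwm,
      ← integral_const_mul]
    exact integral_mono (integrable_norm_rpow hp0 hwm) ((integrable_inner
      ((memLp_pPower hp h₂.v_mem).sub (memLp_pPower hp h₁.v_mem)) hwm).const_mul _)
      fun x => norm_sub_rpow_le_inner hp _ _
  rw [eLpNorm_rpow_eq _ hp0, ← ofReal_integral_rpow hp0 hwm]
  refine (ENNReal.ofReal_le_ofReal hmono).trans ?_
  rw [ENNReal.ofReal_mul (by positivity)]
  gcongr
  rw [intervalIntegral.integral_of_le htk'.le, integral_Ioc_eq_integral_Ioo]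
  refine (Real.ofReal_le_enorm _).trans ((enorm_integral_le_lintegral_enorm _).trans ?_)
  have hvol : volume (Ioo t (t + k)) = ENNReal.ofReal k := by rw [Real.volume_Ioo]; congr 1; ring
  rw [← hvol, ← setLIntegral_const, ← lintegral_add_left measurable_const,
    ← lintegral_const_mul' _ _ ENNReal.coe_ne_top]
  refine lintegral_mono_ae ?_
  have hsub : Ioo t (t + k) ⊆ Ioo 0 T := Ioo_subset_Ioo ht.le htk.le
  filter_upwards [ae_restrict_of_ae_restrict_of_subset hsub hC,
    ae_restrict_of_ae_restrict_of_subset hsub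
      (h.Dv_mem.ae_memLp (ht.trans (htk'.trans htk)) hp0 hp0)] with r hr hrD
  have hnn : ∀ f : Vec d → Mat d, 0 ≤ ∫ x, ‖f x‖ ^ p := fun f =>
    integral_nonneg fun x => by positivity
  have := hnn (Dv (t + k))
  have := hnn (Dv t)
  have := hnn (Dv r)
  rw [← ofReal_integral_rpow hp0 h₁.Dv_mem, ← ofReal_integral_rpow hp0 h₂.Dv_mem,
    ← ofReal_integral_rpow hp0 hrD, ← ENNReal.ofReal_add (by positivity) (by positivity),
    ← ENNReal.ofReal_mul (by positivity), ← ENNReal.ofReal_one,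
    ← ENNReal.ofReal_add (by positivity) (by positivity),
    ← ENNReal.ofReal_add (by positivity) (by positivity), ← ENNReal.ofReal_coe_nnreal,
    ← ENNReal.ofReal_mul (by positivity), ← ofReal_norm, Real.norm_eq_abs]
  refine ENNReal.ofReal_le_ofReal ((hr hwm hWm (h₂.Dv_grad.sub h₁.Dv_grad) hdiv).trans ?_)
  gcongr ?_ * ?_
  linarith

/-- The time integral of the increments over a step `k` is at most `k` times a constant that depends
only on `p`, `T`, `C` and a bound `B` for the total dissipation. -/
theorem lintegral_eLpNorm_sub_rpow_le
    (h : IsStrongSolutionWith ζ p ν ε T v₀ v π Dv Dvp dt gπ pL lap) (hp : 2 ≤ p) (hT : 0 < T)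
    {C : ℝ≥0}
    (hC : ∀ᵐ r ∂(volume.restrict (Ioo 0 T)), ∀ {w : Vec d → Vec d} {W : Vec d → Mat d},
      MemLp w (ENNReal.ofReal p) volume → MemLp W (ENNReal.ofReal p) volume → HasWeakGrad w W →
      (∀ᵐ x, ∑ i, W x (i, i) = 0) →
      |∫ x, inner ℝ (dt r x) (w x)| ≤ C * (1 + (∫ x, ‖Dv r x‖ ^ p) + ∫ x, ‖W x‖ ^ p))
    {k : ℝ} (hk : 0 < k) {B : ℝ≥0∞}
    (hB : ∫⁻ t in Ioo 0 T, ∫⁻ x, ‖Dv t x‖ₑ ^ p ≤ B) :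
    ∫⁻ t in Ioo 0 (T - k), eLpNorm (v (t + k) - v t) (ENNReal.ofReal p) volume ^ p ≤
      ENNReal.ofReal (2 ^ (p - 1)) * (C *
        ((ENNReal.ofReal T + ENNReal.ofReal (2 ^ p) * (B + B)) + B)) * ENNReal.ofReal k := by
  -- a measurable representative `g` of the dissipation, extended by zero outside `(0, T)`
  have hgm : AEMeasurable (fun t => ∫⁻ x, ‖Dv t x‖ₑ ^ p) (volume.restrict (Ioo 0 T)) :=
    (h.Dv_mem.1.enorm.pow_const p).lintegral_prod_right'
  set g : ℝ → ℝ≥0∞ := (Ioo 0 T).indicator (hgm.mk _) with hg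
  have hgmeas : Measurable g := hgm.measurable_mk.indicator measurableSet_Ioo
  have hgeq : ∀ᵐ t ∂(volume.restrict (Ioo 0 T)), ∫⁻ x, ‖Dv t x‖ₑ ^ p = g t := by
    filter_upwards [hgm.ae_eq_mk, ae_restrict_mem measurableSet_Ioo] with t h1 h2
    rw [hg, indicator_of_mem h2, ← h1]
  have hgB : ∫⁻ t, g t ≤ B := by
    refine le_trans (le_of_eq ?_) hB
    rw [hg, lintegral_indicator measurableSet_Ioo]
    exact lintegral_congr_ae hgm.ae_eq_mk.symm
  have hgood := (h.ae_isSlice hT hp).and hgeq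
  have hgood₁ := ae_restrict_of_ae_restrict_of_subset
    (Ioo_subset_Ioo (le_refl (0 : ℝ)) (by linarith : T - k ≤ T)) hgood
  have hgood₂ := (measurePreserving_add_right (volume : Measure ℝ) k).quasiMeasurePreserving.ae
    ((ae_restrict_iff' measurableSet_Ioo).1 hgood)
  calc _ ≤ ∫⁻ t in Ioo 0 (T - k), ENNReal.ofReal (2 ^ (p - 1)) * (C *
        ((1 + ENNReal.ofReal (2 ^ p) * (g (t + k) + g t)) * ENNReal.ofReal k +
          ∫⁻ r in Ioo t (t + k), g r)) := by
        refine lintegral_mono_ae ?_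
        filter_upwards [hgood₁, ae_restrict_of_ae hgood₂, ae_restrict_mem measurableSet_Ioo]
          with t h1 h2 ht
        have htk : t + k < T := by linarith [ht.2]
        have h2 := h2 ⟨by linarith [ht.1], htk⟩
        refine (h.eLpNorm_sub_rpow_le hp hC ht.1 hk htk h1.1 h2.1).trans (le_of_eq ?_)
        rw [h1.2, h2.2, lintegral_congr_ae (ae_restrict_of_ae_restrict_of_subset
          (Ioo_subset_Ioo ht.1.le htk.le) hgeq)]
    _ = ENNReal.ofReal (2 ^ (p - 1)) * (C *
        (((∫⁻ _ in Ioo 0 (T - k), 1) + ENNReal.ofReal (2 ^ p) *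
          ((∫⁻ t in Ioo 0 (T - k), g (t + k)) + ∫⁻ t in Ioo 0 (T - k), g t)) * ENNReal.ofReal k +
          ∫⁻ t in Ioo 0 (T - k), ∫⁻ r in Ioo t (t + k), g r)) := by
        rw [lintegral_const_mul' _ _ ENNReal.ofReal_ne_top,
          lintegral_const_mul' _ _ ENNReal.coe_ne_top, lintegral_add_left (by fun_prop),
          lintegral_mul_const' _ _ ENNReal.ofReal_ne_top, lintegral_add_left (by fun_prop),
          lintegral_const_mul' _ _ ENNReal.ofReal_ne_top, lintegral_add_left (by fun_prop)]
    _ ≤ ENNReal.ofReal (2 ^ (p - 1)) * (C *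
        ((ENNReal.ofReal T + ENNReal.ofReal (2 ^ p) * (B + B)) * ENNReal.ofReal k +
          ENNReal.ofReal k * B)) := by
        gcongr
        · rw [setLIntegral_const, one_mul, Real.volume_Ioo]
          exact ENNReal.ofReal_le_ofReal (by linarith)
        · refine (setLIntegral_le_lintegral _ _).trans ?_
          rwa [lintegral_add_right_eq_self]
        · exact (setLIntegral_le_lintegral _ _).trans hgB
        · refine (setLIntegral_le_lintegral _ _).trans ?_
          rw [lintegral_setLIntegral_Ioo_add hgmeas]
          gcongr
    _ = _ := by ring

end IsStrongSolutionWith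

/-- The shift estimate with a constant that depends only on `d`, `p`, `ν`, `T` and a bound for the
norm of the initial value. -/
theorem exists_normLpLp_timeShift_sub_rpow_le {d : ℕ} (hd : 2 ≤ d) {p : ℝ} (hp : (d : ℝ) ≤ p)
    {ν : ℝ} (hν : 0 < ν) {T : ℝ} (hT : 0 < T) (M : ℝ≥0) :
    ∃ C : ℝ, 0 < C ∧
      ∀ (ζ : Vec d → ℝ), IsMollifier ζ →
      ∀ (v₀ : Vec d → Vec d), MemLp v₀ (ENNReal.ofReal p) volume →
        eLpNorm v₀ (ENNReal.ofReal p) volume ≤ (M : ℝ≥0∞) →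
      ∀ ε : ℝ, 0 < ε → ε < 1 →
      ∀ (v : ℝ → Vec d → Vec d) (π : ℝ → Vec d → ℝ), IsStrongSolution ζ p ν ε T v₀ v π →
      ∀ h : ℝ, 0 < h → h < T →
        normLpLp p (T - h) (timeShift h v - v) ^ p ≤ ENNReal.ofReal (C * h) := by
  have hd' : (2 : ℝ) ≤ d := by exact_mod_cast hd
  have hp2 : 2 ≤ p := hd'.trans hp
  have hp0 : 0 < p := by linarith
  obtain ⟨C, hC⟩ := exists_abs_integral_inner_dt_le hd hp hν (M ^ p)
  set B : ℝ≥0∞ := ENNReal.ofReal ν⁻¹ * (M : ℝ≥0∞) ^ p with hB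
  set X : ℝ≥0∞ := ENNReal.ofReal (2 ^ (p - 1)) * (C *
    ((ENNReal.ofReal T + ENNReal.ofReal (2 ^ p) * (B + B)) + B)) with hX
  have hBtop : B ≠ ∞ := ENNReal.mul_ne_top ENNReal.ofReal_ne_top
    (ENNReal.rpow_ne_top_of_nonneg hp0.le ENNReal.coe_ne_top)
  have hXtop : X ≠ ∞ := by finiteness
  refine ⟨X.toReal + 1, by positivity, ?_⟩
  intro ζ hζ v₀ hv₀ hM ε hε hε1 v π ⟨Dv, Dvp, dt, gπ, pL, lap, hs⟩ h hh hhT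
  have hMp : eLpNorm v₀ (ENNReal.ofReal p) volume ^ p ≤ (M : ℝ≥0∞) ^ p := by gcongr
  have hdiss : ∫⁻ t in Ioo 0 T, ∫⁻ x, ‖Dv t x‖ₑ ^ p ≤ B :=
    (hs.lintegral_dissipation_le (by lia) hp2 hν hζ hε hT hv₀).trans (by rw [hB]; gcongr)
  have hmain := hs.lintegral_eLpNorm_sub_rpow_le hp2 hT (C := C) (by
    filter_upwards [hs.ae_isSlice hT hp2, ae_restrict_mem measurableSet_Ioo] with r hr hrm
    intro w W hw hW hwW hdiv
    refine hC hr hζ hε hε1 ?_ hw hW hwW hdiv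
    rw [ENNReal.coe_rpow_of_nonneg _ hp0.le]
    exact (hs.lintegral_enorm_rpow_le (by lia) hp2 hν hζ hε hv₀ hrm.1.le hrm.2).trans hMp)
    hh hdiss
  rw [normLpLp, ← ENNReal.rpow_mul, one_div, inv_mul_cancel₀ hp0.ne', ENNReal.rpow_one]
  refine hmain.trans ?_
  rw [ENNReal.ofReal_mul (by positivity)]
  refine mul_le_mul_left ?_ _
  exact (ENNReal.ofReal_toReal hXtop).ge.trans (ENNReal.ofReal_le_ofReal (by linarith))

end PNS

theorem mainTheorem3 (d : ℕ) (hd : 2 ≤ d) (p : ℝ) (hp : (d : ℝ) ≤ p) (ν : ℝ) (hν : 0 < ν)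
    (T : ℝ) (hT : 0 < T) (M : ℝ≥0) :
    (∀ η : ℝ, 0 < η → ∃ δ : ℝ, 0 < δ ∧
      ∀ (ζ : PNS.Vec d → ℝ), PNS.IsMollifier ζ →
      ∀ (v₀ : PNS.Vec d → PNS.Vec d), MemLp v₀ (ENNReal.ofReal p) volume →
        eLpNorm v₀ (ENNReal.ofReal p) volume ≤ (M : ℝ≥0∞) →
      ∀ ε : ℝ, 0 < ε → ε < 1 →
      ∀ (v : ℝ → PNS.Vec d → PNS.Vec d) (π : ℝ → PNS.Vec d → ℝ),
        PNS.IsStrongSolution ζ p ν ε T v₀ v π →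
      ∀ h : ℝ, 0 < h → h < T → h < δ →
        PNS.normLpLp p (T - h) (PNS.timeShift h v - v) ≤ ENNReal.ofReal η) ∧
    (∃ C : ℝ, 0 < C ∧
      ∀ (ζ : PNS.Vec d → ℝ), PNS.IsMollifier ζ →
      ∀ (v₀ : PNS.Vec d → PNS.Vec d), MemLp v₀ (ENNReal.ofReal p) volume →
        eLpNorm v₀ (ENNReal.ofReal p) volume ≤ (M : ℝ≥0∞) →
      ∀ ε : ℝ, 0 < ε → ε < 1 →
      ∀ (v : ℝ → PNS.Vec d → PNS.Vec d) (π : ℝ → PNS.Vec d → ℝ),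
        PNS.IsStrongSolution ζ p ν ε T v₀ v π →
      ∀ h : ℝ, 0 < h → h < T →
        PNS.normLpLp p (T - h) (PNS.timeShift h v - v) ^ p ≤ ENNReal.ofReal (C * h)) := by
  have hp0 : 0 < p := lt_of_lt_of_le (by exact_mod_cast (by lia : 0 < d)) hp
  obtain ⟨C, hC, H⟩ := PNS.exists_normLpLp_timeShift_sub_rpow_le hd hp hν hT M
  refine ⟨fun η hη => ⟨η ^ p / C, by positivity, ?_⟩, C, hC, H⟩
  intro ζ hζ v₀ hv₀ hM ε hε hε1 v π hs h hh hhT hhδ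
  rw [← ENNReal.rpow_le_rpow_iff hp0, ENNReal.ofReal_rpow_of_pos hη]
  refine (H ζ hζ v₀ hv₀ hM ε hε hε1 v π hs h hh hhT).trans (ENNReal.ofReal_le_ofReal ?_)
  rw [mul_comm]
  exact ((lt_div_iff₀ hC).1 hhδ).le
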